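/- Notation: $[n]=\{1,\dots,n\}$, and $T(X)=X+\mathbb R\times X+\{\exists,\forall\}$ (disjoint union). **Games.** A *rightward open mean payoff game* (roMPG) $A:m\to n$ consists of a finite set $Q$ of positions, a set of edges $E\subseteq([m]+Q)\times([n]+Q)$, roles $\rho:Q\to\{\exists,\forall\}$ and weights $w:Q\to\mathbb R$, such that each entrance $i\in[m]$ has exactly one successor and each exit $j\in[n]$ has at most one predecessor. An isomorphism of roMPGs of the same arities is a bijection of positions that (fixing entrances and exits) preserves and reflects edges and preserves roles and weights. $\mathbf{roMPG}$ has natural numbers as objects and isomorphism classes of roMPGs as arrows. Its identities and swaps $m+n\to n+m$ are the games without positions that connect the entrances with the corresponding exits. The composite $A;B$ of $A:m\to l$ and $B:l\to n$ has positions $Q^A+Q^B$, the edges of $A$ that do not end in an exit, the edges of $B$ that do not start in an entrance, and an edge $s\to s'$ whenever $s\to j$ in $A$ and $j\to s'$ in $B$ for some $j\in[l]$. The sum $A\oplus B:m+k\to n+l$ of $A:m\to n$ and $B:k\to l$ is the disjoint union (the open ends of $A$ come first). The trace $\mathrm{tr}_l(A):m\to n$ of $A:l+m\to l+n$ has the same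 positions, and an edge $s\to s'$ iff for some $k\ge0$ there are $i_1,\dots,i_k\in[l]$ with $s\to i_1\to\cdots\to i_k\to s'$ in $A$, where the open ends of $s,s'$ are shifted by $l$. **Play semantics.** $\mathbb S^{\mathbb P}_r$ has natural numbers as objects; an arrow $m\to n$ is a function $f:[m]\to T([n])$ such that if $f(i)=k\in[n]$ then $f(j)\ne k$ and $f(j)\notin\mathbb R\times\{k\}$ for all $j\ne i$. Composition $(f;g)(i)$ is: $f(i)$ if $f(i)\in\{\exists,\forall\}$; $g(j)$ if $f(i)=j$; and if $f(i)=(r,j)$ it is $g(j)$, $(r,k)$ or $(r+r',k)$ according as $g(j)\in\{\exists,\forall\}$, $g(j)=k$ or $g(j)=(r',k)$. Identities and swaps are the evident unweighted functions, and $\oplus$ is juxtaposition. For $f:l+m\to l+n$ and $i\in[m]$, let $v_1,v_2,\dots$ be the sequence with $v_1=f(l+i)$ that continues with $v_{j+1}=f(a)$ if $v_j=a$ or $v_j=(r,a)$ with $a\in[l]$, and stops otherwise. If it stops at $v_k\in\{\exists,\forall\}$, then $\mathrm{tr}_l(f)(i)=v_k$. If it stops at the exit $l+b$, with or without a weight,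 then $\mathrm{tr}_l(f)(i)=b$ if none of $v_1,\dots,v_k$ carries a weight, and $\mathrm{tr}_l(f)(i)=(R,b)$ with $R$ the sum of all weights otherwise. If it is infinite, let $r_1,r_2,\dots$ be the weights of those $v_j$ that carry one (there are infinitely many); then $\mathrm{tr}_l(f)(i)=\exists$ if $\liminf_{N\to\infty}\frac1N\sum_{j=1}^N r_j\ge0$, and $\forall$ otherwise. **Semantics of games.** $\mathbb S_r$ is the change of base of $\mathbb S^{\mathbb P}_r$ along the iterated finite powerset: objects are natural numbers, arrows $m\to n$ are finite sets of finite sets of arrows $m\to n$ of $\mathbb S^{\mathbb P}_r$, identities and swaps are $\{\{\mathrm{id}\}\}$ and $\{\{\sigma\}\}$, and $F;G=\{\{f;g\mid f\in F',g\in G'\}\mid F'\in F,G'\in G\}$, $F\oplus G=\{\{f\oplus g\mid f\in F',g\in G'\}\mid F'\in F,G'\in G\}$, $\mathrm{tr}_l(F)=\{\{\mathrm{tr}_l(f)\mid f\in F'\}\mid F'\in F\}$. **The functor.** A (memoryless) $\exists$-strategy on $A$ is a partial function $\tau$ that selects a successor of each position of role $\exists$ that has a successor, and is undefined on the others; $\forall$-strategies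 are defined likewise. Strategies $\tau_\exists,\tau_\forall$ determine a unique maximal play $s_0=i,s_1,s_2,\dots$ from each entrance $i\in[m]$. Its denotation in $T([n])$ is: $s_1$ if $s_1$ is an exit; $(\sum_{j=1}^{N-1}w(s_j),s_N)$ if it ends in an exit $s_N$ with $N>1$; the opponent of $\rho(s_N)$ if it ends in a position $s_N$; and, if it is infinite, $\exists$ if $\liminf_{N\to\infty}\frac1N\sum_{j=1}^Nw(s_j)\ge0$ and $\forall$ otherwise. Let $W(A,\tau_\exists,\tau_\forall):m\to n$ be the arrow of $\mathbb S^{\mathbb P}_r$ that sends $i$ to the denotation of this play. The rightward winning-position functor $\mathcal W_r:\mathbf{roMPG}\to\mathbb S_r$ is the identity on objects and $\mathcal W_r(A)=\{\{W(A,\tau_\exists,\tau_\forall)\mid\tau_\forall\}\mid\tau_\exists\}$ on arrows. **Theorem (compositionality for rightward oMPGs).** With the structure above (monoidal product $+$ on objects, unit $0$), $\mathbf{roMPG}$ and $\mathbb S_r$ are strict traced symmetric monoidal categories, and $\mathcal W_r:\mathbf{roMPG}\to\mathbb S_r$ is a (strict) traced symmetric monoidal functor: it preserves identities and swaps, $\mathcal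 W_r(A;B)=\mathcal W_r(A);\mathcal W_r(B)$, $\mathcal W_r(A\oplus B)=\mathcal W_r(A)\oplus\mathcal W_r(B)$, and $\mathcal W_r(\mathrm{tr}_l(A))=\mathrm{tr}_l(\mathcal W_r(A))$. -/

import Mathlib

open Filter

namespace MPG

universe u v

/-! ### Strict traced symmetric monoidal categories with objects the natural numbers -/

/-- The data of a strict traced symmetric monoidal category whose objects are the natural numbers
and whose monoidal product is addition on objects, with unit `0`.  Composition `comp f g` is
written in diagrammatic order, and `tr l` closes the first `l` wires. -/
structure TracedData where
  Hom : ℕ → ℕ → Type u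
  id : ∀ m, Hom m m
  comp : ∀ {m l n}, Hom m l → Hom l n → Hom m n
  sum : ∀ {m n k l}, Hom m n → Hom k l → Hom (m + k) (n + l)
  swap : ∀ m n, Hom (m + n) (n + m)
  tr : ∀ l {m n}, Hom (l + m) (l + n) → Hom m n

namespace TracedData

/-- Transport of an arrow along equalities of its source and target. -/
def cast (C : TracedData.{u}) {m m' n n' : ℕ} (hm : m = m') (hn : n = n') (f : C.Hom m n) :
    C.Hom m' n' := hm ▸ hn ▸ f

/-- The axioms of a strict traced symmetric monoidal category. -/
structure IsTSMC (C : TracedData.{u}) : Prop where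
  -- category
  id_comp : ∀ {m n} (f : C.Hom m n), C.comp (C.id m) f = f
  comp_id : ∀ {m n} (f : C.Hom m n), C.comp f (C.id n) = f
  assoc : ∀ {m n k l} (f : C.Hom m n) (g : C.Hom n k) (h : C.Hom k l),
    C.comp (C.comp f g) h = C.comp f (C.comp g h)
  -- strict monoidal structure
  sum_id : ∀ m n, C.sum (C.id m) (C.id n) = C.id (m + n)
  sum_comp : ∀ {m n k m' n' k'} (f : C.Hom m n) (g : C.Hom n k)
    (f' : C.Hom m' n') (g' : C.Hom n' k'),
    C.sum (C.comp f g) (C.comp f' g') = C.comp (C.sum f f') (C.sum g g')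
  sum_assoc : ∀ {m n m' n' m'' n''} (f : C.Hom m n) (g : C.Hom m' n') (h : C.Hom m'' n''),
    C.cast (Nat.add_assoc m m' m'') (Nat.add_assoc n n' n'') (C.sum (C.sum f g) h) =
      C.sum f (C.sum g h)
  zero_sum : ∀ {m n} (f : C.Hom m n),
    C.cast (Nat.zero_add m) (Nat.zero_add n) (C.sum (C.id 0) f) = f
  sum_zero : ∀ {m n} (f : C.Hom m n),
    C.cast (Nat.add_zero m) (Nat.add_zero n) (C.sum f (C.id 0)) = f
  -- symmetry
  swap_natural : ∀ {m n k l} (f : C.Hom m n) (g : C.Hom k l),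
    C.comp (C.sum f g) (C.swap n l) = C.comp (C.swap m k) (C.sum g f)
  swap_swap : ∀ m n, C.comp (C.swap m n) (C.swap n m) = C.id (m + n)
  swap_sum : ∀ m n k,
    C.swap m (n + k) =
      C.comp
        (C.cast (Nat.add_assoc m n k) (Nat.add_assoc n m k) (C.sum (C.swap m n) (C.id k)))
        (C.cast rfl (Nat.add_assoc n k m).symm (C.sum (C.id n) (C.swap m k)))
  -- trace: naturality in the source and in the target
  tr_natural_left : ∀ {l m m' n} (g : C.Hom m m') (f : C.Hom (l + m') (l + n)),
    C.tr l (C.comp (C.sum (C.id l) g) f) = C.comp g (C.tr l f)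
  tr_natural_right : ∀ {l m n n'} (f : C.Hom (l + m) (l + n)) (g : C.Hom n n'),
    C.tr l (C.comp f (C.sum (C.id l) g)) = C.comp (C.tr l f) g
  -- trace: dinaturality
  tr_dinatural : ∀ {l l' m n} (f : C.Hom (l + m) (l' + n)) (g : C.Hom l' l),
    C.tr l (C.comp f (C.sum g (C.id n))) = C.tr l' (C.comp (C.sum g (C.id m)) f)
  -- trace: vanishing
  tr_zero : ∀ {m n} (f : C.Hom (0 + m) (0 + n)),
    C.tr 0 f = C.cast (Nat.zero_add m) (Nat.zero_add n) f
  tr_add : ∀ {l k m n} (f : C.Hom ((l + k) + m) ((l + k) + n)),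
    C.tr (l + k) f = C.tr k (C.tr l (C.cast (Nat.add_assoc l k m) (Nat.add_assoc l k n) f))
  -- trace: superposing
  tr_sum : ∀ {l m n m' n'} (f : C.Hom (l + m) (l + n)) (g : C.Hom m' n'),
    C.tr l (C.cast (Nat.add_assoc l m m') (Nat.add_assoc l n n') (C.sum f g)) =
      C.sum (C.tr l f) g
  -- trace: yanking
  tr_swap : ∀ m, C.tr m (C.swap m m) = C.id m

/-- `F` is (the action on arrows of) a strict traced symmetric monoidal functor which is the
identity on objects. -/
structure IsTracedFunctor (C : TracedData.{u}) (D : TracedData.{v})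
    (F : ∀ {m n : ℕ}, C.Hom m n → D.Hom m n) : Prop where
  map_id : ∀ m, F (C.id m) = D.id m
  map_comp : ∀ {m l n} (f : C.Hom m l) (g : C.Hom l n), F (C.comp f g) = D.comp (F f) (F g)
  map_sum : ∀ {m n k l} (f : C.Hom m n) (g : C.Hom k l), F (C.sum f g) = D.sum (F f) (F g)
  map_swap : ∀ m n, F (C.swap m n) = D.swap m n
  map_tr : ∀ {l m n} (f : C.Hom (l + m) (l + n)), F (C.tr l f) = D.tr l (F f)

open Classical in
/-- Change of base along the iterated finite powerset functor: an arrow is a finite set of finite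
sets of arrows, and the operations act elementwise. -/
noncomputable def changeBase (C : TracedData.{u}) : TracedData.{u} where
  Hom m n := Finset (Finset (C.Hom m n))
  id m := {{C.id m}}
  comp F G := Finset.image₂ (Finset.image₂ C.comp) F G
  sum F G := Finset.image₂ (Finset.image₂ C.sum) F G
  swap m n := {{C.swap m n}}
  tr l _ _ F := F.image (Finset.image (C.tr l))

end TracedData

/-! ### Rightward open mean payoff games -/

/-- The two players: `ex` is the player `∃`, and `all` is the player `∀`. -/
inductive Role where
  | ex : Role
  | all : Role

/-- The other player. -/
def Role.opponent : Role → Role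
  | .ex => .all
  | .all => .ex

/-- A rightward open mean payoff game from `m` to `n`: `Fin m` are the entrances, `Fin n` the
exits, `Q` the positions, `E` the edges.  Each entrance has exactly one successor and each exit has
at most one predecessor. -/
structure ROMPG (m n : ℕ) where
  Q : Type
  finite : Finite Q
  E : Fin m ⊕ Q → Fin n ⊕ Q → Prop
  role : Q → Role
  w : Q → ℝ
  entrance : ∀ i : Fin m, ∃! t, E (.inl i) t
  exit : ∀ (j : Fin n) (s s' : Fin m ⊕ Q), E s (.inl j) → E s' (.inl j) → s = s'

namespace ROMPG

/-- The game without positions that connects the entrance `i` with the exit `σ i`. -/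
def wire {m n : ℕ} (σ : Fin m ≃ Fin n) : ROMPG m n where
  Q := Empty
  finite := inferInstance
  E s t := ∃ i, s = .inl i ∧ t = .inl (σ i)
  role := Empty.elim
  w := Empty.elim
  entrance i := ⟨.inl (σ i), ⟨i, rfl, rfl⟩, by
    rintro t ⟨i', h, rfl⟩
    cases h
    rfl⟩
  exit j s s' := by
    rintro ⟨i, rfl, h⟩ ⟨i', rfl, h'⟩
    have h2 : σ i = σ i' := by
      rw [← Sum.inl.inj h, ← Sum.inl.inj h']
    rw [σ.injective h2]

/-- The edges of a sequential composition. -/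
def compE {m l n : ℕ} (A : ROMPG m l) (B : ROMPG l n) :
    Fin m ⊕ (A.Q ⊕ B.Q) → Fin n ⊕ (A.Q ⊕ B.Q) → Prop
  | .inl i, .inr (.inl a) => A.E (.inl i) (.inr a)
  | .inr (.inl a'), .inr (.inl a) => A.E (.inr a') (.inr a)
  | .inl i, .inl k => ∃ j, A.E (.inl i) (.inl j) ∧ B.E (.inl j) (.inl k)
  | .inl i, .inr (.inr b) => ∃ j, A.E (.inl i) (.inl j) ∧ B.E (.inl j) (.inr b)
  | .inr (.inl a), .inl k => ∃ j, A.E (.inr a) (.inl j) ∧ B.E (.inl j) (.inl k)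
  | .inr (.inl a), .inr (.inr b) => ∃ j, A.E (.inr a) (.inl j) ∧ B.E (.inl j) (.inr b)
  | .inr (.inr b), .inl k => B.E (.inr b) (.inl k)
  | .inr (.inr b'), .inr (.inr b) => B.E (.inr b') (.inr b)
  | .inr (.inr _), .inr (.inl _) => False

/-- Sequential composition. -/
def comp {m l n : ℕ} (A : ROMPG m l) (B : ROMPG l n) : ROMPG m n where
  Q := A.Q ⊕ B.Q
  finite := by
    have := A.finite
    have := B.finite
    infer_instance
  E := compE A B
  role := Sum.elim A.role B.role
  w := Sum.elim A.w B.w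
  entrance i := by
    obtain ⟨t, ht, hu⟩ := A.entrance i
    dsimp only at ht hu
    rcases t with j | a
    · obtain ⟨t', ht', hu'⟩ := B.entrance j
      dsimp only at ht' hu'
      have key : ∀ j', A.E (.inl i) (.inl j') → j' = j := fun j' h => Sum.inl.inj (hu _ h)
      have key2 : ∀ a, ¬ A.E (.inl i) (.inr a) := fun a h => by cases hu _ h
      refine ⟨Sum.map id Sum.inr t', ?_, ?_⟩
      · rcases t' with k | b <;> exact ⟨j, ht, ht'⟩
      · rintro (k | a | b) h
        · obtain ⟨j', h1, h2⟩ := h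
          rw [key j' h1] at h2
          rw [← hu' _ h2]
          rfl
        · exact absurd h (key2 a)
        · obtain ⟨j', h1, h2⟩ := h
          rw [key j' h1] at h2
          rw [← hu' _ h2]
          rfl
    · have key : ∀ j', ¬ A.E (.inl i) (.inl j') := fun j' h => by cases hu _ h
      refine ⟨.inr (.inl a), ht, ?_⟩
      rintro (k | a' | b) h
      · obtain ⟨j', h1, -⟩ := h
        exact absurd h1 (key j')
      · rw [Sum.inr.inj (hu _ h)]
      · obtain ⟨j', h1, -⟩ := h
        exact absurd h1 (key j')
  exit k s s' h h' := by
    have aux : ∀ j j', B.E (.inl j) (.inl k) → B.E (.inl j') (.inl k) → j = j' :=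
      fun j j' h1 h2 => Sum.inl.inj (B.exit k _ _ h1 h2)
    have aux2 : ∀ j b, B.E (.inl j) (.inl k) → ¬ B.E (.inr b) (.inl k) :=
      fun j b h1 h2 => by cases B.exit k _ _ h1 h2
    rcases s with i | a | b <;> rcases s' with i' | a' | b'
    · obtain ⟨j, h1, h2⟩ := h
      obtain ⟨j', h1', h2'⟩ := h'
      rw [aux _ _ h2 h2'] at h1
      rw [Sum.inl.inj (A.exit _ _ _ h1 h1')]
    · obtain ⟨j, h1, h2⟩ := h
      obtain ⟨j', h1', h2'⟩ := h'
      rw [aux _ _ h2 h2'] at h1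
      cases A.exit _ _ _ h1 h1'
    · obtain ⟨j, h1, h2⟩ := h
      exact absurd h' (aux2 _ _ h2)
    · obtain ⟨j, h1, h2⟩ := h
      obtain ⟨j', h1', h2'⟩ := h'
      rw [aux _ _ h2 h2'] at h1
      cases A.exit _ _ _ h1 h1'
    · obtain ⟨j, h1, h2⟩ := h
      obtain ⟨j', h1', h2'⟩ := h'
      rw [aux _ _ h2 h2'] at h1
      rw [Sum.inr.inj (A.exit _ _ _ h1 h1')]
    · obtain ⟨j, h1, h2⟩ := h
      exact absurd h' (aux2 _ _ h2)
    · obtain ⟨j, h1, h2⟩ := h'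
      exact absurd h (aux2 _ _ h2)
    · obtain ⟨j, h1, h2⟩ := h'
      exact absurd h (aux2 _ _ h2)
    · rw [Sum.inr.inj (B.exit _ _ _ h h')]

/-- The bijection `[m + k] + (P + Q) ≃ ([m] + P) + ([k] + Q)`. -/
def splitEquiv (m k : ℕ) (P Q : Type) :
    Fin (m + k) ⊕ (P ⊕ Q) ≃ (Fin m ⊕ P) ⊕ (Fin k ⊕ Q) :=
  (Equiv.sumCongr finSumFinEquiv.symm (Equiv.refl _)).trans (Equiv.sumSumSumComm _ _ _ _)

theorem splitEquiv_inl {m k : ℕ} {P Q : Type} (x : Fin m ⊕ Fin k) :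
    splitEquiv m k P Q (.inl (finSumFinEquiv x)) = Sum.map Sum.inl Sum.inl x := by
  rcases x with x | x
  · have h : finSumFinEquiv.symm (finSumFinEquiv (Sum.inl x : Fin m ⊕ Fin k)) = .inl x :=
      Equiv.symm_apply_apply _ _
    simp only [splitEquiv, Equiv.trans_apply, Equiv.sumCongr_apply, Sum.map_inl, h]
    rfl
  · have h : finSumFinEquiv.symm (finSumFinEquiv (Sum.inr x : Fin m ⊕ Fin k)) = .inr x :=
      Equiv.symm_apply_apply _ _
    simp only [splitEquiv, Equiv.trans_apply, Equiv.sumCongr_apply, Sum.map_inl, h]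
    rfl

/-- The sum of two games. -/
def sum {m n k l : ℕ} (A : ROMPG m n) (B : ROMPG k l) : ROMPG (m + k) (n + l) where
  Q := A.Q ⊕ B.Q
  finite := by
    have := A.finite
    have := B.finite
    infer_instance
  E s t := Sum.LiftRel A.E B.E (splitEquiv m k A.Q B.Q s) (splitEquiv n l A.Q B.Q t)
  role := Sum.elim A.role B.role
  w := Sum.elim A.w B.w
  entrance i := by
    obtain ⟨i, rfl⟩ := finSumFinEquiv.surjective i
    rw [splitEquiv_inl]
    rcases i with i | i
    · obtain ⟨t, ht, hu⟩ := A.entrance i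
      refine ⟨(splitEquiv n l A.Q B.Q).symm (.inl t), ?_, ?_⟩
      · dsimp only
        rw [Equiv.apply_symm_apply]
        exact .inl ht
      · intro t' h
        rw [Equiv.eq_symm_apply]
        generalize splitEquiv n l A.Q B.Q t' = x at h
        cases h with
        | inl h => rw [hu _ h]
    · obtain ⟨t, ht, hu⟩ := B.entrance i
      refine ⟨(splitEquiv n l A.Q B.Q).symm (.inr t), ?_, ?_⟩
      · dsimp only
        rw [Equiv.apply_symm_apply]
        exact .inr ht
      · intro t' h
        rw [Equiv.eq_symm_apply]
        generalize splitEquiv n l A.Q B.Q t' = x at h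
        cases h with
        | inr h => rw [hu _ h]
  exit j s s' h h' := by
    obtain ⟨j, rfl⟩ := finSumFinEquiv.surjective j
    apply (splitEquiv m k A.Q B.Q).injective
    rw [splitEquiv_inl] at h h'
    generalize splitEquiv m k A.Q B.Q s = x at h
    generalize splitEquiv m k A.Q B.Q s' = x' at h'
    rcases j with j | j
    · cases h with
      | inl h =>
        cases h' with
        | inl h' => rw [A.exit _ _ _ h h']
    · cases h with
      | inr h =>
        cases h' with
        | inr h' => rw [B.exit _ _ _ h h']

/-- `A.Path s t` means that there are `k ≥ 0` and `i₁, …, iₖ` among the first `l` open ends with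
`s → i₁ → ⋯ → iₖ → t` in `A`. -/
inductive Path {l m n : ℕ} (A : ROMPG (l + m) (l + n)) :
    Fin (l + m) ⊕ A.Q → Fin (l + n) ⊕ A.Q → Prop
  | edge {s t} : A.E s t → Path A s t
  | loop {s t} (i : Fin l) : A.E s (.inl (Fin.castAdd n i)) →
      Path A (.inl (Fin.castAdd m i)) t → Path A s t

/-- `[m] + Q → [l + m] + Q`, shifting open ends by `l`. -/
def shift (l : ℕ) {m : ℕ} {Q : Type} : Fin m ⊕ Q → Fin (l + m) ⊕ Q :=
  Sum.map (Fin.natAdd l) id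

theorem shift_injective (l : ℕ) {m : ℕ} {Q : Type} :
    Function.Injective (shift l : Fin m ⊕ Q → Fin (l + m) ⊕ Q) :=
  Sum.map_injective.2 ⟨Fin.natAdd_injective _ _, Function.injective_id⟩

theorem castAdd_ne_natAdd {l m : ℕ} (i : Fin l) (j : Fin m) :
    Fin.castAdd m i ≠ Fin.natAdd l j := by
  intro h
  have h1 := congrArg Fin.val h
  simp at h1
  omega

theorem shift_ne {l m : ℕ} {Q : Type} (s : Fin m ⊕ Q) (i : Fin l) :
    shift l s ≠ .inl (Fin.castAdd m i) := by
  rcases s with s | s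
  · intro h
    exact castAdd_ne_natAdd i s (Sum.inl.inj h).symm
  · intro h
    cases h

theorem eq_shift_or {l m : ℕ} {Q : Type} (s : Fin (l + m) ⊕ Q) :
    (∃ t : Fin m ⊕ Q, s = shift l t) ∨ ∃ i : Fin l, s = .inl (Fin.castAdd m i) := by
  rcases s with s | s
  · refine Fin.addCases (fun i => ?_) (fun i => ?_) s
    · exact .inr ⟨i, rfl⟩
    · exact .inl ⟨.inl i, rfl⟩
  · exact .inl ⟨.inr s, rfl⟩

theorem Path.exists_of_edge {l m n : ℕ} (A : ROMPG (l + m) (l + n)) (s : Fin m ⊕ A.Q)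
    (t : Fin (l + n) ⊕ A.Q) (h : A.E (shift l s) t) :
    ∃ t' : Fin n ⊕ A.Q, A.Path (shift l s) (shift l t') := by
  by_contra! hno
  have step : ∀ i : Fin l, ∃ t, A.E (.inl (Fin.castAdd m i)) t := fun i => (A.entrance _).exists
  -- while no path to a shifted target exists, the wires never end
  have go : ∀ i : Fin l, (∀ t' : Fin n ⊕ A.Q, ¬ A.Path (.inl (Fin.castAdd m i)) (shift l t')) →
      ∃ i' : Fin l, A.E (.inl (Fin.castAdd m i)) (.inl (Fin.castAdd n i')) ∧
        ∀ t' : Fin n ⊕ A.Q, ¬ A.Path (.inl (Fin.castAdd m i')) (shift l t') := by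
    intro i hi
    obtain ⟨t, ht⟩ := step i
    rcases eq_shift_or t with ⟨t', rfl⟩ | ⟨i', rfl⟩
    · exact absurd (Path.edge ht) (hi t')
    · exact ⟨i', ht, fun t' hp => hi t' (Path.loop i' ht hp)⟩
  rcases eq_shift_or t with ⟨t', rfl⟩ | ⟨i₀, rfl⟩
  · exact hno t' (Path.edge h)
  have h₀ : ∀ t' : Fin n ⊕ A.Q, ¬ A.Path (.inl (Fin.castAdd m i₀)) (shift l t') :=
    fun t' hp => hno t' (Path.loop i₀ h hp)
  choose f hf1 hf2 using go
  let x : ℕ → {i : Fin l // ∀ t' : Fin n ⊕ A.Q,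
      ¬ A.Path (.inl (Fin.castAdd m i)) (shift l t')} :=
    fun k => Nat.rec ⟨i₀, h₀⟩ (fun _ y => ⟨f y.1 y.2, hf2 y.1 y.2⟩) k
  have hx : ∀ k, A.E (.inl (Fin.castAdd m (x k).1)) (.inl (Fin.castAdd n (x (k + 1)).1)) :=
    fun k => hf1 _ _
  have inj : ∀ a b, x a = x b → a = b := by
    intro a
    induction a with
    | zero =>
      intro b hab
      cases b with
      | zero => rfl
      | succ b =>
        have h1 := hx b
        rw [← hab] at h1
        exact absurd (A.exit _ _ _ h h1) (shift_ne s _)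
    | succ a ih =>
      intro b hab
      cases b with
      | zero =>
        have h1 := hx a
        rw [hab] at h1
        exact absurd (A.exit _ _ _ h h1) (shift_ne s _)
      | succ b =>
        have h1 := hx a
        rw [hab] at h1
        have h2 := Sum.inl.inj (A.exit _ _ _ h1 (hx b))
        rw [ih b (Subtype.ext (Fin.castAdd_injective _ _ h2))]
  exact not_injective_infinite_finite x (fun a b hab => inj a b hab)

/-- The trace of a game. -/
def tr (l : ℕ) {m n : ℕ} (A : ROMPG (l + m) (l + n)) : ROMPG m n where
  Q := A.Q
  finite := A.finite
  E s t := A.Path (shift l s) (shift l t)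
  role := A.role
  w := A.w
  entrance i := by
    obtain ⟨t, ht, -⟩ := A.entrance (Fin.natAdd l i)
    obtain ⟨t', ht'⟩ := Path.exists_of_edge A (.inl i) t ht
    refine ⟨t', ht', ?_⟩
    intro t'' h
    have uniq : ∀ (s : Fin (l + m) ⊕ A.Q) (u : Fin (l + n) ⊕ A.Q), A.Path s u →
        (∃ i, s = .inl i) → ∀ a, u = shift l a → ∀ b, A.Path s (shift l b) → b = a := by
      intro s u hp
      induction hp with
      | @edge s u h =>
        rintro ⟨i, rfl⟩ a rfl b hb
        cases hb with
        | edge hb => exact shift_injective l ((A.entrance i).unique hb h)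
        | loop j hb _ => exact absurd ((A.entrance i).unique h hb) (shift_ne a j)
      | @loop s u j h _ ih =>
        rintro ⟨i, rfl⟩ a rfl b hb
        cases hb with
        | edge hb => exact absurd ((A.entrance i).unique hb h) (shift_ne b j)
        | loop j' hb hb' =>
          have e := Fin.castAdd_injective _ _ (Sum.inl.inj ((A.entrance i).unique hb h))
          subst e
          exact ih ⟨_, rfl⟩ a rfl b hb'
    exact uniq _ _ ht' ⟨_, rfl⟩ t' rfl t'' h
  exit j s s' h h' := by
    -- the last edge of a path
    have last : ∀ (s : Fin (l + m) ⊕ A.Q) (u : Fin (l + n) ⊕ A.Q), A.Path s u →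
        A.E s u ∨ ∃ i : Fin l, A.Path s (.inl (Fin.castAdd n i)) ∧
          A.E (.inl (Fin.castAdd m i)) u := by
      intro s u hp
      induction hp with
      | edge h => exact .inl h
      | loop i h _ ih =>
        rcases ih with h2 | ⟨i', h2, h3⟩
        · exact .inr ⟨i, Path.edge h, h2⟩
        · exact .inr ⟨i', Path.loop i h h2, h3⟩
    have main : ∀ (s s' : Fin (l + m) ⊕ A.Q) (u : Fin (l + n) ⊕ A.Q), A.Path s u →
        A.Path s' u → (∃ j, u = .inl j) → s = s' ∨
          (∃ i : Fin l, s = .inl (Fin.castAdd m i) ∧ A.Path s' (.inl (Fin.castAdd n i))) ∨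
          (∃ i : Fin l, s' = .inl (Fin.castAdd m i) ∧ A.Path s (.inl (Fin.castAdd n i))) := by
      intro s s' u hp hp' hu
      induction hp with
      | edge h =>
        obtain ⟨j, rfl⟩ := hu
        rcases last _ _ hp' with h2 | ⟨i, h2, h3⟩
        · exact .inl (A.exit _ _ _ h h2)
        · exact .inr (.inl ⟨i, A.exit _ _ _ h h3, h2⟩)
      | loop i h _ ih =>
        rcases ih hp' hu with h2 | ⟨i', h2, h3⟩ | ⟨i', h2, h3⟩
        · exact .inr (.inr ⟨i, h2.symm, Path.edge h⟩)
        · have e := Fin.castAdd_injective _ _ (Sum.inl.inj h2)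
          subst e
          rcases last _ _ h3 with h4 | ⟨i3, h4, h5⟩
          · exact .inl (A.exit _ _ _ h h4)
          · exact .inr (.inl ⟨i3, A.exit _ _ _ h h5, h4⟩)
        · exact .inr (.inr ⟨i', h2, Path.loop i h h3⟩)
    rcases main _ _ _ h h' ⟨_, rfl⟩ with h2 | ⟨i, h2, -⟩ | ⟨i, h2, -⟩
    · exact shift_injective l h2
    · exact absurd h2 (shift_ne s i)
    · exact absurd h2 (shift_ne s' i)

/-! ### Isomorphisms, and the traced category of games -/

/-- An isomorphism of games with the same arities. -/
structure Iso {m n : ℕ} (A B : ROMPG m n) where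
  η : A.Q ≃ B.Q
  edge : ∀ s t, A.E s t ↔ B.E (Sum.map id η s) (Sum.map id η t)
  role_eq : ∀ q, A.role q = B.role (η q)
  w_eq : ∀ q, A.w q = B.w (η q)

/-- The identity isomorphism. -/
def Iso.refl {m n : ℕ} (A : ROMPG m n) : Iso A A where
  η := Equiv.refl _
  edge s t := by simp
  role_eq _ := rfl
  w_eq _ := rfl

/-- The inverse isomorphism. -/
def Iso.symm {m n : ℕ} {A B : ROMPG m n} (e : Iso A B) : Iso B A where
  η := e.η.symm
  edge s t := by rw [e.edge]; simp
  role_eq q := by rw [e.role_eq]; simp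
  w_eq q := by rw [e.w_eq]; simp

/-- Composition of isomorphisms. -/
def Iso.trans {m n : ℕ} {A B C : ROMPG m n} (e : Iso A B) (f : Iso B C) : Iso A C where
  η := e.η.trans f.η
  edge s t := by rw [e.edge, f.edge]; simp
  role_eq q := by rw [e.role_eq, f.role_eq]; rfl
  w_eq q := by rw [e.w_eq, f.w_eq]; rfl

/-- Games are identified if they are isomorphic. -/
instance setoid (m n : ℕ) : Setoid (ROMPG m n) where
  r A B := Nonempty (Iso A B)
  iseqv := ⟨fun A => ⟨Iso.refl A⟩, fun ⟨e⟩ => ⟨e.symm⟩, fun ⟨e⟩ ⟨f⟩ => ⟨e.trans f⟩⟩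

/-- Sequential composition respects isomorphism. -/
def Iso.comp {m l n : ℕ} {A A' : ROMPG m l} {B B' : ROMPG l n} (e : Iso A A') (f : Iso B B') :
    Iso (A.comp B) (A'.comp B') where
  η := Equiv.sumCongr e.η f.η
  edge s t := by
    rcases s with i | a | b <;> rcases t with k | a' | b'
    · exact exists_congr fun j => and_congr (e.edge _ _) (f.edge _ _)
    · exact e.edge _ _
    · exact exists_congr fun j => and_congr (e.edge _ _) (f.edge _ _)
    · exact exists_congr fun j => and_congr (e.edge _ _) (f.edge _ _)
    · exact e.edge _ _
    · exact exists_congr fun j => and_congr (e.edge _ _) (f.edge _ _)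
    · exact f.edge _ _
    · exact Iff.rfl
    · exact f.edge _ _
  role_eq := by
    rintro (q | q)
    · exact e.role_eq q
    · exact f.role_eq q
  w_eq := by
    rintro (q | q)
    · exact e.w_eq q
    · exact f.w_eq q

theorem splitEquiv_map {m k : ℕ} {P Q P' Q' : Type} (f : P → P') (g : Q → Q')
    (s : Fin (m + k) ⊕ (P ⊕ Q)) :
    splitEquiv m k P' Q' (Sum.map id (Sum.map f g) s) =
      Sum.map (Sum.map id f) (Sum.map id g) (splitEquiv m k P Q s) := by
  rcases s with i | p | q
  · obtain ⟨x, rfl⟩ := finSumFinEquiv.surjective i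
    rw [Sum.map_inl, id, splitEquiv_inl, splitEquiv_inl]
    rcases x with x | x <;> rfl
  · rfl
  · rfl

/-- The sum respects isomorphism. -/
def Iso.sum {m n k l : ℕ} {A A' : ROMPG m n} {B B' : ROMPG k l} (e : Iso A A') (f : Iso B B') :
    Iso (A.sum B) (A'.sum B') where
  η := Equiv.sumCongr e.η f.η
  edge s t := by
    change Fin (m + k) ⊕ (A.Q ⊕ B.Q) at s
    change Fin (n + l) ⊕ (A.Q ⊕ B.Q) at t
    change Sum.LiftRel A.E B.E _ _ ↔ Sum.LiftRel A'.E B'.E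
      (splitEquiv m k A'.Q B'.Q (Sum.map id (Sum.map e.η f.η) s))
      (splitEquiv n l A'.Q B'.Q (Sum.map id (Sum.map e.η f.η) t))
    rw [splitEquiv_map, splitEquiv_map]
    generalize splitEquiv m k A.Q B.Q s = x
    generalize splitEquiv n l A.Q B.Q t = y
    rcases x with x | x <;> rcases y with y | y
    · simpa using e.edge x y
    · simp
    · simp
    · simpa using f.edge x y
  role_eq := by
    rintro (q | q)
    · exact e.role_eq q
    · exact f.role_eq q
  w_eq := by
    rintro (q | q)
    · exact e.w_eq q
    · exact f.w_eq q

theorem Iso.path {l m n : ℕ} {A B : ROMPG (l + m) (l + n)} (e : Iso A B)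
    (s : Fin (l + m) ⊕ A.Q) (t : Fin (l + n) ⊕ A.Q) (h : A.Path s t) :
    B.Path (Sum.map id e.η s) (Sum.map id e.η t) := by
  induction h with
  | edge h => exact Path.edge ((e.edge _ _).1 h)
  | loop i h _ ih => exact Path.loop i ((e.edge _ _).1 h) ih

/-- The trace respects isomorphism. -/
def Iso.tr {l m n : ℕ} {A B : ROMPG (l + m) (l + n)} (e : Iso A B) :
    Iso (A.tr l) (B.tr l) where
  η := e.η
  edge s t := by
    have hs : ∀ (k : ℕ) (x : Fin k ⊕ A.Q),
        shift l (Sum.map id e.η x) = Sum.map id e.η (shift l x) := by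
      rintro k (x | x) <;> rfl
    change Fin m ⊕ A.Q at s
    change Fin n ⊕ A.Q at t
    change A.Path (shift l s) (shift l t) ↔
      B.Path (shift l (Sum.map id e.η s)) (shift l (Sum.map id e.η t))
    rw [hs, hs]
    refine ⟨e.path _ _, fun h => ?_⟩
    have h2 := e.symm.path _ _ h
    simpa [Iso.symm] using h2
  role_eq := e.role_eq
  w_eq := e.w_eq

end ROMPG

/-- The traced symmetric monoidal category of (isomorphism classes of) rightward open mean payoff
games. -/
def roMPG : TracedData.{1} where
  Hom m n := Quotient (ROMPG.setoid m n)
  id m := ⟦ROMPG.wire (Equiv.refl (Fin m))⟧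
  comp := Quotient.map₂ ROMPG.comp fun _ _ ⟨e⟩ _ _ ⟨f⟩ => ⟨e.comp f⟩
  sum := Quotient.map₂ ROMPG.sum fun _ _ ⟨e⟩ _ _ ⟨f⟩ => ⟨e.sum f⟩
  swap m n := ⟦ROMPG.wire (finAddFlip : Fin (m + n) ≃ Fin (n + m))⟧
  tr l := Quotient.map (ROMPG.tr l) fun _ _ ⟨e⟩ => ⟨e.tr⟩

/-! ### The semantic category of plays -/

/-- `T(X) = X + ℝ × X + {∃, ∀}`: the result of a play. -/
inductive T (X : Type) where
  | direct (x : X) : T X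
  | weighted (r : ℝ) (x : X) : T X
  | winner (p : Role) : T X

namespace T

/-- The action of `T` on functions. -/
def map {X Y : Type} (f : X → Y) : T X → T Y
  | direct x => direct (f x)
  | weighted r x => weighted r (f x)
  | winner p => winner p

/-- The result of a play that has result `z : T X` and then continues with `g`. -/
def bind {X Y : Type} : T X → (X → T Y) → T Y
  | winner p, _ => winner p
  | direct j, g => g j
  | weighted r j, g =>
    match g j with
    | winner p => winner p
    | direct k => weighted r k
    | weighted r' k => weighted (r + r') k

/-- `z.Lands k` means that `z` is the exit `k`, with or without a weight. -/
def Lands {X : Type} (z : T X) (k : X) : Prop := z = direct k ∨ ∃ r, z = weighted r k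

end T

/-- The realizability condition. -/
def Realizable {m n : ℕ} (f : Fin m → T (Fin n)) : Prop :=
  ∀ i k, f i = .direct k → ∀ j, j ≠ i → ¬ (f j).Lands k

/-- The mean payoff condition for a sequence of weights. -/
def MeanPayoff (a : ℕ → ℝ) : Prop :=
  0 ≤ liminf (fun N : ℕ => (((∑ j ∈ Finset.range N, a j) / N : ℝ) : EReal)) atTop

namespace Play

theorem realizable_wire {m n : ℕ} (σ : Fin m ≃ Fin n) :
    Realizable fun i => T.direct (σ i) := by
  rintro i k h j hj (h2 | ⟨r, h2⟩)
  · rw [← h] at h2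
    exact hj (σ.injective (T.direct.inj h2))
  · cases h2

theorem lands_bind {X Y : Type} {z : T X} {g : X → T Y} {k : Y} (h : (z.bind g).Lands k) :
    ∃ j, z.Lands j ∧ (g j).Lands k := by
  rcases z with j | ⟨r, j⟩ | p
  · exact ⟨j, .inl rfl, h⟩
  · refine ⟨j, .inr ⟨r, rfl⟩, ?_⟩
    simp only [T.bind] at h
    rcases hg : g j with k' | ⟨r', k'⟩ | p <;> rw [hg] at h
    · rcases h with h | ⟨r2, h⟩
      · cases h
      · cases h
        exact .inl rfl
    · rcases h with h | ⟨r2, h⟩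
      · cases h
      · cases h
        exact .inr ⟨r', rfl⟩
    · rcases h with h | ⟨r2, h⟩ <;> cases h
  · rcases h with h | ⟨r2, h⟩ <;> cases h

theorem bind_eq_direct {X Y : Type} {z : T X} {g : X → T Y} {k : Y}
    (h : z.bind g = .direct k) : ∃ j, z = .direct j ∧ g j = .direct k := by
  rcases z with j | ⟨r, j⟩ | p
  · exact ⟨j, rfl, h⟩
  · simp only [T.bind] at h
    rcases hg : g j with k' | ⟨r', k'⟩ | p <;> rw [hg] at h <;> cases h
  · cases h

theorem realizable_comp {m l n : ℕ} {f : Fin m → T (Fin l)} {g : Fin l → T (Fin n)}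
    (hf : Realizable f) (hg : Realizable g) : Realizable fun i => (f i).bind g := by
  intro i k h i' hi hl
  obtain ⟨j, h1, h2⟩ := bind_eq_direct h
  obtain ⟨j', h3, h4⟩ := lands_bind hl
  by_cases hj : j' = j
  · subst hj
    exact hf i _ h1 i' hi h3
  · exact hg j k h2 j' hj h4

/-- The sum of two families of results. -/
def sum {m n k l : ℕ} (f : Fin m → T (Fin n)) (g : Fin k → T (Fin l)) :
    Fin (m + k) → T (Fin (n + l)) :=
  Fin.addCases (fun i => (f i).map (Fin.castAdd l)) (fun j => (g j).map (Fin.natAdd n))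

theorem map_eq_direct {X Y : Type} {f : X → Y} {z : T X} {y : Y} (h : z.map f = .direct y) :
    ∃ x, z = .direct x ∧ f x = y := by
  rcases z with x | ⟨r, x⟩ | p <;> simp [T.map] at h
  exact ⟨x, rfl, h⟩

theorem map_lands {X Y : Type} {f : X → Y} {z : T X} {y : Y} (h : (z.map f).Lands y) :
    ∃ x, z.Lands x ∧ f x = y := by
  rcases z with x | ⟨r, x⟩ | p <;> simp [T.map, T.Lands] at h
  · exact ⟨x, .inl rfl, h⟩
  · exact ⟨x, .inr ⟨r, rfl⟩, h⟩

theorem realizable_sum {m n k l : ℕ} {f : Fin m → T (Fin n)} {g : Fin k → T (Fin l)}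
    (hf : Realizable f) (hg : Realizable g) : Realizable (sum f g) := by
  intro i y
  refine Fin.addCases (fun i => ?_) (fun i => ?_) i <;> intro h j <;>
    refine Fin.addCases (fun j => ?_) (fun j => ?_) j <;> intro hj hl <;>
    simp only [sum, Fin.addCases_left, Fin.addCases_right] at h hl <;>
    obtain ⟨x, hx, rfl⟩ := map_eq_direct h <;> obtain ⟨x', hx', e⟩ := map_lands hl
  · rw [Fin.castAdd_injective _ _ e] at hx'
    exact hf i x hx j (fun e => hj (by rw [e])) hx'
  · exact ROMPG.castAdd_ne_natAdd _ _ e.symm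
  · exact ROMPG.castAdd_ne_natAdd _ _ e
  · rw [Fin.natAdd_injective _ _ e] at hx'
    exact hg i x hx j (fun e => hj (by rw [e])) hx'

/-- The results of `f`, with the first `l` exits separated from the others. -/
def split {l m n : ℕ} (f : Fin (l + m) → T (Fin (l + n))) (i : Fin (l + m)) :
    T (Fin l ⊕ Fin n) :=
  (f i).map finSumFinEquiv.symm

/-- The traced sequence `v₁, v₂, …` of results of `f : l + m → l + n` starting from `i`, where
`tdp f i j` is `vⱼ₊₁`, or `none` if that is undefined: the sequence starts with the result of the
entrance `i`, is continued from each of the first `l` open ends, and stops elsewhere. -/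
def tdp {l m n : ℕ} (f : Fin (l + m) → T (Fin (l + n))) (i : Fin m) :
    ℕ → Option (T (Fin l ⊕ Fin n))
  | 0 => some (split f (Fin.natAdd l i))
  | j + 1 =>
    match tdp f i j with
    | some (.direct (.inl a)) => some (split f (Fin.castAdd m a))
    | some (.weighted _ (.inl a)) => some (split f (Fin.castAdd m a))
    | _ => none

/-- The weight of an element of a traced sequence. -/
def tdpWeight {X : Type} : Option (T X) → ℝ
  | some (.weighted r _) => r
  | _ => 0

/-- Whether an element of a traced sequence carries a weight. -/
def IsWeighted {X : Type} (z : Option (T X)) : Prop := ∃ r x, z = some (.weighted r x)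

open Classical in
/-- The outcome of a traced sequence.  If it is infinite, the mean payoff condition is applied to
the sequence of weights that remains when the elements without weight are skipped. -/
noncomputable def tdpOutcome {l n : ℕ} (v : ℕ → Option (T (Fin l ⊕ Fin n))) : T (Fin n) :=
  if ∃ j, v (j + 1) = none then
    -- `N` is the index of the last element
    let N := sInf {j | v (j + 1) = none}
    match v N with
    | some (.winner p) => .winner p
    | some (.direct (.inr k)) =>
      if ∃ j < N, IsWeighted (v j) then
        .weighted (∑ j ∈ Finset.range (N + 1), tdpWeight (v j)) k
      else .direct k
    | some (.weighted _ (.inr k)) => .weighted (∑ j ∈ Finset.range (N + 1), tdpWeight (v j)) k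
    -- the remaining cases do not occur for the last element of a traced sequence
    | _ => .winner .all
  else if MeanPayoff fun j => tdpWeight (v (Nat.nth (fun j => IsWeighted (v j)) j)) then
    .winner .ex
  else .winner .all

/-- The trace of a family of results. -/
noncomputable def tr (l : ℕ) {m n : ℕ} (f : Fin (l + m) → T (Fin (l + n))) (i : Fin m) :
    T (Fin n) :=
  tdpOutcome (tdp f i)

theorem split_eq_direct {l m n : ℕ} {f : Fin (l + m) → T (Fin (l + n))} {i : Fin (l + m)}
    {y : Fin l ⊕ Fin n} (h : split f i = .direct y) : f i = .direct (finSumFinEquiv y) := by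
  obtain ⟨x, hx, rfl⟩ := map_eq_direct h
  rw [hx, Equiv.apply_symm_apply]

theorem split_lands {l m n : ℕ} {f : Fin (l + m) → T (Fin (l + n))} {i : Fin (l + m)}
    {y : Fin l ⊕ Fin n} (h : (split f i).Lands y) : (f i).Lands (finSumFinEquiv y) := by
  obtain ⟨x, hx, rfl⟩ := map_lands h
  rwa [Equiv.apply_symm_apply]

theorem tdp_succ {l m n : ℕ} {f : Fin (l + m) → T (Fin (l + n))} {i : Fin m} {j : ℕ}
    {z : T (Fin l ⊕ Fin n)} (h : tdp f i (j + 1) = some z) :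
    ∃ a u, tdp f i j = some u ∧ u.Lands (.inl a) ∧ z = split f (Fin.castAdd m a) := by
  rw [tdp] at h
  split at h
  · rename_i a h2
    exact ⟨a, _, h2, .inl rfl, (Option.some.inj h).symm⟩
  · rename_i r a h2
    exact ⟨a, _, h2, .inr ⟨r, rfl⟩, (Option.some.inj h).symm⟩
  · cases h

theorem tdp_unique {l m n : ℕ} {f : Fin (l + m) → T (Fin (l + n))} (hf : Realizable f)
    (i j : Fin m) : ∀ (N M : ℕ) (y : Fin l ⊕ Fin n) (z : T (Fin l ⊕ Fin n)),
    (∀ t < N, ¬ IsWeighted (tdp f i t)) → tdp f i N = some (.direct y) →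
    tdp f j M = some z → z.Lands y → i = j := by
  intro N
  induction N with
  | zero =>
    intro M y z _ h hz hl
    have h1 := split_eq_direct (Option.some.inj h)
    cases M with
    | zero =>
      cases hz
      by_contra hij
      exact hf _ _ h1 _ (fun e => hij (Fin.natAdd_injective _ _ e).symm) (split_lands hl)
    | succ M =>
      obtain ⟨a, u, -, -, rfl⟩ := tdp_succ hz
      exact absurd (split_lands hl) (hf _ _ h1 _ (ROMPG.castAdd_ne_natAdd _ _))
  | succ N ih =>
    intro M y z hw h hz hl
    obtain ⟨a, u, hu, hul, e⟩ := tdp_succ h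
    have h1 := split_eq_direct e.symm
    cases M with
    | zero =>
      cases hz
      exact absurd (split_lands hl) (hf _ _ h1 _ (ROMPG.castAdd_ne_natAdd _ _).symm)
    | succ M =>
      obtain ⟨b, u', hu', hul', rfl⟩ := tdp_succ hz
      have hab : b = a := by
        by_contra hab
        exact hf _ _ h1 _ (fun e => hab (Fin.castAdd_injective _ _ e)) (split_lands hl)
      subst hab
      rcases hul with rfl | ⟨r, rfl⟩
      · exact ih M _ _ (fun t ht => hw t (Nat.lt_succ_of_lt ht)) hu hu' hul'
      · exact absurd ⟨r, _, hu⟩ (hw N (Nat.lt_succ_self N))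

theorem tr_eq_direct {l m n : ℕ} {f : Fin (l + m) → T (Fin (l + n))} {i : Fin m} {k : Fin n}
    (h : tr l f i = .direct k) :
    ∃ N, (∀ t < N, ¬ IsWeighted (tdp f i t)) ∧ tdp f i N = some (.direct (.inr k)) := by
  unfold tr tdpOutcome at h
  split at h
  · refine ⟨sInf {j | tdp f i (j + 1) = none}, ?_⟩
    dsimp only at h
    split at h
    · cases h
    · rename_i hk
      split at h
      · cases h
      · rename_i hw
        cases h
        push Not at hw
        exact ⟨hw, hk⟩
    · cases h
    · cases h
  · split at h <;> cases h

theorem tr_lands {l m n : ℕ} {f : Fin (l + m) → T (Fin (l + n))} {i : Fin m} {k : Fin n}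
    (h : (tr l f i).Lands k) :
    ∃ N z, tdp f i N = some z ∧ z.Lands (.inr k) := by
  unfold tr tdpOutcome at h
  split at h
  · refine ⟨sInf {j | tdp f i (j + 1) = none}, ?_⟩
    dsimp only at h
    split at h
    · rcases h with h | ⟨r, h⟩ <;> cases h
    · rename_i hk
      split at h
      · rcases h with h | ⟨r, h⟩ <;> cases h
        exact ⟨_, hk, .inl rfl⟩
      · rcases h with h | ⟨r, h⟩ <;> cases h
        exact ⟨_, hk, .inl rfl⟩
    · rename_i hk
      rcases h with h | ⟨r, h⟩ <;> cases h
      exact ⟨_, hk, .inr ⟨_, rfl⟩⟩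
    · rcases h with h | ⟨r, h⟩ <;> cases h
  · split at h <;> rcases h with h | ⟨r, h⟩ <;> cases h

theorem realizable_tr {l m n : ℕ} {f : Fin (l + m) → T (Fin (l + n))} (hf : Realizable f) :
    Realizable (tr l f) := by
  intro i k h j hj hl
  obtain ⟨N, hw, hN⟩ := tr_eq_direct h
  obtain ⟨M, z, hz, hzl⟩ := tr_lands hl
  exact hj (tdp_unique hf i j N M _ z hw hN hz hzl).symm

end Play

/-- The semantic category of plays. -/
noncomputable def SP : TracedData.{0} where
  Hom m n := {f : Fin m → T (Fin n) // Realizable f}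
  id m := ⟨fun i => .direct i, Play.realizable_wire (Equiv.refl (Fin m))⟩
  comp f g := ⟨fun i => (f.1 i).bind g.1, Play.realizable_comp f.2 g.2⟩
  sum f g := ⟨Play.sum f.1 g.1, Play.realizable_sum f.2 g.2⟩
  swap m n := ⟨fun i => .direct (finAddFlip i : Fin (n + m)), Play.realizable_wire finAddFlip⟩
  tr l _ _ f := ⟨Play.tr l f.1, Play.realizable_tr f.2⟩

/-- The semantic category of rightward open mean payoff games. -/
noncomputable def Sr : TracedData.{0} := SP.changeBase

/-! ### Play graphs and their outcomes -/

/-- A rightward open play graph: a game in which every entrance and position has at most one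
successor. -/
structure ROPG (m n : ℕ) extends ROMPG m n where
  det : ∀ s t t', E s t → E s t' → t = t'

namespace ROPG

variable {m n : ℕ}

open Classical in
/-- The successor of an entrance or position, if there is one. -/
noncomputable def next (C : ROPG m n) (s : Fin m ⊕ C.Q) : Option (Fin n ⊕ C.Q) :=
  if h : ∃ t, C.E s t then some h.choose else none

/-- The play `s₀ = i, s₁, s₂, …` from the entrance `i`, where `C.play i j` is `sⱼ₊₁`, or `none` if
the play has ended before. -/
noncomputable def play (C : ROPG m n) (i : Fin m) : ℕ → Option (Fin n ⊕ C.Q)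
  | 0 => C.next (.inl i)
  | j + 1 =>
    match C.play i j with
    | some (.inr q) => C.next (.inr q)
    | _ => none

/-- The weight of an element of a play. -/
def weight (C : ROPG m n) : Option (Fin n ⊕ C.Q) → ℝ
  | some (.inr q) => C.w q
  | _ => 0

open Classical in
/-- The outcome of a play `v = (s₁, s₂, …)`. -/
noncomputable def playOutcome (C : ROPG m n) (v : ℕ → Option (Fin n ⊕ C.Q)) : T (Fin n) :=
  if ∃ j, v (j + 1) = none then
    -- `N` is the index of the last element
    let N := sInf {j | v (j + 1) = none}
    match v N with
    | some (.inl k) =>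
      if N = 0 then .direct k else .weighted (∑ j ∈ Finset.range N, C.weight (v j)) k
    | some (.inr q) => .winner (C.role q).opponent
    -- this case does not occur, since every entrance has a successor
    | none => .winner .all
  else if MeanPayoff fun j => C.weight (v j) then .winner .ex
  else .winner .all

/-- The outcome of the play from the entrance `i`. -/
noncomputable def outcome (C : ROPG m n) (i : Fin m) : T (Fin n) :=
  C.playOutcome (C.play i)

theorem next_eq_some_iff (C : ROPG m n) (s : Fin m ⊕ C.Q) (t : Fin n ⊕ C.Q) :
    C.next s = some t ↔ C.E s t := by
  unfold next
  split
  · rename_i h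
    constructor
    · intro e
      rw [← Option.some.inj e]
      exact h.choose_spec
    · intro ht
      rw [C.det _ _ _ h.choose_spec ht]
  · rename_i h
    constructor
    · intro e
      cases e
    · intro ht
      exact absurd ⟨t, ht⟩ h

theorem lands_outcome (C : ROPG m n) {i : Fin m} {k : Fin n} (h : (C.outcome i).Lands k) :
    C.E (.inl i) (.inl k) ∨ ∃ q, C.E (.inr q) (.inl k) := by
  have key : ∀ N, C.play i N = some (.inl k) →
      C.E (.inl i) (.inl k) ∨ ∃ q, C.E (.inr q) (.inl k) := by
    intro N hN
    cases N with
    | zero => exact .inl ((C.next_eq_some_iff _ _).1 hN)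
    | succ N =>
      rw [play] at hN
      split at hN
      · exact .inr ⟨_, (C.next_eq_some_iff _ _).1 hN⟩
      · cases hN
  unfold outcome playOutcome at h
  split at h
  · dsimp only at h
    split at h
    · rename_i hk
      split at h
      · rcases h with h | ⟨r, h⟩ <;> cases h
        exact key _ hk
      · rcases h with h | ⟨r, h⟩ <;> cases h
        exact key _ hk
    · rcases h with h | ⟨r, h⟩ <;> cases h
    · rcases h with h | ⟨r, h⟩ <;> cases h
  · split at h <;> rcases h with h | ⟨r, h⟩ <;> cases h

theorem outcome_eq_direct (C : ROPG m n) {i : Fin m} {k : Fin n}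
    (h : C.outcome i = .direct k) : C.E (.inl i) (.inl k) := by
  unfold outcome playOutcome at h
  split at h
  · dsimp only at h
    split at h
    · rename_i hk
      split at h
      · rename_i h0
        cases h
        rw [h0] at hk
        exact (C.next_eq_some_iff _ _).1 hk
      · cases h
    · cases h
    · cases h
  · split at h <;> cases h

theorem realizable_outcome (C : ROPG m n) : Realizable C.outcome := by
  intro i k h j hj hl
  have h1 := C.outcome_eq_direct h
  rcases C.lands_outcome hl with h2 | ⟨q, h2⟩
  · exact hj (Sum.inl.inj (C.exit _ _ _ h2 h1))
  · cases C.exit _ _ _ h2 h1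

/-- The solution functor on arrows: a play graph is mapped to the outcomes of its plays. -/
noncomputable def solution (C : ROPG m n) : SP.Hom m n := ⟨C.outcome, C.realizable_outcome⟩

theorem next_iso {C D : ROPG m n} (e : ROMPG.Iso C.toROMPG D.toROMPG) (s : Fin m ⊕ C.Q) :
    D.next (Sum.map id e.η s) = (C.next s).map (Sum.map id e.η) := by
  rcases h : C.next s with _ | t
  · rcases h2 : D.next (Sum.map id e.η s) with _ | u
    · rfl
    · rw [next_eq_some_iff] at h2
      have h3 : u = Sum.map id e.η (Sum.map id e.η.symm u) := by simp
      rw [h3, ← e.edge, ← next_eq_some_iff, h] at h2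
      cases h2
  · rw [next_eq_some_iff, e.edge, ← next_eq_some_iff] at h
    exact h

theorem play_iso {C D : ROPG m n} (e : ROMPG.Iso C.toROMPG D.toROMPG) (i : Fin m) (j : ℕ) :
    D.play i j = (C.play i j).map (Sum.map id e.η) := by
  induction j with
  | zero => exact next_iso e (.inl i)
  | succ j ih =>
    rw [play, play, ih]
    rcases C.play i j with _ | k | q
    · rfl
    · rfl
    · exact next_iso e (.inr q)

theorem solution_iso {C D : ROPG m n} (e : ROMPG.Iso C.toROMPG D.toROMPG) :
    C.solution = D.solution := by
  apply Subtype.ext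
  funext i
  change C.playOutcome (C.play i) = D.playOutcome (D.play i)
  have hw : ∀ z, D.weight (Option.map (Sum.map id e.η) z) = C.weight z := by
    rintro (_ | k | q)
    · rfl
    · rfl
    · exact (e.w_eq q).symm
  have hn : ∀ j, D.play i j = none ↔ C.play i j = none := fun j => by
    rw [play_iso e, Option.map_eq_none_iff]
  have hN : sInf {j | D.play i (j + 1) = none} = sInf {j | C.play i (j + 1) = none} := by
    simp only [hn]
  have hwt : (fun j => D.weight (D.play i j)) = fun j => C.weight (C.play i j) := by
    funext j
    rw [play_iso e, hw]
  unfold playOutcome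
  by_cases h : ∃ j, C.play i (j + 1) = none
  · have h' : ∃ j, D.play i (j + 1) = none := h.imp fun j hj => (hn _).2 hj
    rw [if_pos h, if_pos h']
    dsimp only
    rw [hN, play_iso e]
    have hs := fun N => congrArg (fun g : ℕ → ℝ => ∑ j ∈ Finset.range N, g j) hwt
    dsimp only at hs
    rw [hs]
    rcases C.play i (sInf {j | C.play i (j + 1) = none}) with _ | k | q
    · rfl
    · rfl
    · exact congrArg (fun p => T.winner (Role.opponent p)) (e.role_eq q)
  · have h' : ¬ ∃ j, D.play i (j + 1) = none := fun h' => h (h'.imp fun j hj => (hn _).1 hj)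
    rw [if_neg h, if_neg h', hwt]

end ROPG

/-! ### Strategies and the winning-position functor -/

namespace ROMPG

variable {m n : ℕ}

/-- Memoryless strategies of the player `p`: partial functions that choose a successor of each
position of `p` that has one. -/
def Strategy (A : ROMPG m n) (p : Role) : Type :=
  {τ : {q : A.Q // A.role q = p} → Option (Fin n ⊕ A.Q) //
    ∀ q, (∀ t, τ q = some t → A.E (.inr q.1) t) ∧ (τ q = none → ∀ t, ¬ A.E (.inr q.1) t)}

noncomputable instance (A : ROMPG m n) (p : Role) : Fintype (A.Strategy p) := by
  have := A.finite
  unfold Strategy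
  exact Fintype.ofFinite _

/-- The edges of the play graph induced by two strategies. -/
def inducedE (A : ROMPG m n) (τ : A.Strategy .ex) (σ : A.Strategy .all) :
    Fin m ⊕ A.Q → Fin n ⊕ A.Q → Prop
  | .inl i, t => A.E (.inl i) t
  | .inr q, t => (∃ h : A.role q = .ex, τ.1 ⟨q, h⟩ = some t) ∨
      ∃ h : A.role q = .all, σ.1 ⟨q, h⟩ = some t

theorem inducedE_le (A : ROMPG m n) (τ : A.Strategy .ex) (σ : A.Strategy .all)
    (s : Fin m ⊕ A.Q) (t : Fin n ⊕ A.Q) (h : A.inducedE τ σ s t) : A.E s t := by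
  rcases s with i | q
  · exact h
  · rcases h with ⟨h1, h2⟩ | ⟨h1, h2⟩
    · exact (τ.2 _).1 _ h2
    · exact (σ.2 _).1 _ h2

/-- The play graph induced by two strategies. -/
def induced (A : ROMPG m n) (τ : A.Strategy .ex) (σ : A.Strategy .all) : ROPG m n where
  Q := A.Q
  finite := A.finite
  E := A.inducedE τ σ
  role := A.role
  w := A.w
  entrance := A.entrance
  exit j s s' h h' := A.exit j s s' (A.inducedE_le τ σ _ _ h) (A.inducedE_le τ σ _ _ h')
  det s t t' h h' := by
    rcases s with i | q
    · exact (A.entrance i).unique h h'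
    · rcases h with ⟨h1, h2⟩ | ⟨h1, h2⟩ <;> rcases h' with ⟨h3, h4⟩ | ⟨h3, h4⟩
      · exact Option.some.inj (h2.symm.trans h4)
      · rw [h1] at h3
        cases h3
      · rw [h1] at h3
        cases h3
      · exact Option.some.inj (h2.symm.trans h4)

open Classical in
/-- The winning positions of a game: for each strategy of `∃`, the set of the outcomes of the
plays against all strategies of `∀`. -/
noncomputable def winning (A : ROMPG m n) : Sr.Hom m n :=
  Finset.univ.image fun τ : A.Strategy .ex =>
    Finset.univ.image fun σ : A.Strategy .all => (A.induced τ σ).solution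

/-- The transport of strategies along an isomorphism. -/
def Iso.strategyFun {A B : ROMPG m n} (e : Iso A B) (p : Role) (τ : A.Strategy p) :
    B.Strategy p :=
  ⟨fun q => (τ.1 ⟨e.η.symm q.1, by rw [e.role_eq, Equiv.apply_symm_apply, q.2]⟩).map
    (Sum.map id e.η), by
    intro q
    constructor
    · intro t ht
      obtain ⟨u, hu, rfl⟩ := Option.map_eq_some_iff.1 ht
      have h := (e.edge _ _).1 ((τ.2 _).1 u hu)
      simpa using h
    · intro ht t h
      have h1 := (τ.2 _).2 (Option.map_eq_none_iff.1 ht) (Sum.map id e.η.symm t)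
      rw [e.edge] at h1
      apply h1
      simpa using h⟩

theorem Iso.strategyFun_surjective {A B : ROMPG m n} (e : Iso A B) (p : Role) :
    Function.Surjective (e.strategyFun p) := by
  intro τ
  refine ⟨e.symm.strategyFun p τ, ?_⟩
  apply Subtype.ext
  funext ⟨q, hq⟩
  have h : ∀ q' (hq' : B.role q' = p), q' = q →
      ((τ.1 ⟨q', hq'⟩).map (Sum.map id e.η.symm)).map (Sum.map id e.η) = τ.1 ⟨q, hq⟩ := by
    rintro q' hq' rfl
    rw [Option.map_map, Sum.map_comp_map]
    simp
  exact h _ _ (Equiv.apply_symm_apply _ _)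

/-- The isomorphism of induced play graphs. -/
def Iso.induced {A B : ROMPG m n} (e : Iso A B) (τ : A.Strategy .ex) (σ : A.Strategy .all) :
    Iso (A.induced τ σ).toROMPG
      (B.induced (e.strategyFun .ex τ) (e.strategyFun .all σ)).toROMPG where
  η := e.η
  edge s t := by
    change Fin m ⊕ A.Q at s
    change Fin n ⊕ A.Q at t
    change A.inducedE τ σ s t ↔ B.inducedE (e.strategyFun .ex τ) (e.strategyFun .all σ)
      (Sum.map id e.η s) (Sum.map id e.η t)
    have key : ∀ (p : Role) (τ : A.Strategy p) (q : A.Q),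
        (∃ h : A.role q = p, τ.1 ⟨q, h⟩ = some t) ↔
          ∃ h : B.role (e.η q) = p,
            (e.strategyFun p τ).1 ⟨e.η q, h⟩ = some (Sum.map id e.η t) := by
      intro p τ q
      have inj : Function.Injective (Sum.map id e.η : Fin n ⊕ A.Q → Fin n ⊕ B.Q) :=
        Sum.map_injective.2 ⟨Function.injective_id, e.η.injective⟩
      have h1 : ∀ q' (hq' : A.role q' = p) (hq : A.role q = p), q' = q →
          (((τ.1 ⟨q', hq'⟩).map (Sum.map id e.η) = some (Sum.map id e.η t)) ↔
            τ.1 ⟨q, hq⟩ = some t) := by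
        rintro q' hq' hq rfl
        constructor
        · intro h
          exact Option.map_injective inj h
        · intro h
          rw [h]
          rfl
      constructor
      · rintro ⟨h, h2⟩
        have h3 : B.role (e.η q) = p := by rw [← e.role_eq, h]
        exact ⟨h3, (h1 _ _ h (Equiv.symm_apply_apply _ _)).2 h2⟩
      · rintro ⟨h, h2⟩
        have h3 : A.role q = p := by rw [e.role_eq, h]
        exact ⟨h3, (h1 _ _ h3 (Equiv.symm_apply_apply _ _)).1 h2⟩
    rcases s with i | q
    · exact e.edge _ _
    · exact or_congr (key .ex τ q) (key .all σ q)
  role_eq := e.role_eq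
  w_eq := e.w_eq

open Classical in
theorem Iso.winning {A B : ROMPG m n} (e : Iso A B) : A.winning = B.winning := by
  unfold ROMPG.winning
  refine Finset.ext fun X => ?_
  simp only [Finset.mem_image, Finset.mem_univ, true_and]
  have key : ∀ τ : A.Strategy .ex,
      (Finset.univ.image fun σ : A.Strategy .all => (A.induced τ σ).solution) =
        Finset.univ.image fun σ : B.Strategy .all =>
          (B.induced (e.strategyFun .ex τ) σ).solution := by
    intro τ
    refine Finset.ext fun Y => ?_
    simp only [Finset.mem_image, Finset.mem_univ, true_and]
    rw [(e.strategyFun_surjective .all).exists]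
    simp only [ROPG.solution_iso (e.induced τ _)]
  rw [(e.strategyFun_surjective .ex).exists]
  simp only [key]

end ROMPG

/-- The rightward winning-position functor on arrows; it is the identity on objects. -/
noncomputable def Wr {m n : ℕ} : roMPG.Hom m n → Sr.Hom m n :=
  Quotient.lift ROMPG.winning fun _ _ ⟨e⟩ => e.winning

end MPG

namespace MPG

/-! ### The monad of results -/

namespace T

variable {X Y Z : Type}

/-! The results `T` form a monad: the weights of consecutive stretches add up, an unweighted result
is a unit for this addition, and a decided winner absorbs whatever follows. Tracing a family of
results and playing through a play graph are the same activity, namely running a finite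
deterministic system in this monad until it stops. Both are therefore expressed by one operator
`iter` (`Play.tr_eq_trace`, `ROPG.outcome_eq_trace`).

The delicate point is the winner of an infinite run. A mean payoff depends on how many weights are
counted, and this number changes when weights are grouped or zeros are skipped. But runs of finite
systems are eventually periodic, and for eventually periodic weights the averages converge to the
drift, which is nonnegative exactly if the partial sums are bounded below (`meanPayoff_iff`).
Boundedness is insensitive to finite prefixes, to skipped zeros, and to grouping into excursions of
bounded weight, so `iter` takes it as its winning condition. Realizability ensures that an infinite
traced sequence carries infinitely many weights.

The main lemma is Bekić's identity `iter_bekic`: running a system on two finite blocks of states is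
the same as first eliminating one block and then iterating on the other. It is vanishing for the
trace; applied in two orders to a system alternating between two blocks it gives dinaturality. It
also makes the solution of play graphs compatible with composition (the positions of the first graph
form the first block) and with the trace: eliminating the wires first gives the traced graph,
eliminating the positions first gives the trace of the solution. The laws pass from `SP` to `Sr`
because every variable occurs exactly once on each side of every axiom.

For games, the edges of a trace are reachability along wires. Dinaturality is then a shift of
alternating paths (`Reach.slide`), and vanishing is a grouping of paths by their visits to one block
of wires (`reachStaged_iff`).

Finally, entrances have one successor, and wires that are entered from a position cannot cycle since
exits have at most one predecessor. Hence following wires is a function on the successors of a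
position. Strategies on the components are thereby mapped onto the strategies on the compound game,
and the induced play graphs are the compounds of the induced ones. -/

theorem bind_direct (z : T X) : z.bind direct = z := by
  cases z <;> rfl

theorem bind_assoc (z : T X) (f : X → T Y) (g : Y → T Z) :
    (z.bind f).bind g = z.bind fun x => (f x).bind g := by
  rcases z with x | ⟨r, x⟩ | p
  · rfl
  · simp only [bind]
    rcases f x with y | ⟨s, y⟩ | p
    · rfl
    · dsimp only
      rcases g y with y | ⟨s, y⟩ | p <;> simp [add_assoc]
    · rfl
  · rfl

theorem map_eq_bind (f : X → Y) (z : T X) : z.map f = z.bind fun x => direct (f x) := by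
  cases z <;> rfl

theorem bind_map (z : T X) (f : X → Y) (g : Y → T Z) :
    (z.map f).bind g = z.bind fun x => g (f x) := by
  cases z <;> rfl

theorem map_bind (z : T X) (f : X → T Y) (g : Y → Z) :
    (z.bind f).map g = z.bind fun x => (f x).map g := by
  simp only [map_eq_bind, bind_assoc]

theorem map_map (z : T X) (f : X → Y) (g : Y → Z) : (z.map f).map g = z.map fun x => g (f x) := by
  cases z <;> rfl

theorem map_id (z : T X) : z.map (fun x => x) = z := by
  cases z <;> rfl

/-- A result has at most one landing point, so a continuation is consulted only there. -/
theorem bind_congr {z : T X} {f g : X → T Y} (h : ∀ x, z.Lands x → f x = g x) :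
    z.bind f = z.bind g := by
  rcases z with x | ⟨r, x⟩ | p
  · exact h x (.inl rfl)
  · simp only [bind]
    rw [h x (.inr ⟨r, rfl⟩)]
  · rfl

theorem Lands.unique {z : T X} {x y : X} (h : z.Lands x) (h' : z.Lands y) : x = y := by
  rcases h with rfl | ⟨r, rfl⟩ <;> rcases h' with h' | ⟨r', h'⟩ <;> cases h' <;> rfl

theorem lands_bind_iff {z : T X} {x : X} (h : z.Lands x) (f : X → T Y) (y : Y) :
    (z.bind f).Lands y ↔ (f x).Lands y := by
  rcases h with rfl | ⟨r, rfl⟩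
  · rfl
  · simp only [bind]
    rcases f x with y' | ⟨s, y'⟩ | p <;> simp [Lands]

theorem lands_map {z : T X} {x : X} (h : z.Lands x) (f : X → Y) : (z.map f).Lands (f x) := by
  rcases h with rfl | ⟨r, rfl⟩
  · exact .inl rfl
  · exact .inr ⟨r, rfl⟩

theorem bind_eq_winner {z : T X} {x : X} (h : z.Lands x) {f : X → T Y} {p : Role}
    (hf : f x = winner p) : z.bind f = winner p := by
  rcases h with rfl | ⟨r, rfl⟩
  · exact hf
  · simp only [bind, hf]

/-- The weight of a result. -/
def weight : T X → ℝ
  | weighted r _ => r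
  | _ => 0

theorem weight_bind {z : T X} {x : X} (h : z.Lands x) {f : X → T Y} {y : Y}
    (hf : (f x).Lands y) : (z.bind f).weight = z.weight + (f x).weight := by
  rcases h with rfl | ⟨r, rfl⟩
  · simp [weight, bind]
  · simp only [bind]
    rcases hf with hf | ⟨s, hf⟩ <;> rw [hf] <;> simp [weight]

theorem weight_map (z : T X) (f : X → Y) : (z.map f).weight = z.weight := by
  cases z <;> rfl

/-- A result is running if it has to be continued. -/
def Running {S : Type} (z : T (S ⊕ Y)) : Prop := ∃ s, z.Lands (.inl s)

/-- A stopped result never consults the branch for states, so default values there can be exchanged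
freely. -/
theorem not_running_bind {S : Type} {z : T (S ⊕ Y)} (h : ¬ z.Running) {f f' : S → T Z}
    (g : Y → T Z) : z.bind (Sum.elim f g) = z.bind (Sum.elim f' g) := by
  apply bind_congr
  rintro (s | y) hx
  · exact absurd ⟨s, hx⟩ h
  · rfl

theorem bind_direct_sum {S : Type} (z : T (S ⊕ Y)) :
    z.bind (Sum.elim (fun s => direct (.inl s)) fun y => direct (.inr y)) = z := by
  rcases z with (x | x) | ⟨r, (x | x)⟩ | p <;> rfl

theorem not_running_bind_eq {S : Type} {z : T (S ⊕ Y)} (h : ¬ z.Running) (f : S → T (S ⊕ Y)) :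
    z.bind (Sum.elim f fun y => direct (.inr y)) = z := by
  rw [not_running_bind h (f' := fun s => direct (.inl s)), bind_direct_sum]

end T

/-! ### Iteration -/

open Classical in
/-- The winner of an infinite run with the given partial sums of weights. -/
noncomputable def infWinner (P : ℕ → ℝ) : Role := if BddBelow (Set.range P) then .ex else .all

theorem infWinner_congr {P P' : ℕ → ℝ} (h : BddBelow (Set.range P) ↔ BddBelow (Set.range P')) :
    infWinner P = infWinner P' := by
  simp only [infWinner]
  split_ifs <;> tauto

theorem bddBelow_range_add (P : ℕ → ℝ) (k : ℕ) :
    BddBelow (Set.range fun n => P (k + n)) ↔ BddBelow (Set.range P) := by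
  constructor
  · intro h
    have h2 : BddBelow (P '' Set.Iio k) := ((Set.finite_Iio k).image P).bddBelow
    refine (h2.union h).mono ?_
    rintro _ ⟨n, rfl⟩
    rcases lt_or_ge n k with hn | hn
    · exact .inl ⟨n, hn, rfl⟩
    · exact .inr ⟨n - k, by simp [Nat.add_sub_cancel' hn]⟩
  · intro h
    refine h.mono ?_
    rintro _ ⟨n, rfl⟩
    exact ⟨k + n, rfl⟩

/-- Boundedness below ignores finitely many terms and a translation. This makes the winner of an
infinite run independent of the point from which it is observed. -/
theorem infWinner_shift {P P' : ℕ → ℝ} (k : ℕ) (c : ℝ) (h : ∀ n, P (k + n) = c + P' n) :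
    infWinner P = infWinner P' := by
  apply infWinner_congr
  rw [← bddBelow_range_add P k]
  simp only [h]
  constructor
  · rintro ⟨b, hb⟩
    refine ⟨b - c, ?_⟩
    rintro _ ⟨n, rfl⟩
    linarith [hb ⟨n, rfl⟩]
  · rintro ⟨b, hb⟩
    refine ⟨c + b, ?_⟩
    rintro _ ⟨n, rfl⟩
    linarith [hb ⟨n, rfl⟩]

section Iteration

variable {S Y Z : Type}

/-- The result of `n` steps of `h`. -/
def pow (h : S → T (S ⊕ Y)) : ℕ → S → T (S ⊕ Y)
  | 0, s => .direct (.inl s)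
  | n + 1, s => (pow h n s).bind (Sum.elim h fun y => .direct (.inr y))

theorem pow_add (h : S → T (S ⊕ Y)) (m n : ℕ) (s : S) :
    pow h (m + n) s = (pow h m s).bind (Sum.elim (pow h n) fun y => .direct (.inr y)) := by
  induction n with
  | zero => exact (T.bind_direct_sum _).symm
  | succ n ih =>
    rw [← add_assoc, pow, ih, T.bind_assoc]
    congr 1
    funext x
    rcases x with x | x <;> rfl

theorem pow_one (h : S → T (S ⊕ Y)) (s : S) : pow h 1 s = h s := rfl

theorem pow_succ_left (h : S → T (S ⊕ Y)) (n : ℕ) (s : S) :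
    pow h (n + 1) s = (h s).bind (Sum.elim (pow h n) fun y => .direct (.inr y)) := by
  rw [add_comm, pow_add, pow_one]

theorem fix_pow {h : S → T (S ⊕ Y)} {φ : S → T Y}
    (hφ : ∀ s, φ s = (h s).bind (Sum.elim φ .direct)) (n : ℕ) (s : S) :
    φ s = (pow h n s).bind (Sum.elim φ .direct) := by
  induction n generalizing s with
  | zero => rfl
  | succ n ih =>
    rw [pow, T.bind_assoc, ih]
    congr 1
    funext x
    rcases x with x | x
    · exact hφ x
    · rfl

/-- A state from which the run never stops. -/
def Infinite' (h : S → T (S ⊕ Y)) (s : S) : Prop := ∀ n, (pow h n s).Running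

open Classical in
/-- The result of running `h` until it stops. -/
noncomputable def iter (h : S → T (S ⊕ Y)) (s : S) : T Y :=
  if H : ∃ n, ¬ (pow h n s).Running then
    -- The value on states is a default that is never used, because the run has stopped.
    (pow h H.choose s).bind (Sum.elim (fun _ => .winner .all) .direct)
  else .winner (infWinner fun n => (pow h n s).weight)

theorem iter_infinite {h : S → T (S ⊕ Y)} {s : S} (hs : Infinite' h s) :
    iter h s = .winner (infWinner fun n => (pow h n s).weight) := by
  rw [iter, dif_neg]
  push Not
  exact hs

/-- A stopped result is left unchanged by all further steps. -/
theorem running_of_le {h : S → T (S ⊕ Y)} {s : S} {m n : ℕ} (hmn : m ≤ n)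
    (hm : ¬ (pow h m s).Running) : pow h n s = pow h m s := by
  obtain ⟨k, rfl⟩ := Nat.exists_eq_add_of_le hmn
  rw [pow_add, T.not_running_bind_eq hm]

/-- Neither the stopping time nor the default matters: stopped runs are constant and ignore the
branch for states. -/
theorem iter_halt {h : S → T (S ⊕ Y)} {s : S} {n : ℕ} (hn : ¬ (pow h n s).Running)
    (φ : S → T Y) : iter h s = (pow h n s).bind (Sum.elim φ .direct) := by
  have H : ∃ n, ¬ (pow h n s).Running := ⟨n, hn⟩
  rw [iter, dif_pos H, T.not_running_bind H.choose_spec (f' := φ)]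
  rcases le_total n H.choose with hle | hle
  · rw [running_of_le hle hn]
  · rw [running_of_le hle H.choose_spec]

/-- The run from `s` continues as the run from `s'`, and it cannot have stopped earlier and resumed.
-/
theorem infinite_of_pow_lands {h : S → T (S ⊕ Y)} {s s' : S} {k : ℕ}
    (hl : (pow h k s).Lands (.inl s')) : Infinite' h s ↔ Infinite' h s' := by
  have key : ∀ n, (pow h (k + n) s).Running ↔ (pow h n s').Running := fun n => by
    rw [pow_add]
    exact exists_congr fun x => T.lands_bind_iff hl _ _
  constructor
  · intro H n
    exact (key n).1 (H _)
  · intro H n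
    by_contra hn
    have h1 := running_of_le (Nat.le_add_left n k) hn
    exact hn (h1 ▸ (key n).2 (H n))

theorem infWinner_of_pow_lands {h : S → T (S ⊕ Y)} {s s' : S} {k : ℕ}
    (hl : (pow h k s).Lands (.inl s')) (hs : Infinite' h s) :
    infWinner (fun n => (pow h n s).weight) = infWinner fun n => (pow h n s').weight := by
  refine infWinner_shift k (pow h k s).weight fun n => ?_
  obtain ⟨x, hx⟩ := (infinite_of_pow_lands hl).1 hs n
  rw [pow_add]
  exact T.weight_bind hl hx

theorem iter_fix (h : S → T (S ⊕ Y)) (s : S) :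
    iter h s = (h s).bind (Sum.elim (iter h) .direct) := by
  by_cases hs : Infinite' h s
  · obtain ⟨s', hs'⟩ := hs 1
    have hs2 := (infinite_of_pow_lands hs').1 hs
    rw [iter_infinite hs, infWinner_of_pow_lands hs' hs]
    have h2 : Sum.elim (iter h) T.direct (.inl s') = .winner _ := iter_infinite hs2
    exact (T.bind_eq_winner hs' h2).symm
  · obtain ⟨n, hn⟩ := not_forall.1 hs
    -- Increasing the stopping time leaves room for splitting off the first step.
    have hn1 : ¬ (pow h (n + 1) s).Running := by rwa [running_of_le (Nat.le_succ n) hn]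
    rw [iter_halt hn1 (iter h), pow_succ_left, T.bind_assoc]
    apply T.bind_congr
    rintro (x | x) hx
    · change (pow h n x).bind _ = iter h x
      rw [iter_halt]
      rintro ⟨y, hy⟩
      apply hn1
      refine ⟨y, ?_⟩
      rw [pow_succ_left, T.lands_bind_iff hx]
      exact hy
    · rfl

theorem iter_pow (h : S → T (S ⊕ Y)) (n : ℕ) (s : S) :
    iter h s = (pow h n s).bind (Sum.elim (iter h) .direct) := fix_pow (iter_fix h) n s

/-- Iteration is determined by the fixed point equation and the outcomes of infinite runs. -/
theorem iter_unique {h : S → T (S ⊕ Y)} {φ : S → T Y}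
    (hφ : ∀ s, φ s = (h s).bind (Sum.elim φ .direct))
    (hinf : ∀ s, Infinite' h s → φ s = .winner (infWinner fun n => (pow h n s).weight)) :
    φ = iter h := by
  funext s
  by_cases hs : Infinite' h s
  · rw [hinf s hs, iter_infinite hs]
  · obtain ⟨n, hn⟩ := not_forall.1 hs
    rw [iter_halt hn φ]
    exact fix_pow hφ n s

/-- Since `g` acts only at the moment of stopping, infinite runs of the two systems pass through the
same states with the same weights. The rest is the uniqueness of iteration. -/
theorem iter_natural (h : S → T (S ⊕ Y)) (g : Y → T Z) :
    iter (fun s => (h s).bind (Sum.elim (fun s => .direct (.inl s)) fun y => (g y).map .inr)) =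
      fun s => (iter h s).bind g := by
  symm
  have hpow : ∀ n s, pow (fun s => (h s).bind
      (Sum.elim (fun s => .direct (.inl s)) fun y => (g y).map .inr)) n s =
        (pow h n s).bind (Sum.elim (fun s => .direct (.inl s)) fun y => (g y).map .inr) := by
    intro n
    induction n with
    | zero => intro s; rfl
    | succ n ih =>
      intro s
      rw [pow, ih, pow, T.bind_assoc, T.bind_assoc]
      congr 1
      funext x
      rcases x with x | x
      · rfl
      · simp only [Sum.elim_inr, T.bind_map]
        rw [← T.map_eq_bind]
        rfl
  apply iter_unique
  · intro s
    rw [iter_fix h s, T.bind_assoc, T.bind_assoc]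
    congr 1
    funext x
    rcases x with x | x
    · rfl
    · simp only [Sum.elim_inr, T.bind_map]
      exact (T.bind_direct _).symm
  · intro s hs
    -- A run that still goes on has not passed through `g`, whose exits all lie in the right
    -- summand.
    have key : ∀ n, (pow h n s).Running ∧ (pow (fun s => (h s).bind
      (Sum.elim (fun s => .direct (.inl s)) fun y => (g y).map .inr)) n s).weight =
        (pow h n s).weight := by
      intro n
      obtain ⟨x, hx⟩ := hs n
      rw [hpow] at hx
      obtain ⟨j, hj, hjx⟩ := Play.lands_bind hx
      rcases j with j | j
      · refine ⟨⟨j, hj⟩, ?_⟩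
        rw [hpow, T.weight_bind hj hjx]
        simp [T.weight]
      · exfalso
        obtain ⟨_, _, h3⟩ := Play.map_lands hjx
        cases h3
    rw [iter_infinite fun n => (key n).1]
    simp only [key]
    rfl

theorem iter_equiv {S' : Type} (e : S ≃ S') (h : S → T (S ⊕ Y)) :
    iter (fun s' => (h (e.symm s')).map (Sum.map e id)) = fun s' => iter h (e.symm s') := by
  symm
  have hpow : ∀ n s', pow (fun s' => (h (e.symm s')).map (Sum.map e id)) n s' =
      (pow h n (e.symm s')).map (Sum.map e id) := by
    intro n
    induction n with
    | zero => intro s; simp [pow, T.map]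
    | succ n ih =>
      intro s
      rw [pow, ih, pow, T.bind_map, T.map_bind]
      congr 1
      funext x
      rcases x with x | x
      · simp
      · rfl
  apply iter_unique
  · intro s
    rw [iter_fix h, T.bind_map]
    congr 1
    funext x
    rcases x with x | x
    · simp
    · rfl
  · intro s hs
    rw [iter_infinite]
    · simp only [hpow, T.weight_map]
    · intro n
      obtain ⟨x, hx⟩ := hs n
      rw [hpow] at hx
      obtain ⟨j, hj, hjx⟩ := Play.map_lands hx
      rcases j with j | j
      · exact ⟨j, hj⟩
      · cases hjx

theorem iter_of_not_running {h : S → T Y} :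
    iter (fun s => (h s).map (.inr : Y → S ⊕ Y)) = h := by
  funext s
  rw [iter_fix, T.bind_map]
  exact T.bind_direct _

end Iteration

/-! ### Simultaneous iteration -/

section Bekic

variable {L K B : Type} (h : L ⊕ K → T ((L ⊕ K) ⊕ B))

/-- The restriction to the first block. -/
def innerSystem (l : L) : T (L ⊕ (K ⊕ B)) := (h (.inl l)).map (Equiv.sumAssoc L K B)

/-- Continue a result that lies in the first block until it leaves this block. -/
noncomputable def resolve (x : (L ⊕ K) ⊕ B) : T (K ⊕ B) :=
  Sum.elim (iter (innerSystem h)) .direct (Equiv.sumAssoc L K B x)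

/-- The system on the second block that results from iterating the first one. -/
noncomputable def outerSystem (k : K) : T (K ⊕ B) := (h (.inr k)).bind (resolve h)

theorem resolve_inl (l : L) : resolve h (.inl (.inl l)) = (h (.inl l)).bind (resolve h) := by
  change iter (innerSystem h) l = _
  rw [iter_fix, innerSystem, T.bind_map]
  rfl

/-- The solution on both blocks that is given by the solutions of the two systems. -/
noncomputable def bekic : L ⊕ K → T B :=
  Sum.elim (fun l => (iter (innerSystem h) l).bind (Sum.elim (iter (outerSystem h)) .direct))
    (iter (outerSystem h))

theorem resolve_bind (x : (L ⊕ K) ⊕ B) :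
    (resolve h x).bind (Sum.elim (iter (outerSystem h)) .direct) =
      Sum.elim (bekic h) .direct x := by
  rcases x with (x | x) | x <;> rfl

theorem bekic_fix (s : L ⊕ K) : bekic h s = (h s).bind (Sum.elim (bekic h) .direct) := by
  have h1 : ∀ z : T ((L ⊕ K) ⊕ B), z.bind (Sum.elim (bekic h) .direct) =
      (z.bind (resolve h)).bind (Sum.elim (iter (outerSystem h)) .direct) := fun z => by
    rw [T.bind_assoc]
    simp only [resolve_bind]
  rw [h1]
  rcases s with l | k
  · rw [← resolve_inl]
    rfl
  · exact iter_fix _ _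

/-- Resolving already includes all steps that start in the first block. Hence the outer clock
advances only with a step that starts in the second block. -/
theorem outer_pow_step {n N : ℕ} {y : K}
    (hn : pow (outerSystem h) n y = (pow h N (.inr y)).bind (resolve h)) :
    (∀ y', (pow h N (.inr y)).Lands (.inl (.inr y')) → pow (outerSystem h) (n + 1) y =
        (pow h (N + 1) (.inr y)).bind (resolve h)) ∧
    ((∀ y', ¬ (pow h N (.inr y)).Lands (.inl (.inr y'))) → pow (outerSystem h) n y =
        (pow h (N + 1) (.inr y)).bind (resolve h)) := by
  constructor
  · intro y' hy'
    rw [pow, hn, pow, T.bind_assoc, T.bind_assoc]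
    apply T.bind_congr
    intro x hx
    cases hx.unique hy'
    rfl
  · intro hno
    rw [hn, pow, T.bind_assoc]
    apply T.bind_congr
    rintro ((x | x) | x) hx
    · exact resolve_inl h x
    · exact absurd hx (hno x)
    · rfl

theorem exists_outer_pow (y : K) (N : ℕ) :
    ∃ n, pow (outerSystem h) n y = (pow h N (.inr y)).bind (resolve h) := by
  induction N with
  | zero => exact ⟨0, rfl⟩
  | succ N ih =>
    obtain ⟨n, hn⟩ := ih
    have hs := outer_pow_step h hn
    by_cases hy : ∃ y', (pow h N (.inr y)).Lands (.inl (.inr y'))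
    · obtain ⟨y', hy'⟩ := hy
      exact ⟨n + 1, hs.1 y' hy'⟩
    · exact ⟨n, hs.2 (not_exists.1 hy)⟩

/-- An excursion into the first block can be followed to its end while the outer clock stands still.
The induction is on the time `m` of some later visit to the second block. -/
theorem exists_pow_lands {n : ℕ} {y : K} (m : ℕ) :
    ∀ (N : ℕ) (x : L ⊕ K) (k : K),
      pow (outerSystem h) n y = (pow h N (.inr y)).bind (resolve h) →
      (pow h N (.inr y)).Lands (.inl x) → (pow h m x).Lands (.inl (.inr k)) →
      ∃ N' y', (pow h N' (.inr y)).Lands (.inl (.inr y')) ∧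
        pow (outerSystem h) n y = (pow h N' (.inr y)).bind (resolve h) := by
  induction m with
  | zero =>
    intro N x k hn hx hk
    cases hk.unique (.inl rfl)
    exact ⟨N, k, hx, hn⟩
  | succ m ih =>
    intro N x k hn hx hk
    rcases x with l | y'
    · rw [pow_succ_left] at hk
      obtain ⟨x, hx1, hx2⟩ := Play.lands_bind hk
      rcases x with x | x
      · refine ih (N + 1) x k ((outer_pow_step h hn).2 fun y' hy' => ?_) ?_ hx2
        · cases hx.unique hy'
        · rw [pow, T.lands_bind_iff hx]
          exact hx1
      · rcases hx2 with hx2 | ⟨r, hx2⟩ <;> cases hx2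
    · exact ⟨N, y', hx, hn⟩

variable {h}

/-- Every outer partial sum is thereby a partial sum of the full run, taken at a visit to the second
block. -/
theorem exists_pow_of_recurrent {y : K} (hy : Infinite' h (.inr y))
    (hrec : ∀ n x, (pow h n (.inr y)).Lands (.inl x) →
      ∃ m k, (pow h m x).Lands (.inl (.inr k))) (n : ℕ) :
    ∃ N y', (pow h N (.inr y)).Lands (.inl (.inr y')) ∧
      pow (outerSystem h) n y = (pow h N (.inr y)).bind (resolve h) := by
  induction n with
  | zero => exact ⟨0, y, .inl rfl, rfl⟩
  | succ n ih =>
    obtain ⟨N, y', hN, hn⟩ := ih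
    obtain ⟨x, hx⟩ := hy (N + 1)
    obtain ⟨m, k, hm⟩ := hrec _ _ hx
    exact exists_pow_lands h m (N + 1) x k ((outer_pow_step h hn).1 y' hN) hx hm

/-- The outer partial sums are partial sums of the full run. Conversely, any partial sum of the full
run differs from an outer one by the weight of a path back to the second block. Only finitely many
such weights are needed, one for each state, so both sequences are bounded below or neither is. -/
theorem iter_outer_of_recurrent [Finite L] [Finite K] {y : K} (hy : Infinite' h (.inr y))
    (hrec : ∀ n x, (pow h n (.inr y)).Lands (.inl x) →
      ∃ m k, (pow h m x).Lands (.inl (.inr k))) :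
    iter (outerSystem h) y = .winner (infWinner fun n => (pow h n (.inr y)).weight) := by
  have hA := exists_pow_of_recurrent hy hrec
  have hweight : ∀ N y', (pow h N (.inr y)).Lands (.inl (.inr y')) →
      ((pow h N (.inr y)).bind (resolve h)).weight = (pow h N (.inr y)).weight := by
    intro N y' hN
    have h1 : (resolve h (.inl (.inr y'))).Lands (.inl y') := .inl rfl
    rw [T.weight_bind hN h1]
    exact add_zero _
  have hinf : Infinite' (outerSystem h) y := by
    intro n
    obtain ⟨N, y', hN, hn⟩ := hA n
    refine ⟨y', ?_⟩
    rw [hn, T.lands_bind_iff hN]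
    exact .inl rfl
  rw [iter_infinite hinf]
  congr 1
  apply infWinner_congr
  constructor
  · rintro ⟨c, hc⟩
    -- A return time that depends only on the state, with value 0 where there is no return, so that
    -- the weights of the returns form a finite set.
    have hD : ∀ x : L ⊕ K, ∃ m, (∃ m k, (pow h m x).Lands (.inl (.inr k))) →
        ∃ k, (pow h m x).Lands (.inl (.inr k)) := by
      intro x
      by_cases hx : ∃ m k, (pow h m x).Lands (.inl (.inr k))
      · obtain ⟨m, hm⟩ := hx
        exact ⟨m, fun _ => hm⟩
      · exact ⟨0, fun hx' => absurd hx' hx⟩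
    choose d hd using hD
    obtain ⟨b, hb⟩ := (Set.finite_range fun x : L ⊕ K => (pow h (d x) x).weight).bddAbove
    refine ⟨c - b, ?_⟩
    rintro _ ⟨N, rfl⟩
    obtain ⟨x, hx⟩ := hy N
    obtain ⟨k, hk⟩ := hd x (hrec _ _ hx)
    obtain ⟨n, hn⟩ := exists_outer_pow h y (N + d x)
    have h1 : (pow h (N + d x) (.inr y)).Lands (.inl (.inr k)) := by
      rw [pow_add, T.lands_bind_iff hx]
      exact hk
    have h2 : (pow h (N + d x) (.inr y)).weight =
        (pow h N (.inr y)).weight + (pow h (d x) x).weight := by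
      rw [pow_add]
      exact T.weight_bind hx hk
    have h3 := hc ⟨n, rfl⟩
    dsimp only at h3 ⊢
    rw [hn, hweight _ _ h1, h2] at h3
    linarith [hb ⟨x, rfl⟩]
  · intro hb
    refine hb.mono ?_
    rintro _ ⟨n, rfl⟩
    obtain ⟨N, y', hN, hn⟩ := hA n
    refine ⟨N, ?_⟩
    dsimp only
    rw [hn, hweight _ _ hN]

/-- A run that never meets the second block is literally a run of the inner system, with the same
weights. -/
theorem iter_inner_of_transient {l : L} (hl : Infinite' h (.inl l))
    (hno : ∀ m k, ¬ (pow h m (.inl l)).Lands (.inl (.inr k))) :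
    iter (innerSystem h) l = .winner (infWinner fun n => (pow h n (.inl l)).weight) := by
  have hpow : ∀ n, pow (innerSystem h) n l = (pow h n (.inl l)).map (Equiv.sumAssoc L K B) := by
    intro n
    induction n with
    | zero => rfl
    | succ n ih =>
      rw [pow, ih, pow, T.bind_map, T.map_bind]
      apply T.bind_congr
      rintro ((x | x) | x) hx
      · rfl
      · exact absurd hx (hno _ _)
      · rfl
  rw [iter_infinite]
  · simp only [hpow, T.weight_map]
  · intro n
    obtain ⟨x | x, hx⟩ := hl n
    · exact ⟨x, hpow n ▸ T.lands_map hx (Equiv.sumAssoc L K B)⟩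
    · exact absurd hx (hno _ _)

variable (h)

/-- Bekić's identity. -/
theorem iter_bekic [Finite L] [Finite K] : iter h = bekic h := by
  symm
  apply iter_unique (bekic_fix h)
  -- It suffices to treat some later state of an infinite run.
  have move : ∀ {n s x}, Infinite' h s → (pow h n s).Lands (.inl x) →
      bekic h x = .winner (infWinner fun n => (pow h n x).weight) →
      bekic h s = .winner (infWinner fun n => (pow h n s).weight) := by
    intro n s x hs hx he
    rw [fix_pow (bekic_fix h) n s, infWinner_of_pow_lands hx hs]
    exact T.bind_eq_winner hx he
  intro s hs
  -- Either the run returns to the second block from each of its states, or from some state on it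
  -- stays in the first block forever.
  by_cases hrec : ∀ n x, (pow h n s).Lands (.inl x) → ∃ m k, (pow h m x).Lands (.inl (.inr k))
  · obtain ⟨m, k, hk⟩ := hrec 0 s (.inl rfl)
    apply move hs hk
    apply iter_outer_of_recurrent ((infinite_of_pow_lands hk).1 hs)
    intro n x hx
    apply hrec (m + n)
    rw [pow_add, T.lands_bind_iff hk]
    exact hx
  · push Not at hrec
    obtain ⟨n, x, hx, hno⟩ := hrec
    apply move hs hx
    rcases x with l | k
    · change (iter (innerSystem h) l).bind _ = _
      rw [iter_inner_of_transient ((infinite_of_pow_lands hx).1 hs) hno]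
      rfl
    · exact absurd (.inl rfl) (hno 0 k)

end Bekic

end MPG

namespace MPG

/-! ### Mean payoffs of eventually periodic sequences -/

theorem eventually_periodic {α : Type*} [Finite α] (v : ℕ → α) (F : α → α)
    (h : ∀ j, v (j + 1) = F (v j)) : ∃ n₀ p, 0 < p ∧ ∀ n, n₀ ≤ n → v (n + p) = v n := by
  obtain ⟨a, b, hab, hv⟩ := Finite.exists_ne_map_eq_of_infinite v
  have key : ∀ a b, a < b → v a = v b → ∃ n₀ p, 0 < p ∧ ∀ n, n₀ ≤ n → v (n + p) = v n := by
    intro a b hab hv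
    refine ⟨a, b - a, by omega, fun n hn => ?_⟩
    induction n, hn using Nat.le_induction with
    | base => rw [Nat.add_sub_cancel' hab.le, hv]
    | succ n _ ih => rw [Nat.add_right_comm, h, ih, h]
  rcases lt_or_gt_of_ne hab with hab | hab
  · exact key a b hab hv
  · exact key b a hab hv.symm

theorem exists_bound_of_periodic {Q : ℕ → ℝ} {n₀ p : ℕ} (hp : 0 < p)
    (h : ∀ n, n₀ ≤ n → Q (n + p) = Q n) : ∃ C, ∀ n, |Q n| ≤ C := by
  have h1 : ∀ n, ∃ m < n₀ + p, Q n = Q m := by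
    intro n
    induction n using Nat.strong_induction_on with
    | _ n ih =>
      rcases lt_or_ge n (n₀ + p) with hn | hn
      · exact ⟨n, hn, rfl⟩
      · obtain ⟨m, hm, he⟩ := ih (n - p) (by omega)
        refine ⟨m, hm, ?_⟩
        rw [← he, ← h (n - p) (by omega), Nat.sub_add_cancel (by omega)]
  obtain ⟨C, hC⟩ := ((Set.finite_Iio (n₀ + p)).image fun n => |Q n|).bddAbove
  refine ⟨C, fun n => ?_⟩
  obtain ⟨m, hm, he⟩ := h1 n
  rw [he]
  exact hC ⟨m, hm, rfl⟩

/-- With `d` the gain per period, the partial sums stay within bounded distance of the line of slope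
`d / p`. Both conditions therefore say that this slope is nonnegative. -/
theorem meanPayoff_iff {a : ℕ → ℝ} {n₀ p : ℕ} (hp : 0 < p)
    (h : ∀ n, n₀ ≤ n → a (n + p) = a n) :
    MeanPayoff a ↔ BddBelow (Set.range fun N => ∑ j ∈ Finset.range N, a j) := by
  set P : ℕ → ℝ := fun N => ∑ j ∈ Finset.range N, a j with hPdef
  set d : ℝ := P (n₀ + p) - P n₀ with hd
  have hp' : (0 : ℝ) < p := Nat.cast_pos.2 hp
  have hP : ∀ n, n₀ ≤ n → P (n + p) = P n + d := by
    intro n hn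
    induction n, hn using Nat.le_induction with
    | base => rw [hd]; ring
    | succ n hn ih =>
      have h1 : P (n + 1 + p) = P (n + p) + a (n + p) := by
        rw [Nat.add_right_comm]
        exact Finset.sum_range_succ _ _
      have h2 : P (n + 1) = P n + a n := Finset.sum_range_succ _ _
      rw [h1, ih, h2, h n hn]
      ring
  -- Subtracting the linear drift leaves an eventually periodic sequence.
  obtain ⟨C, hC⟩ := exists_bound_of_periodic (Q := fun n => P n - n * (d / p)) hp (by
    intro n hn
    rw [hP n hn]
    push_cast
    field_simp
    ring)
  have hlim : Tendsto (fun N : ℕ => P N / N) atTop (nhds (d / p)) := by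
    have h0 : Tendsto (fun N : ℕ => (P N - N * (d / p)) / N) atTop (nhds 0) := by
      refine squeeze_zero_norm (fun n => ?_) (tendsto_const_div_atTop_nhds_zero_nat C)
      rw [norm_div, Real.norm_natCast, Real.norm_eq_abs]
      exact div_le_div_of_nonneg_right (hC n) (Nat.cast_nonneg n)
    have h1 := h0.add_const (d / p)
    rw [zero_add] at h1
    refine h1.congr' ?_
    filter_upwards [eventually_gt_atTop 0] with n hn
    have hn' : (n : ℝ) ≠ 0 := Nat.cast_ne_zero.2 hn.ne'
    field_simp
    ring
  have hlim' : Tendsto (fun N : ℕ => ((P N / N : ℝ) : EReal)) atTop (nhds ((d / p : ℝ) : EReal)) :=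
    (continuous_coe_real_ereal.tendsto _).comp hlim
  have h1 : MeanPayoff a ↔ 0 ≤ d / p := by
    unfold MeanPayoff
    rw [hlim'.liminf_eq, EReal.coe_nonneg]
  rw [h1]
  constructor
  · intro hdp
    refine ⟨-C, ?_⟩
    rintro _ ⟨n, rfl⟩
    have h2 := (abs_le.1 (hC n)).1
    have h3 : 0 ≤ n * (d / p) := mul_nonneg (Nat.cast_nonneg n) hdp
    linarith
  · rintro ⟨b, hb⟩
    by_contra hneg
    push Not at hneg
    -- So large that `C + n * (d / p) < b`, which contradicts the lower bound `b`.
    obtain ⟨n, hn⟩ := exists_nat_gt ((b - C) / (d / p))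
    rw [div_lt_iff_of_neg hneg] at hn
    have h2 := (abs_le.1 (hC n)).2
    have h3 := hb ⟨n, rfl⟩
    linarith

/-! ### The trace of families of results -/

/-- The trace of a family of results that continues results in `L`. -/
noncomputable def trace {L A B : Type} (f : L ⊕ A → T (L ⊕ B)) (a : A) : T B :=
  (f (.inr a)).bind (Sum.elim (iter fun s => f (.inl s)) .direct)

namespace Play

open Classical in
/-- A result that is preceded by results with total weight `r`, where `w` tells whether one of
these results carries a weight. -/
noncomputable def prefixed {X : Type} (w : Prop) (r : ℝ) : T X → T X
  | .direct x => if w then .weighted r x else .direct x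
  | .weighted s x => .weighted (r + s) x
  | .winner p => .winner p

section Traced

variable {l m n : ℕ} (f : Fin (l + m) → T (Fin (l + n))) (i : Fin m)

theorem tdp_succ_of_lands {j : ℕ} {u : T (Fin l ⊕ Fin n)} {a : Fin l}
    (h : tdp f i j = some u) (ha : u.Lands (.inl a)) :
    tdp f i (j + 1) = some (split f (Fin.castAdd m a)) := by
  rw [tdp, h]
  rcases ha with rfl | ⟨r, rfl⟩ <;> rfl

theorem sum_tdpWeight_of_not_weighted {N : ℕ} (h : ¬ ∃ j < N, IsWeighted (tdp f i j)) :
    ∑ j ∈ Finset.range N, tdpWeight (tdp f i j) = 0 := by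
  refine Finset.sum_eq_zero fun j hj => ?_
  have h1 : ¬ IsWeighted (tdp f i j) := fun h2 => h ⟨j, Finset.mem_range.1 hj, h2⟩
  unfold tdpWeight
  split
  · rename_i r x e
    exact absurd ⟨r, x, e⟩ h1
  · rfl

theorem isWeighted_iff_succ {N : ℕ} : (∃ j < N + 1, IsWeighted (tdp f i j)) ↔
    IsWeighted (tdp f i N) ∨ ∃ j < N, IsWeighted (tdp f i j) := by
  constructor
  · rintro ⟨j, hj, h⟩
    rcases Nat.lt_succ_iff_lt_or_eq.1 hj with hj | rfl
    · exact .inr ⟨j, hj, h⟩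
    · exact .inl h
  · rintro (h | ⟨j, hj, h⟩)
    · exact ⟨N, Nat.lt_succ_self N, h⟩
    · exact ⟨j, Nat.lt_succ_of_lt hj, h⟩

/-- The result of the first elements of a traced sequence. -/
noncomputable def accumulated (N : ℕ) : T (Fin l ⊕ Fin n) :=
  (split f (Fin.natAdd l i)).bind
    (Sum.elim (pow (fun a => split f (Fin.castAdd m a)) N) fun y => .direct (.inr y))

theorem accumulated_succ (N : ℕ) : accumulated f i (N + 1) =
    (accumulated f i N).bind
      (Sum.elim (fun a => split f (Fin.castAdd m a)) fun y => .direct (.inr y)) := by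
  unfold accumulated
  rw [T.bind_assoc]
  congr 1
  funext x
  rcases x with x | x <;> rfl

/-- The weights before the last element are collected in a sum. A separate flag is needed because a
sum equal to zero does not reveal whether any weight has occurred, and the result stays unweighted
only if none has. -/
theorem accumulated_eq {N : ℕ} {z : T (Fin l ⊕ Fin n)} (hz : tdp f i N = some z) :
    accumulated f i N = prefixed (∃ j < N, IsWeighted (tdp f i j))
      (∑ j ∈ Finset.range N, tdpWeight (tdp f i j)) z := by
  induction N generalizing z with
  | zero =>
    cases hz
    have h1 : accumulated f i 0 = split f (Fin.natAdd l i) := T.bind_direct_sum _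
    rw [h1]
    rcases split f (Fin.natAdd l i) with x | ⟨r, x⟩ | p <;> simp [prefixed]
  | succ N ih =>
    obtain ⟨a, u, hu, hul, rfl⟩ := tdp_succ hz
    rw [accumulated_succ, ih hu, isWeighted_iff_succ, Finset.sum_range_succ, hu]
    by_cases hw : ∃ j < N, IsWeighted (tdp f i j)
    · rcases hul with rfl | ⟨r, rfl⟩
      · simp only [prefixed, hw, if_true, tdpWeight, add_zero, or_true, T.bind, Sum.elim_inl]
        rcases split f (Fin.castAdd m a) with x | ⟨r, x⟩ | p <;> simp
      · simp only [prefixed, hw, tdpWeight, or_true, T.bind, Sum.elim_inl]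
        rcases split f (Fin.castAdd m a) with x | ⟨r, x⟩ | p <;> simp
    · rw [sum_tdpWeight_of_not_weighted f i hw]
      rcases hul with rfl | ⟨r, rfl⟩
      · have h0 : ¬ IsWeighted (some (T.direct (.inl a) : T (Fin l ⊕ Fin n))) := by
          rintro ⟨r, x, e⟩
          cases e
        simp only [prefixed, hw, h0, if_false, tdpWeight, add_zero, or_false, T.bind, Sum.elim_inl]
        rcases split f (Fin.castAdd m a) with x | ⟨r, x⟩ | p <;> simp
      · simp only [prefixed, tdpWeight, T.bind, Sum.elim_inl]
        rcases split f (Fin.castAdd m a) with x | ⟨r, x⟩ | p <;> simp [IsWeighted]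

theorem trace_eq_accumulated (N : ℕ) :
    trace (fun x => split f (finSumFinEquiv x)) i = (accumulated f i N).bind
      (Sum.elim (iter fun a => split f (Fin.castAdd m a)) .direct) := by
  unfold trace accumulated
  rw [T.bind_assoc]
  congr 1
  funext x
  rcases x with x | x
  · exact iter_pow _ N x
  · rfl

theorem tr_of_stops (h : ∃ j, tdp f i (j + 1) = none) :
    tr l f i = trace (fun x => split f (finSumFinEquiv x)) i := by
  set N := sInf {j | tdp f i (j + 1) = none} with hN
  have h1 : tdp f i (N + 1) = none := Nat.sInf_mem h
  have h2 : ∃ z, tdp f i N = some z := by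
    rcases hM : N with _ | M
    · exact ⟨_, rfl⟩
    · rw [← Option.ne_none_iff_exists']
      intro h3
      have := Nat.sInf_le (s := {j | tdp f i (j + 1) = none}) h3
      omega
  obtain ⟨z, hz⟩ := h2
  rw [trace_eq_accumulated f i N, accumulated_eq f i hz]
  unfold tr tdpOutcome
  rw [if_pos h]
  dsimp only
  rw [← hN, hz, Finset.sum_range_succ, hz]
  -- The sequence would continue from a looped open end, so its last element is not one.
  have hr : ∀ a, ¬ z.Lands (.inl a) := fun a ha => by
    rw [tdp_succ_of_lands f i hz ha] at h1
    cases h1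
  rcases z with (x | x) | ⟨r, (x | x)⟩ | p
  · exact absurd (.inl rfl) (hr x)
  · simp only [prefixed, tdpWeight, add_zero]
    split_ifs <;> rfl
  · exact absurd (.inr ⟨r, rfl⟩) (hr x)
  · rfl
  · rfl

variable {f i}

/-- The open ends through which an infinite traced sequence passes. -/
theorem exists_indices (h : ¬ ∃ j, tdp f i (j + 1) = none) :
    ∃ x : ℕ → Fin (l + m), x 0 = Fin.natAdd l i ∧ (∀ j, tdp f i j = some (split f (x j))) ∧
      ∀ j, ∃ a, x (j + 1) = Fin.castAdd m a ∧ (split f (x j)).Lands (.inl a) := by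
  have h1 : ∀ j, ∃ a u, tdp f i j = some u ∧ u.Lands (.inl a) ∧
      tdp f i (j + 1) = some (split f (Fin.castAdd m a)) := by
    intro j
    obtain ⟨z, hz⟩ := Option.ne_none_iff_exists'.1 (not_exists.1 h j)
    obtain ⟨a, u, hu, hl, rfl⟩ := tdp_succ hz
    exact ⟨a, u, hu, hl, hz⟩
  choose a u hu hl hs using h1
  let x : ℕ → Fin (l + m) := fun j => Nat.casesOn j (Fin.natAdd l i) fun j => Fin.castAdd m (a j)
  have hx : ∀ j, tdp f i j = some (split f (x j)) := by
    rintro (_ | j)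
    · rfl
    · exact hs j
  refine ⟨x, rfl, hx, fun j => ⟨a j, rfl, ?_⟩⟩
  have h2 := hu j
  rw [hx j] at h2
  rw [Option.some.inj h2]
  exact hl j

/-- Otherwise the sequence would finally run through a cycle of unweighted results. By realizability
such a cycle cannot be entered from outside, whereas the sequence starts at an entrance that no loop
returns to. -/
theorem infinite_isWeighted (hf : Realizable f) (h : ¬ ∃ j, tdp f i (j + 1) = none) :
    {j | IsWeighted (tdp f i j)}.Infinite := by
  obtain ⟨x, hx0, hx, hxs⟩ := exists_indices h
  intro hfin
  obtain ⟨N₁, hN₁⟩ := hfin.bddAbove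
  have hdir : ∀ j, N₁ < j → ∃ a, split f (x j) = .direct (.inl a) ∧ x (j + 1) = Fin.castAdd m a := by
    intro j hj
    obtain ⟨a, ha, hl⟩ := hxs j
    rcases hl with hl | ⟨r, hl⟩
    · exact ⟨a, hl, ha⟩
    · have := hN₁ (show IsWeighted (tdp f i j) from ⟨r, _, by rw [hx, hl]⟩)
      omega
  obtain ⟨y, hy⟩ := Finite.exists_infinite_fiber x
  have hy' : (x ⁻¹' {y}).Infinite := Set.infinite_coe_iff.1 hy
  obtain ⟨a, ha, haN⟩ := hy'.exists_gt N₁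
  -- The margin keeps `b - k` beyond `N₁` for all `k ≤ a`, where only unweighted results occur.
  obtain ⟨b, hb, hbN⟩ := hy'.exists_gt (a + N₁ + 1)
  have hab : x a = x b := Eq.trans ha (Eq.symm hb)
  -- An exit reached by an unweighted result is reached from one open end only, so the coincidence
  -- propagates backwards.
  have back : ∀ k, k ≤ a → x (a - k) = x (b - k) := by
    intro k
    induction k with
    | zero => intro _; exact hab
    | succ k ih =>
      intro hk
      have h1 := ih (by omega)
      have e1 : a - k = a - (k + 1) + 1 := by omega
      have e2 : b - k = b - (k + 1) + 1 := by omega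
      rw [e1, e2] at h1
      obtain ⟨c, hc, hcl⟩ := hxs (a - (k + 1))
      obtain ⟨c', hc', hcl'⟩ := hdir (b - (k + 1)) (by omega)
      have e3 : c = c' := by
        rw [hc, hcl'] at h1
        exact Fin.castAdd_injective _ _ h1
      subst e3
      by_contra hne
      exact hf _ _ (split_eq_direct hc') _ hne (split_lands hcl)
  -- At the start, the entrance `x 0` would coincide with a looped open end.
  have h0 := back a le_rfl
  rw [Nat.sub_self, hx0] at h0
  obtain ⟨c, hc, -⟩ := hxs (b - a - 1)
  rw [show b - a - 1 + 1 = b - a by omega] at hc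
  rw [hc] at h0
  exact ROMPG.castAdd_ne_natAdd _ _ h0.symm

theorem tdp_periodic (h : ¬ ∃ j, tdp f i (j + 1) = none) :
    ∃ n₀ p, 0 < p ∧ ∀ n, n₀ ≤ n → tdp f i (n + p) = tdp f i n := by
  classical
  obtain ⟨x, -, hx, hxs⟩ := exists_indices h
  obtain ⟨n₀, p, hp, h1⟩ := eventually_periodic x
    (fun y => if H : ∃ a, (split f y).Lands (.inl a) then Fin.castAdd m H.choose else y) (by
      intro j
      obtain ⟨a, ha, hl⟩ := hxs j
      have H : ∃ a, (split f (x j)).Lands (.inl a) := ⟨a, hl⟩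
      rw [dif_pos H, ha, Sum.inl.inj (hl.unique H.choose_spec)])
  refine ⟨n₀, p, hp, fun n hn => ?_⟩
  rw [hx, hx, h1 n hn]

-- Omitting zeros changes the averages but not the set of partial sums. The selected subsequence is
-- again eventually periodic, its period `q` being the number of indices selected in one period `p`,
-- so that `meanPayoff_iff` applies to it.
open Classical in
theorem meanPayoff_nth {W : ℕ → Prop} {a : ℕ → ℝ} (ha : ∀ j, ¬ W j → a j = 0)
    (hW : {j | W j}.Infinite) {n₀ p : ℕ} (hp : 0 < p)
    (hWp : ∀ n, n₀ ≤ n → (W (n + p) ↔ W n)) (hap : ∀ n, n₀ ≤ n → a (n + p) = a n) :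
    MeanPayoff (fun j => a (Nat.nth W j)) ↔
      BddBelow (Set.range fun N => ∑ j ∈ Finset.range N, a j) := by
  set q := Nat.count W (n₀ + p) - Nat.count W n₀ with hq
  have hcount : ∀ n, n₀ ≤ n → Nat.count W (n + p) = Nat.count W n + q := by
    intro n hn
    induction n, hn using Nat.le_induction with
    | base =>
      have := Nat.count_monotone W (Nat.le_add_right n₀ p)
      omega
    | succ n hn ih =>
      rw [Nat.add_right_comm, Nat.count_succ, Nat.count_succ, ih]
      simp only [hWp n hn]
      omega
  have hqpos : 0 < q := by
    obtain ⟨n, hn, hn0⟩ := hW.exists_gt n₀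
    have h1 := hcount n hn0.le
    have h2 : Nat.count W (n + 1) = Nat.count W n + 1 := by
      rw [Nat.count_succ, if_pos (show W n from hn)]
    have h3 := Nat.count_monotone W (show n + 1 ≤ n + p by omega)
    omega
  rw [meanPayoff_iff (n₀ := n₀) hqpos]
  · have hsum : ∀ N, ∑ j ∈ Finset.range N, a j =
        ∑ j ∈ Finset.range (Nat.count W N), a (Nat.nth W j) := by
      intro N
      induction N with
      | zero => simp
      | succ N ih =>
        rw [Finset.sum_range_succ, ih, Nat.count_succ]
        by_cases hN : W N
        · rw [if_pos hN, Finset.sum_range_succ, Nat.nth_count hN]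
        · rw [if_neg hN, ha N hN, add_zero, add_zero]
    have hrange : (Set.range fun N => ∑ j ∈ Finset.range N, a (Nat.nth W j)) =
        Set.range fun N => ∑ j ∈ Finset.range N, a j := by
      ext r
      constructor
      · rintro ⟨N, rfl⟩
        refine ⟨Nat.nth W N, ?_⟩
        dsimp only
        rw [hsum, Nat.count_nth_of_infinite hW]
      · rintro ⟨N, rfl⟩
        exact ⟨Nat.count W N, (hsum N).symm⟩
    rw [hrange]
  · intro j hj
    -- The index of the `j`-th selected element is at least `j`, so the threshold `n₀` also serves
    -- for the subsequence.
    have hj' : n₀ ≤ Nat.nth W j := hj.trans (Nat.nth_strictMono hW).le_apply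
    have hWj : W (Nat.nth W j) := Nat.nth_mem_of_infinite hW j
    have h1 := hcount _ hj'
    rw [Nat.count_nth_of_infinite hW] at h1
    rw [← h1, Nat.nth_count ((hWp _ hj').2 hWj), hap _ hj']

theorem prefixed_weight {X : Type} {w : Prop} {r : ℝ} {z : T X} {x : X} (hz : z.Lands x)
    (hw : ¬ w → r = 0) :
    (prefixed w r z).Lands x ∧ (prefixed w r z).weight = r + tdpWeight (some z) := by
  rcases hz with rfl | ⟨s, rfl⟩
  · by_cases h : w
    · simp [prefixed, h, T.Lands, T.weight, tdpWeight]
    · simp [prefixed, h, T.Lands, T.weight, tdpWeight, hw h]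
  · simp [prefixed, T.Lands, T.weight, tdpWeight]

theorem tr_of_not_stops (hf : Realizable f) (h : ¬ ∃ j, tdp f i (j + 1) = none) :
    tr l f i = trace (fun x => split f (finSumFinEquiv x)) i := by
  obtain ⟨x, hx0, hx, hxs⟩ := exists_indices h
  have hacc : ∀ N, (accumulated f i N).Running ∧
      (accumulated f i N).weight = ∑ j ∈ Finset.range (N + 1), tdpWeight (tdp f i j) := by
    intro N
    obtain ⟨a, -, ha⟩ := hxs N
    obtain ⟨h1, h2⟩ := prefixed_weight (w := ∃ j < N, IsWeighted (tdp f i j)) ha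
      (sum_tdpWeight_of_not_weighted f i)
    rw [accumulated_eq f i (hx N), Finset.sum_range_succ, h2, hx N]
    exact ⟨⟨a, h1⟩, rfl⟩
  obtain ⟨a, ha⟩ := (hacc 0).1
  have ha : (split f (Fin.natAdd l i)).Lands (.inl a) := by
    rw [← T.bind_direct_sum (split f (Fin.natAdd l i))]
    exact ha
  have hrun : Infinite' (fun a => split f (Fin.castAdd m a)) a := by
    intro N
    obtain ⟨b, hb⟩ := (hacc N).1
    unfold accumulated at hb
    rw [T.lands_bind_iff ha] at hb
    exact ⟨b, hb⟩
  have hwin : trace (fun x => split f (finSumFinEquiv x)) i =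
      .winner (infWinner fun N => ∑ j ∈ Finset.range N, tdpWeight (tdp f i j)) := by
    refine T.bind_eq_winner ha ((iter_infinite hrun).trans ?_)
    congr 1
    symm
    -- The first `N + 1` elements are the result of the entrance followed by `N` steps of the
    -- iteration.
    refine infWinner_shift 1 (split f (Fin.natAdd l i)).weight fun N => ?_
    rw [Nat.add_comm 1 N, ← (hacc N).2]
    obtain ⟨b, hb⟩ := hrun N
    exact T.weight_bind ha hb
  obtain ⟨n₀, p, hp, hper⟩ := tdp_periodic h
  have hmp := meanPayoff_nth (W := fun j => IsWeighted (tdp f i j))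
    (a := fun j => tdpWeight (tdp f i j)) (n₀ := n₀) (p := p)
    (by
      intro j hj
      unfold tdpWeight
      split
      · rename_i r x e
        exact absurd ⟨r, x, e⟩ hj
      · rfl)
    (infinite_isWeighted hf h) hp (fun n hn => by rw [hper n hn]) (fun n hn => by rw [hper n hn])
  rw [hwin]
  unfold tr tdpOutcome infWinner
  rw [if_neg h]
  split_ifs <;> tauto

/-- Realizability is used only for infinite sequences, where it ensures that skipping the unweighted
elements leaves an infinite sequence. -/
theorem tr_eq_trace (hf : Realizable f) :
    tr l f = trace fun x => split f (finSumFinEquiv x) := by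
  funext i
  by_cases h : ∃ j, tdp f i (j + 1) = none
  · exact tr_of_stops f i h
  · exact tr_of_not_stops hf h

end Traced

end Play

end MPG

namespace MPG

/-! ### The laws of the trace -/

section Trace

variable {L L' K A A' B B' : Type}

theorem trace_natural_right (f : L ⊕ A → T (L ⊕ B)) (g : B → T B') :
    trace (fun x => (f x).bind (Sum.elim (fun s => .direct (.inl s)) fun y => (g y).map .inr)) =
      fun a => (trace f a).bind g := by
  funext a
  unfold trace
  rw [iter_natural (fun s => f (.inl s)) g, T.bind_assoc, T.bind_assoc]
  congr 1
  funext x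
  rcases x with x | x
  · rfl
  · simp only [Sum.elim_inr, T.bind_map]
    exact T.bind_direct _

/-- Both sides solve the system `h` that alternates between `L` and `L'`: eliminating `L` by Bekić's
identity leaves the left-hand iteration on `L'`, eliminating `L'` leaves the right-hand one on `L`.
Either inner system stops after one step. -/
theorem iter_dinatural [Finite L] [Finite L'] (f : L → T (L' ⊕ B)) (g : L' → T L) :
    iter (fun j => (g j).bind f) = fun j => (g j).bind (iter fun i =>
      (f i).bind (Sum.elim (fun j => (g j).map .inl) fun y => .direct (.inr y))) := by
  let h : L ⊕ L' → T ((L ⊕ L') ⊕ B) := Sum.elim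
    (fun i => (f i).map (Sum.elim (fun j => .inl (.inr j)) .inr))
    (fun j => (g j).map fun i => .inl (.inl i))
  have h1 : ∀ j, iter h (.inr j) = iter (fun j => (g j).bind f) j := by
    intro j
    have e1 : iter (innerSystem h) = f := by
      have e2 : innerSystem h = fun i => (f i).map .inr := by
        funext i
        change ((f i).map _).map _ = _
        rw [T.map_map]
        congr 1
        funext x
        rcases x with x | x <;> rfl
      rw [e2]
      exact iter_of_not_running
    rw [iter_bekic]
    change iter (outerSystem h) j = _
    congr 1
    funext j
    change ((g j).map _).bind _ = _
    rw [T.bind_map]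
    congr 1
  have h2 : ∀ i, iter h (.inl i) = iter (fun i =>
      (f i).bind (Sum.elim (fun j => (g j).map .inl) fun y => .direct (.inr y))) i := by
    intro i
    -- Exchanging the blocks makes `L'` the one that is eliminated first.
    have e0 := congrFun (iter_equiv (Equiv.sumComm L L') h) (.inr i)
    refine Eq.trans e0.symm ?_
    set h' : L' ⊕ L → T ((L' ⊕ L) ⊕ B) := fun s' =>
      (h ((Equiv.sumComm L L').symm s')).map (Sum.map (Equiv.sumComm L L') id) with hh'
    have e1 : iter (innerSystem h') = fun j => (g j).map .inl := by
      have e2 : innerSystem h' = fun j => ((g j).map .inl).map .inr := by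
        funext j
        change (((g j).map _).map _).map _ = _
        rw [T.map_map, T.map_map, T.map_map]
        rfl
      rw [e2]
      exact iter_of_not_running
    rw [iter_bekic]
    change iter (outerSystem h') i = _
    congr 1
    funext i
    change (((f i).map _).map _).bind _ = _
    rw [T.bind_map, T.bind_map]
    congr 1
    funext x
    rcases x with x | x
    · exact congrFun e1 x
    · rfl
  funext j
  rw [← h1, iter_fix]
  change ((g j).map _).bind _ = _
  rw [T.bind_map]
  congr 1
  funext i
  exact h2 i

theorem trace_dinatural [Finite L] [Finite L'] (f : L ⊕ A → T (L' ⊕ B)) (g : L' → T L) :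
    trace (fun x => (f x).bind (Sum.elim (fun j => (g j).map .inl) fun y => .direct (.inr y))) =
      trace (Sum.elim (fun j => (g j).bind fun i => f (.inl i)) fun a => f (.inr a)) := by
  funext a
  unfold trace
  simp only [Sum.elim_inl, Sum.elim_inr]
  rw [iter_dinatural (fun i => f (.inl i)) g, T.bind_assoc]
  congr 1
  funext x
  rcases x with x | x
  · simp only [Sum.elim_inl, T.bind_map]
  · rfl

/-- This is Bekić's identity: the inner trace resolves the visits to `L` and leaves the outer system
on `K`. -/
theorem trace_vanish [Finite L] [Finite K] (f : (L ⊕ K) ⊕ A → T ((L ⊕ K) ⊕ B)) :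
    trace f = trace (trace fun x =>
      (f ((Equiv.sumAssoc L K A).symm x)).map (Equiv.sumAssoc L K B)) := by
  funext a
  conv_lhs => rw [trace, iter_bekic]
  conv_rhs => rw [trace]
  have h1 : (trace (fun x => (f ((Equiv.sumAssoc L K A).symm x)).map (Equiv.sumAssoc L K B))
      (.inr a)) = (f (.inr a)).bind (resolve fun s => f (.inl s)) := T.bind_map _ _ _
  have h2 : (fun s => trace (fun x => (f ((Equiv.sumAssoc L K A).symm x)).map
      (Equiv.sumAssoc L K B)) (.inl s)) = outerSystem fun s => f (.inl s) := by
    funext k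
    exact T.bind_map _ _ _
  rw [h1, h2, T.bind_assoc]
  congr 1
  funext x
  exact (resolve_bind _ x).symm

theorem trace_equiv (e : L ≃ L') (f : L ⊕ A → T (L ⊕ B)) :
    trace (fun x : L' ⊕ A => (f (x.map e.symm id)).map (Sum.map e id)) = trace f := by
  funext a
  unfold trace
  simp only [Sum.map_inl, Sum.map_inr]
  rw [iter_equiv e fun s => f (.inl s), T.bind_map]
  congr 1
  funext x
  rcases x with x | x
  · simp
  · rfl

/-- Renaming exits is naturality along an unweighted map, and entrances play no role in the
iteration. -/
theorem trace_conj (f : L ⊕ A → T (L ⊕ B)) (α : A' → A) (β : B → B') :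
    trace (fun x => (f (x.map id α)).map (Sum.map id β)) = fun a => (trace f (α a)).map β := by
  have h := trace_natural_right f fun b => .direct (β b)
  funext a
  rw [T.map_eq_bind]
  refine Eq.trans ?_ (congrFun h (α a))
  have e : ∀ z : T (L ⊕ B), z.map (Sum.map id β) = z.bind
      (Sum.elim (fun s => .direct (.inl s)) fun y => (T.direct (β y)).map .inr) := fun z => by
    rw [T.map_eq_bind]
    congr 1
    funext x
    rcases x with x | x <;> rfl
  simp only [e]
  rfl

end Trace

/-- Strict associativity on objects is expressed by casts of indices; here they are matched with the
reassociation of disjoint unions, in which the trace laws are formulated. -/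
theorem cast_finSumFinEquiv {a b c : ℕ} (z : Fin a ⊕ (Fin b ⊕ Fin c)) :
    Fin.cast (Nat.add_assoc a b c)
      (finSumFinEquiv (Sum.map finSumFinEquiv id ((Equiv.sumAssoc _ _ _).symm z))) =
      finSumFinEquiv (Sum.map id finSumFinEquiv z) := by
  rcases z with z | z | z
  · rfl
  · rfl
  · exact Fin.ext (Nat.add_assoc _ _ _)

/-! ### The category of plays -/

/-- The family of results of an arrow of `SP`. -/
def arrow {m n : ℕ} (f : SP.Hom m n) : Fin m → T (Fin n) := Subtype.val f

theorem arrow_injective {m n : ℕ} {f g : SP.Hom m n} (h : ∀ i, arrow f i = arrow g i) : f = g :=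
  Subtype.ext (funext h)

theorem arrow_id (m : ℕ) (i : Fin m) : arrow (SP.id m) i = .direct i := rfl

theorem arrow_swap (m n : ℕ) (i : Fin (m + n)) :
    arrow (SP.swap m n) i = .direct (finAddFlip i) := rfl

theorem arrow_comp {m l n : ℕ} (f : SP.Hom m l) (g : SP.Hom l n) (i : Fin m) :
    arrow (SP.comp f g) i = (arrow f i).bind (arrow g) := rfl

theorem arrow_sum_castAdd {m n k l : ℕ} (f : SP.Hom m n) (g : SP.Hom k l) (i : Fin m) :
    arrow (SP.sum f g) (Fin.castAdd k i) = (arrow f i).map (Fin.castAdd l) := by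
  change Play.sum (arrow f) (arrow g) _ = _
  rw [Play.sum, Fin.addCases_left]

theorem arrow_sum_natAdd {m n k l : ℕ} (f : SP.Hom m n) (g : SP.Hom k l) (i : Fin k) :
    arrow (SP.sum f g) (Fin.natAdd m i) = (arrow g i).map (Fin.natAdd n) := by
  change Play.sum (arrow f) (arrow g) _ = _
  rw [Play.sum, Fin.addCases_right]

theorem arrow_cast {m m' n n' : ℕ} (hm : m = m') (hn : n = n') (f : SP.Hom m n) (i : Fin m') :
    arrow (SP.cast hm hn f) i = (arrow f (Fin.cast hm.symm i)).map (Fin.cast hn) := by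
  subst hm hn
  exact (T.map_id _).symm

/-- An arrow with the first `l` open ends separated from the others. -/
def splitArrow {l l' m n : ℕ} (f : SP.Hom (l + m) (l' + n)) (x : Fin l ⊕ Fin m) :
    T (Fin l' ⊕ Fin n) :=
  (arrow f (finSumFinEquiv x)).map finSumFinEquiv.symm

theorem arrow_tr {l m n : ℕ} (f : SP.Hom (l + m) (l + n)) :
    arrow (SP.tr l f) = trace (splitArrow f) := Play.tr_eq_trace f.2

theorem splitArrow_comp {l l' l'' m k n : ℕ} (f : SP.Hom (l + m) (l' + k))
    (g : SP.Hom (l' + k) (l'' + n)) :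
    splitArrow (SP.comp f g) = fun x => (splitArrow f x).bind (splitArrow g) := by
  funext x
  unfold splitArrow
  rw [arrow_comp, T.map_bind, T.bind_map]
  simp only [Equiv.apply_symm_apply]

theorem splitArrow_sum {m n k l : ℕ} (f : SP.Hom m n) (g : SP.Hom k l) :
    splitArrow (SP.sum f g) =
      Sum.elim (fun i => (arrow f i).map .inl) fun i => (arrow g i).map .inr := by
  funext x
  unfold splitArrow
  rcases x with x | x
  · rw [finSumFinEquiv_apply_left, arrow_sum_castAdd, T.map_map]
    simp
  · rw [finSumFinEquiv_apply_right, arrow_sum_natAdd, T.map_map]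
    simp

theorem exists_fin_add {a b : ℕ} {P : Fin (a + b) → Prop} :
    (∃ i, P i) ↔ (∃ i, P (Fin.castAdd b i)) ∨ ∃ i, P (Fin.natAdd a i) := by
  constructor
  · rintro ⟨i, h⟩
    revert h
    exact Fin.addCases (fun i h => .inl ⟨i, h⟩) (fun i h => .inr ⟨i, h⟩) i
  · rintro (⟨i, h⟩ | ⟨i, h⟩)
    · exact ⟨_, h⟩
    · exact ⟨_, h⟩

theorem forall_fin_add {a b : ℕ} {P : Fin (a + b) → Prop} :
    (∀ i, P i) ↔ (∀ i, P (Fin.castAdd b i)) ∧ ∀ i, P (Fin.natAdd a i) :=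
  ⟨fun h => ⟨fun _ => h _, fun _ => h _⟩, fun h i => Fin.addCases h.1 h.2 i⟩

/-! ### Associativity and unit casts on open ends -/

section CastLemmas

variable {a b c : ℕ}

theorem cast_assoc_castAdd_castAdd (i : Fin a) :
    Fin.cast (Nat.add_assoc a b c) (Fin.castAdd c (Fin.castAdd b i)) = Fin.castAdd (b + c) i := rfl

theorem cast_assoc_castAdd_natAdd (i : Fin b) :
    Fin.cast (Nat.add_assoc a b c) (Fin.castAdd c (Fin.natAdd a i)) =
      Fin.natAdd a (Fin.castAdd c i) := rfl

theorem cast_assoc_natAdd (i : Fin c) :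
    Fin.cast (Nat.add_assoc a b c) (Fin.natAdd (a + b) i) =
      Fin.natAdd a (Fin.natAdd b i) := Fin.ext (Nat.add_assoc _ _ _)

theorem cast_assoc_symm_castAdd (i : Fin a) :
    Fin.cast (Nat.add_assoc a b c).symm (Fin.castAdd (b + c) i) =
      Fin.castAdd c (Fin.castAdd b i) := rfl

theorem cast_assoc_symm_natAdd_castAdd (i : Fin b) :
    Fin.cast (Nat.add_assoc a b c).symm (Fin.natAdd a (Fin.castAdd c i)) =
      Fin.castAdd c (Fin.natAdd a i) := rfl

theorem cast_assoc_symm_natAdd_natAdd (i : Fin c) :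
    Fin.cast (Nat.add_assoc a b c).symm (Fin.natAdd a (Fin.natAdd b i)) =
      Fin.natAdd (a + b) i := Fin.ext (Nat.add_assoc _ _ _).symm

theorem cast_natAdd_zero (i : Fin a) (h : a = 0 + a) : Fin.cast h i = Fin.natAdd 0 i :=
  Fin.ext (Nat.zero_add _).symm

theorem cast_castAdd_zero (i : Fin a) (h : a = a + 0) : Fin.cast h i = Fin.castAdd 0 i := rfl

theorem cast_zero_natAdd (i : Fin a) (h : 0 + a = a) : Fin.cast h (Fin.natAdd 0 i) = i :=
  Fin.ext (Nat.zero_add _)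

end CastLemmas

theorem map_direct {X Y : Type} (x : X) (f : X → Y) : (T.direct x).map f = .direct (f x) := rfl

theorem direct_bind {X Y : Type} (x : X) (f : X → T Y) : (T.direct x).bind f = f x := rfl

/-- With the open ends separated into blocks, each axiom becomes a monad law or a law of `trace`. -/
theorem isTSMC_SP : SP.IsTSMC where
  id_comp f := rfl
  comp_id f := arrow_injective fun i => T.bind_direct _
  assoc f g h := arrow_injective fun i => T.bind_assoc _ _ _
  sum_id m n := by
    refine arrow_injective (forall_fin_add.2 ⟨fun i => ?_, fun i => ?_⟩)
    · rw [arrow_sum_castAdd]; rfl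
    · rw [arrow_sum_natAdd]; rfl
  sum_comp f g f' g' := by
    refine arrow_injective (forall_fin_add.2 ⟨fun i => ?_, fun i => ?_⟩)
    · simp only [arrow_comp, arrow_sum_castAdd, T.map_bind, T.bind_map]
    · simp only [arrow_comp, arrow_sum_natAdd, T.map_bind, T.bind_map]
  sum_assoc f g h := by
    refine arrow_injective (forall_fin_add.2 ⟨fun i => ?_,
      forall_fin_add.2 ⟨fun i => ?_, fun i => ?_⟩⟩)
    · simp only [arrow_cast, cast_assoc_symm_castAdd, arrow_sum_castAdd, T.map_map,
        cast_assoc_castAdd_castAdd]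
    · simp only [arrow_cast, cast_assoc_symm_natAdd_castAdd, arrow_sum_castAdd, arrow_sum_natAdd,
        T.map_map, cast_assoc_castAdd_natAdd]
    · simp only [arrow_cast, cast_assoc_symm_natAdd_natAdd, arrow_sum_natAdd, T.map_map,
        cast_assoc_natAdd]
  zero_sum f := arrow_injective fun i => by
    simp only [arrow_cast, cast_natAdd_zero, arrow_sum_natAdd, T.map_map, cast_zero_natAdd, T.map_id]
  sum_zero f := arrow_injective fun i => by
    rw [arrow_cast, cast_castAdd_zero, arrow_sum_castAdd, T.map_map]
    exact T.map_id _
  swap_natural f g := by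
    refine arrow_injective (forall_fin_add.2 ⟨fun i => ?_, fun i => ?_⟩)
    · simp only [arrow_comp, arrow_sum_castAdd, arrow_swap, direct_bind, T.bind_map,
        finAddFlip_apply_castAdd, arrow_sum_natAdd]
      exact (T.map_eq_bind _ _).symm
    · simp only [arrow_comp, arrow_swap, direct_bind, T.bind_map,
        finAddFlip_apply_natAdd, arrow_sum_natAdd, arrow_sum_castAdd]
      exact (T.map_eq_bind _ _).symm
  swap_swap m n := by
    refine arrow_injective (forall_fin_add.2 ⟨fun i => ?_, fun i => ?_⟩)
    · simp only [arrow_comp, arrow_swap, direct_bind, finAddFlip_apply_castAdd,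
        finAddFlip_apply_natAdd, arrow_id]
    · simp only [arrow_comp, arrow_swap, direct_bind, finAddFlip_apply_castAdd,
        finAddFlip_apply_natAdd, arrow_id]
  swap_sum m n k := by
    refine arrow_injective (forall_fin_add.2 ⟨fun i => ?_,
      forall_fin_add.2 ⟨fun i => ?_, fun i => ?_⟩⟩)
    · simp only [arrow_comp, arrow_cast, cast_assoc_symm_castAdd, arrow_sum_castAdd, arrow_swap,
        finAddFlip_apply_castAdd, T.map, direct_bind, cast_assoc_castAdd_natAdd, Fin.cast_refl, id,
        arrow_sum_natAdd, cast_assoc_symm_natAdd_natAdd]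
    · simp only [arrow_comp, arrow_cast, cast_assoc_symm_natAdd_castAdd, arrow_sum_castAdd,
        arrow_swap, finAddFlip_apply_natAdd, T.map, direct_bind,
        cast_assoc_castAdd_castAdd, Fin.cast_refl, id, arrow_id, cast_assoc_symm_castAdd]
    · simp only [arrow_comp, arrow_cast, cast_assoc_symm_natAdd_natAdd, arrow_sum_natAdd,
        arrow_swap, finAddFlip_apply_natAdd, T.map, direct_bind,
        cast_assoc_natAdd, Fin.cast_refl, id, arrow_id, cast_assoc_symm_natAdd_castAdd]
  tr_natural_left g f := arrow_injective fun i => by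
    rw [arrow_comp, arrow_tr, arrow_tr, splitArrow_comp, splitArrow_sum]
    unfold trace
    simp only [Sum.elim_inl, Sum.elim_inr, T.bind_map, arrow_id, map_direct, direct_bind,
      T.bind_assoc]
  tr_natural_right f g := arrow_injective fun i => by
    rw [arrow_comp, arrow_tr, arrow_tr, splitArrow_comp, splitArrow_sum]
    exact congrFun (trace_natural_right (splitArrow f) (arrow g)) i
  tr_dinatural f g := arrow_injective fun i => by
    rw [arrow_tr, arrow_tr, splitArrow_comp, splitArrow_sum, splitArrow_comp, splitArrow_sum]
    refine (congrFun (trace_dinatural (splitArrow f) (arrow g)) i).trans ?_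
    congr 1
    funext x
    rcases x with x | x
    · simp only [Sum.elim_inl, T.bind_map]
    · rfl
  tr_zero f := arrow_injective fun i => by
    rw [arrow_tr, arrow_cast, cast_natAdd_zero]
    unfold trace splitArrow
    rw [T.bind_map, T.map_eq_bind]
    congr 1
    funext x
    obtain ⟨x | x, rfl⟩ := finSumFinEquiv.surjective x
    · exact x.elim0
    · rw [Equiv.symm_apply_apply, finSumFinEquiv_apply_right, cast_zero_natAdd]
      rfl
  tr_add {l k m n} f := arrow_injective fun i => by
    -- The traced block has to be split into two blocks before vanishing applies.
    rw [arrow_tr, ← trace_equiv finSumFinEquiv.symm, trace_vanish, arrow_tr]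
    congr 1
    funext x
    symm
    set G := fun x => (((splitArrow f) (Sum.map finSumFinEquiv.symm.symm id
      ((Equiv.sumAssoc (Fin l) (Fin k) (Fin m)).symm x))).map
      (Sum.map finSumFinEquiv.symm id)).map (Equiv.sumAssoc (Fin l) (Fin k) (Fin n)) with hG
    have key : splitArrow (SP.cast (Nat.add_assoc l k m) (Nat.add_assoc l k n) f) =
        fun y => (G (y.map id finSumFinEquiv.symm)).map (Sum.map id finSumFinEquiv) := by
      funext y
      have hy : y = Sum.map id finSumFinEquiv (Sum.map id finSumFinEquiv.symm y) := by simp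
      rw [hG, hy]
      dsimp only
      generalize Sum.map id finSumFinEquiv.symm y = z
      unfold splitArrow
      have e1 : Sum.map id finSumFinEquiv.symm (Sum.map id finSumFinEquiv z) = z := by simp
      rw [arrow_cast, e1, ← cast_finSumFinEquiv, T.map_map, T.map_map, T.map_map, T.map_map]
      congr 1
      funext x
      rw [Equiv.symm_apply_eq]
      obtain ⟨x, rfl⟩ := finSumFinEquiv.surjective x
      have e2 : x = Sum.map finSumFinEquiv id ((Equiv.sumAssoc _ _ _).symm
          (Equiv.sumAssoc _ _ _ (Sum.map finSumFinEquiv.symm id x))) := by simp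
      rw [e2, cast_finSumFinEquiv]
      simp
    rw [splitArrow, arrow_tr, key, trace_conj]
    dsimp only
    rw [Equiv.symm_apply_apply, T.map_map]
    simp only [Equiv.symm_apply_apply]
    exact T.map_id _
  tr_sum {l m n m' n'} f g := by
    have key : ∀ y, splitArrow
        (SP.cast (Nat.add_assoc l m m') (Nat.add_assoc l n n') (SP.sum f g))
          (Sum.map id (Fin.castAdd m') y) =
        (splitArrow f y).map (Sum.map id (Fin.castAdd n')) := by
      intro y
      have e : Fin.cast (Nat.add_assoc l m m').symm
          (finSumFinEquiv (Sum.map id (Fin.castAdd m') y)) =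
            Fin.castAdd m' (finSumFinEquiv y) := by
        rcases y with y | y <;> rfl
      unfold splitArrow
      rw [arrow_cast, e, arrow_sum_castAdd, T.map_map, T.map_map, T.map_map]
      congr 1
      funext x
      obtain ⟨x | x, rfl⟩ := finSumFinEquiv.surjective x <;> rw [Equiv.symm_apply_eq] <;> simp <;>
        rfl
    refine arrow_injective (forall_fin_add.2 ⟨fun i => ?_, fun i => ?_⟩)
    · rw [arrow_sum_castAdd, arrow_tr, arrow_tr]
      have h := congrFun (trace_conj (splitArrow f) id (Fin.castAdd n')) i
      simp only [Sum.map_id_id, id] at h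
      rw [← h]
      simp only [← key]
      rfl
    -- A play from an entrance of `g` leaves at once and never meets the loop.
    · rw [arrow_sum_natAdd, arrow_tr]
      unfold trace splitArrow
      rw [finSumFinEquiv_apply_right, arrow_cast, cast_assoc_symm_natAdd_natAdd, arrow_sum_natAdd,
        T.bind_map, T.bind_map, T.bind_map, T.map_eq_bind]
      congr 1
      funext x
      rw [cast_assoc_natAdd, finSumFinEquiv_symm_apply_natAdd]
      rfl
  tr_swap m := arrow_injective fun i => by
    -- The play enters the loop once and leaves it with the next result, so one unfolding of the
    -- iteration suffices.
    rw [arrow_tr]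
    unfold trace splitArrow
    rw [finSumFinEquiv_apply_right, arrow_swap, finAddFlip_apply_natAdd, map_direct,
      finSumFinEquiv_symm_apply_castAdd, direct_bind, Sum.elim_inl, iter_fix,
      finSumFinEquiv_apply_left, arrow_swap, finAddFlip_apply_castAdd, map_direct,
      finSumFinEquiv_symm_apply_natAdd]
    rfl

end MPG

namespace MPG

/-! ### Change of base preserves the laws -/

section Lift

open Classical

variable {α α' β β' γ δ ε ζ : Type*}

/-- The action of the iterated finite powerset on functions. -/
noncomputable def lift₁ (f : α → β) (F : Finset (Finset α)) : Finset (Finset β) :=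
  F.image (Finset.image f)

/-- The action of the iterated finite powerset on binary functions. -/
noncomputable def lift₂ (f : α → β → γ) (F : Finset (Finset α)) (G : Finset (Finset β)) :
    Finset (Finset γ) :=
  Finset.image₂ (Finset.image₂ f) F G

theorem lift₁_id {f : α → α} (hf : ∀ a, f a = a) (F : Finset (Finset α)) : lift₁ f F = F := by
  have h1 : f = id := funext hf
  have h2 : Finset.image (id : α → α) = id := funext fun s => Finset.image_id
  rw [lift₁, h1, h2, Finset.image_id]

theorem lift₁_lift₁ (g : β → γ) (f : α → β) (F : Finset (Finset α)) :
    lift₁ g (lift₁ f F) = lift₁ (fun a => g (f a)) F := by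
  unfold lift₁
  rw [Finset.image_image]
  congr 1
  funext s
  exact Finset.image_image

theorem lift₁_lift₂ (g : γ → δ) (f : α → β → γ) (F : Finset (Finset α)) (G : Finset (Finset β)) :
    lift₁ g (lift₂ f F G) = lift₂ (fun a b => g (f a b)) F G := by
  unfold lift₁ lift₂
  rw [Finset.image_image₂]
  congr 1
  funext s t
  exact Finset.image_image₂ _ _

theorem lift₂_lift₁_left (f : α → β → γ) (g : α' → α) (F : Finset (Finset α'))
    (G : Finset (Finset β)) : lift₂ f (lift₁ g F) G = lift₂ (fun a b => f (g a) b) F G := by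
  unfold lift₁ lift₂
  rw [Finset.image₂_image_left]
  congr 1
  funext s t
  exact Finset.image₂_image_left _ _

theorem lift₂_lift₁_right (f : α → β → γ) (g : β' → β) (F : Finset (Finset α))
    (G : Finset (Finset β')) : lift₂ f F (lift₁ g G) = lift₂ (fun a b => f a (g b)) F G := by
  unfold lift₁ lift₂
  rw [Finset.image₂_image_right]
  congr 1
  funext s t
  exact Finset.image₂_image_right _ _

/-- Identities and swaps are singletons of singletons, so an operation with such an argument becomes
unary. -/
theorem lift₂_singleton_left (f : α → β → γ) (a : α) (G : Finset (Finset β)) :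
    lift₂ f {{a}} G = lift₁ (f a) G := by
  unfold lift₁ lift₂
  rw [Finset.image₂_singleton_left]
  congr 1
  funext s
  exact Finset.image₂_singleton_left

theorem lift₂_singleton_right (f : α → β → γ) (b : β) (F : Finset (Finset α)) :
    lift₂ f F {{b}} = lift₁ (fun a => f a b) F := by
  unfold lift₁ lift₂
  rw [Finset.image₂_singleton_right]
  congr 1
  funext s
  exact Finset.image₂_singleton_right

theorem lift₁_singleton (f : α → β) (a : α) : lift₁ f {{a}} = {{f a}} := by
  unfold lift₁
  rw [Finset.image_singleton, Finset.image_singleton]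

theorem lift₁_congr {f g : α → β} (h : ∀ a, f a = g a) (F : Finset (Finset α)) :
    lift₁ f F = lift₁ g F := by
  rw [funext h]

theorem lift₂_congr {f g : α → β → γ} (h : ∀ a b, f a b = g a b) (F : Finset (Finset α))
    (G : Finset (Finset β)) : lift₂ f F G = lift₂ g F G := by
  rw [show f = g from funext fun a => funext (h a)]

/-- Needed for the laws in which two variables exchange their order. -/
theorem lift₂_swap (f : α → β → γ) (F : Finset (Finset α)) (G : Finset (Finset β)) :
    lift₂ f F G = lift₂ (fun b a => f a b) G F := by
  unfold lift₂
  rw [Finset.image₂_swap]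
  congr 1
  funext s t
  exact Finset.image₂_swap _ _ _

theorem lift₂_assoc {f : δ → γ → ε} {g : α → β → δ} {f' : α → ζ → ε} {g' : β → γ → ζ}
    (h : ∀ a b c, f (g a b) c = f' a (g' b c)) (F : Finset (Finset α)) (G : Finset (Finset β))
    (H : Finset (Finset γ)) : lift₂ f (lift₂ g F G) H = lift₂ f' F (lift₂ g' G H) :=
  Finset.image₂_assoc fun _ _ _ => Finset.image₂_assoc h

end Lift

namespace TracedData

universe u

variable {C : TracedData.{u}}

theorem changeBase_cast {m m' n n' : ℕ} (hm : m = m') (hn : n = n')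
    (F : Finset (Finset (C.Hom m n))) :
    C.changeBase.cast hm hn F = lift₁ (C.cast hm hn) F := by
  subst hm hn
  exact (lift₁_id (fun _ => rfl) F).symm

theorem changeBase_sum {m n k l : ℕ} (F : Finset (Finset (C.Hom m n)))
    (G : Finset (Finset (C.Hom k l))) : C.changeBase.sum F G = lift₂ C.sum F G := rfl

/-- The transfer is elementwise and works because the axioms are linear: a variable that occurred
twice would range independently over its set at each occurrence. -/
theorem isTSMC_changeBase (h : C.IsTSMC) : C.changeBase.IsTSMC where
  id_comp F := (lift₂_singleton_left _ _ _).trans (lift₁_id h.id_comp _)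
  comp_id F := (lift₂_singleton_right _ _ _).trans (lift₁_id h.comp_id _)
  assoc F G H := lift₂_assoc h.assoc F G H
  sum_id m n := by
    refine (lift₂_singleton_left _ _ _).trans ((lift₁_singleton _ _).trans ?_)
    rw [h.sum_id]
    rfl
  sum_comp F G F' G' := by
    classical
    exact Finset.image₂_image₂_image₂_comm fun _ _ _ _ =>
      Finset.image₂_image₂_image₂_comm h.sum_comp
  sum_assoc F G H := by
    refine (changeBase_cast _ _ _).trans ((lift₁_lift₂ _ _ _ _).trans ?_)
    exact lift₂_assoc h.sum_assoc F G H
  zero_sum F := by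
    refine (changeBase_cast _ _ _).trans
      ((congrArg _ (lift₂_singleton_left _ _ _)).trans ((lift₁_lift₁ _ _ _).trans ?_))
    exact lift₁_id h.zero_sum _
  sum_zero F := by
    refine (changeBase_cast _ _ _).trans
      ((congrArg _ (lift₂_singleton_right _ _ _)).trans ((lift₁_lift₁ _ _ _).trans ?_))
    exact lift₁_id h.sum_zero _
  swap_natural F G := by
    refine (lift₂_singleton_right _ _ _).trans ((lift₁_lift₂ _ _ _ _).trans
      (Eq.trans ?_ (lift₂_singleton_left _ _ _).symm))
    refine Eq.trans ?_ (lift₁_lift₂ _ _ _ _).symm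
    refine (lift₂_swap _ _ _).trans ?_
    exact lift₂_congr (fun _ _ => h.swap_natural _ _) _ _
  swap_swap m n := by
    refine (lift₂_singleton_left _ _ _).trans ((lift₁_singleton _ _).trans ?_)
    rw [h.swap_swap]
    rfl
  swap_sum m n k := by
    change ({{C.swap m (n + k)}} : Finset (Finset (C.Hom (m + (n + k)) (n + k + m)))) =
      lift₂ C.comp (C.changeBase.cast _ _ (lift₂ C.sum {{C.swap m n}} {{C.id k}}))
        (C.changeBase.cast _ _ (lift₂ C.sum {{C.id n}} {{C.swap m k}}))
    rw [changeBase_cast, changeBase_cast, lift₂_singleton_left, lift₂_singleton_left,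
      lift₁_singleton, lift₁_singleton, lift₁_singleton, lift₁_singleton, lift₂_singleton_left,
      lift₁_singleton, h.swap_sum]
  tr_natural_left {l m m' n} (G : Finset (Finset (C.Hom m m')))
      (F : Finset (Finset (C.Hom (l + m') (l + n)))) := by
    change lift₁ _ (lift₂ _ (lift₂ _ {{_}} G) F) = lift₂ _ _ (lift₁ _ _)
    rw [lift₁_lift₂, lift₂_singleton_left, lift₂_lift₁_left, lift₂_lift₁_right]
    exact lift₂_congr h.tr_natural_left _ _
  tr_natural_right {l m n n'} (F : Finset (Finset (C.Hom (l + m) (l + n))))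
      (G : Finset (Finset (C.Hom n n'))) := by
    change lift₁ _ (lift₂ _ F (lift₂ _ {{_}} G)) = lift₂ _ (lift₁ _ _) _
    rw [lift₁_lift₂, lift₂_singleton_left, lift₂_lift₁_right, lift₂_lift₁_left]
    exact lift₂_congr h.tr_natural_right _ _
  tr_dinatural {l l' m n} (F : Finset (Finset (C.Hom (l + m) (l' + n))))
      (G : Finset (Finset (C.Hom l' l))) := by
    change lift₁ _ (lift₂ _ F (lift₂ _ G {{_}})) = lift₁ _ (lift₂ _ (lift₂ _ _ {{_}}) _)
    rw [lift₁_lift₂, lift₁_lift₂, lift₂_singleton_right, lift₂_singleton_right, lift₂_lift₁_right,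
      lift₂_lift₁_left, lift₂_swap]
    exact lift₂_congr (fun g f => h.tr_dinatural f g) _ _
  tr_zero F := (lift₁_congr h.tr_zero _).trans (changeBase_cast _ _ _).symm
  tr_add {l k m n} (F : Finset (Finset (C.Hom ((l + k) + m) ((l + k) + n)))) := by
    change lift₁ _ F =
      lift₁ _ (lift₁ _ (C.changeBase.cast _ _ _))
    rw [changeBase_cast, lift₁_lift₁, lift₁_lift₁]
    exact lift₁_congr h.tr_add _
  tr_sum {l m n m' n'} (F : Finset (Finset (C.Hom (l + m) (l + n))))
      (G : Finset (Finset (C.Hom m' n'))) := by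
    rw [changeBase_sum, changeBase_cast]
    change lift₁ _ (lift₁ _ (lift₂ _ F G)) = lift₂ _ (lift₁ _ _) _
    rw [lift₁_lift₁, lift₁_lift₂, lift₂_lift₁_left]
    exact lift₂_congr h.tr_sum _ _
  tr_swap m := by
    refine (lift₁_singleton _ _).trans ?_
    rw [h.tr_swap]
    rfl

end TracedData

theorem isTSMC_Sr : Sr.IsTSMC := TracedData.isTSMC_changeBase isTSMC_SP

end MPG

namespace MPG

/-! ### Reachability along wires -/

/-- `Reach E U i` means that some element with `U` can be reached from `i` along `E`. -/
inductive Reach {L : Type} (E : L → L → Prop) (U : L → Prop) : L → Prop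
  | done {i} : U i → Reach E U i
  | step {i j} : E i j → Reach E U j → Reach E U i

namespace Reach

variable {L L' : Type}

theorem iff_or {E : L → L → Prop} {U : L → Prop} {i : L} :
    Reach E U i ↔ U i ∨ ∃ j, E i j ∧ Reach E U j := by
  constructor
  · rintro (h | ⟨h, h'⟩)
    · exact .inl h
    · exact .inr ⟨_, h, h'⟩
  · rintro (h | ⟨j, h, h'⟩)
    · exact done h
    · exact step h h'

/-- A last edge after the wires can be split off, because it involves only the end of the path. This
serves naturality in the target. -/
theorem exists_iff {E : L → L → Prop} {α : Type} {U : L → α → Prop} {c : α → Prop} {i : L} :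
    Reach E (fun i => ∃ a, U i a ∧ c a) i ↔ ∃ a, Reach E (fun i => U i a) i ∧ c a := by
  constructor
  · intro h
    induction h with
    | done h =>
      obtain ⟨a, h, hc⟩ := h
      exact ⟨a, done h, hc⟩
    | step h _ ih =>
      obtain ⟨a, h', hc⟩ := ih
      exact ⟨a, step h h', hc⟩
  · rintro ⟨a, h, hc⟩
    induction h with
    | done h => exact done ⟨a, h, hc⟩
    | step h _ ih => exact step h ih

theorem false_iff {E : L → L → Prop} {i : L} : Reach E (fun _ => False) i ↔ False := by
  refine ⟨fun h => ?_, False.elim⟩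
  induction h with
  | done h => exact h
  | step _ _ ih => exact ih

/-- A path alternating between `L` and `L'` is cut at its visits to `L'` instead of those to `L`,
which shifts the cuts by half a step. -/
theorem slide_aux {f : L → L' → Prop} {g : L' → L → Prop} {U : L → Prop} {V : L' → Prop} {i : L}
    (h : Reach (fun i i' => ∃ j, f i j ∧ g j i') (fun i => U i ∨ ∃ j, f i j ∧ V j) i) :
    U i ∨ ∃ j, f i j ∧
      Reach (fun j j' => ∃ i, g j i ∧ f i j') (fun j => V j ∨ ∃ i, g j i ∧ U i) j := by
  induction h with
  | done h =>
    rcases h with h | ⟨j, h, h'⟩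
    · exact .inl h
    · exact .inr ⟨j, h, done (.inl h')⟩
  | step h _ ih =>
    obtain ⟨j, h1, h2⟩ := h
    refine .inr ⟨j, h1, ?_⟩
    rcases ih with ih | ⟨j', h3, h4⟩
    · exact done (.inr ⟨_, h2, ih⟩)
    · exact step ⟨_, h2, h3⟩ h4

/-- The converse of the shift is the same shift with the two blocks exchanged. -/
theorem slide {f : L → L' → Prop} {g : L' → L → Prop} {U : L → Prop} {V : L' → Prop} {i : L} :
    Reach (fun i i' => ∃ j, f i j ∧ g j i') (fun i => U i ∨ ∃ j, f i j ∧ V j) i ↔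
    U i ∨ ∃ j, f i j ∧
      Reach (fun j j' => ∃ i, g j i ∧ f i j') (fun j => V j ∨ ∃ i, g j i ∧ U i) j := by
  refine ⟨slide_aux, ?_⟩
  rintro (h | ⟨j, h, h'⟩)
  · exact done (.inl h)
  · rcases slide_aux h' with h' | ⟨i', h1, h2⟩
    · exact done (.inr ⟨j, h, h'⟩)
    · exact step ⟨j, h, h1⟩ h2

theorem of_isolated {U : L → Prop} {i : L} : Reach (fun _ _ => False) U i ↔ U i := by
  rw [iff_or]
  simp

theorem slide_one {f : L → L' → Prop} {g : L' → L → Prop} {V : L' → Prop} {i : L} :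
    Reach (fun i i' => ∃ j, f i j ∧ g j i') (fun i => ∃ j, f i j ∧ V j) i ↔
      ∃ j, f i j ∧ Reach (fun j j' => ∃ i, g j i ∧ f i j') V j := by
  simpa using slide (f := f) (g := g) (U := fun _ => False) (V := V) (i := i)

/-- The case of a path that enters through `L'` and is left from `L`. -/
theorem slide_entrance {f : L → L' → Prop} {g : L' → L → Prop} {u : Prop} {r : L' → Prop}
    {U : L → Prop} :
    (u ∨ ∃ i, (∃ j, r j ∧ g j i) ∧ Reach (fun i i' => ∃ j, f i j ∧ g j i') U i) ↔
      u ∨ ∃ j, r j ∧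
        Reach (fun j j' => ∃ i, g j i ∧ f i j') (fun j => ∃ i, g j i ∧ U i) j := by
  simp only [slide_one]
  refine or_congr Iff.rfl ⟨?_, ?_⟩
  · rintro ⟨i, ⟨j, h, h'⟩, h''⟩
    exact ⟨j, h, i, h', h''⟩
  · rintro ⟨j, h, i, h', h''⟩
    exact ⟨i, ⟨j, h, h'⟩, h''⟩

/-- The case of a path that both enters through `L'` and is left from `L'`. -/
theorem slide_exit {f : L → L' → Prop} {g : L' → L → Prop} {r V : L' → Prop} :
    ((∃ j, r j ∧ V j) ∨ ∃ i, (∃ j, r j ∧ g j i) ∧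
      Reach (fun i i' => ∃ j, f i j ∧ g j i') (fun i => ∃ j, f i j ∧ V j) i) ↔
      ∃ j, r j ∧ Reach (fun j j' => ∃ i, g j i ∧ f i j') V j := by
  simp only [slide_one]
  constructor
  · rintro (⟨j, h, h'⟩ | ⟨i, ⟨j, h, h'⟩, j', h1, h2⟩)
    · exact ⟨j, h, done h'⟩
    · exact ⟨j, h, step ⟨i, h', h1⟩ h2⟩
  · rintro ⟨j, h, h'⟩
    rcases iff_or.1 h' with h' | ⟨j', ⟨i, h1, h2⟩, h3⟩
    · exact .inl ⟨j, h, h'⟩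
    · exact .inr ⟨i, ⟨j, h, h1⟩, j', h2, h3⟩

end Reach

section ReachAdd

variable {l k : ℕ} (E : Fin (l + k) → Fin (l + k) → Prop) (U : Fin (l + k) → Prop)

/-- Reachability along the first `l` wires. -/
def ReachLeft (W : Fin (l + k) → Prop) (i : Fin l) : Prop :=
  Reach (fun i i' => E (Fin.castAdd k i) (Fin.castAdd k i')) (fun i => W (Fin.castAdd k i)) i

/-- Reachability along the last `k` wires, where each step may pass through the first `l` wires. -/
def ReachRight (j : Fin k) : Prop :=
  Reach (fun j j' => E (Fin.natAdd l j) (Fin.natAdd l j') ∨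
      ∃ i, E (Fin.natAdd l j) (Fin.castAdd k i) ∧ ReachLeft E (fun x => E x (Fin.natAdd l j')) i)
    (fun j => U (Fin.natAdd l j) ∨
      ∃ i, E (Fin.natAdd l j) (Fin.castAdd k i) ∧ ReachLeft E U i) j

/-- Reachability in two stages, where `u` and `e` describe the first step. -/
def ReachStaged (u : Prop) (e : Fin (l + k) → Prop) : Prop :=
  (u ∨ ∃ i, e (Fin.castAdd k i) ∧ ReachLeft E U i) ∨
    ∃ j, (e (Fin.natAdd l j) ∨
      ∃ i, e (Fin.castAdd k i) ∧ ReachLeft E (fun x => E x (Fin.natAdd l j)) i) ∧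
        ReachRight E U j

variable {E U}

/-- An element of the first block prolongs the initial stretch in that block, while an element of
the second block becomes the first stop of the outer path. -/
theorem ReachStaged.step {u : Prop} {e : Fin (l + k) → Prop} {y : Fin (l + k)} (hy : e y)
    (h : ReachStaged E U (U y) (E y)) : ReachStaged E U u e := by
  revert hy h
  refine Fin.addCases (fun i => ?_) (fun j => ?_) y <;> intro hy h
  · rcases h with (h | ⟨i', h, h'⟩) | ⟨j, h | ⟨i', h, h'⟩, hj⟩
    · exact .inl (.inr ⟨i, hy, Reach.done h⟩)
    · exact .inl (.inr ⟨i, hy, Reach.step h h'⟩)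
    · exact .inr ⟨j, .inr ⟨i, hy, Reach.done h⟩, hj⟩
    · exact .inr ⟨j, .inr ⟨i, hy, Reach.step h h'⟩, hj⟩
  · refine .inr ⟨j, .inl hy, ?_⟩
    rcases h with h | ⟨j', h, h'⟩
    · exact Reach.done h
    · exact Reach.step h h'

theorem ReachLeft.reach {W : Fin (l + k) → Prop} (hW : ∀ x, W x → Reach E U x) {i : Fin l}
    (h : ReachLeft E W i) : Reach E U (Fin.castAdd k i) := by
  induction h with
  | done h => exact hW _ h
  | step h _ ih => exact Reach.step h ih

theorem ReachRight.reach {j : Fin k} (h : ReachRight E U j) : Reach E U (Fin.natAdd l j) := by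
  induction h with
  | done h =>
    rcases h with h | ⟨i, h, h'⟩
    · exact Reach.done h
    · exact Reach.step h (h'.reach fun _ => Reach.done)
  | step h _ ih =>
    rcases h with h | ⟨i, h, h'⟩
    · exact Reach.step h ih
    · exact Reach.step h (h'.reach (W := fun x => E x (Fin.natAdd l _)) fun x hx => Reach.step hx ih)

/-- A path is cut at its visits to the last `k` wires; between two cuts it runs in the first `l`
wires. This is vanishing for wires. -/
theorem reachStaged_iff {u : Prop} {e : Fin (l + k) → Prop} :
    (u ∨ ∃ y, e y ∧ Reach E U y) ↔ ReachStaged E U u e := by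
  have h1 : ∀ y, Reach E U y → ReachStaged E U (U y) (E y) := by
    intro y h
    induction h with
    | done h => exact .inl (.inl h)
    | step h _ ih => exact ih.step h
  constructor
  · rintro (h | ⟨y, hy, h⟩)
    · exact .inl (.inl h)
    · exact (h1 y h).step hy
  · rintro ((h | ⟨i, h, h'⟩) | ⟨j, h | ⟨i, h, h'⟩, hj⟩)
    · exact .inl h
    · exact .inr ⟨_, h, h'.reach fun _ => Reach.done⟩
    · exact .inr ⟨_, h, hj.reach⟩
    · exact .inr ⟨_, h, h'.reach (W := fun x => E x (Fin.natAdd l j)) fun x hx =>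
      Reach.step hx hj.reach⟩

end ReachAdd

/-! ### Edge relations -/

section Relations

open ROMPG

variable {P Q R : Type}

/-- The edges of a sequential composition. -/
def compR {m l n : ℕ} (R : Fin m ⊕ P → Fin l ⊕ P → Prop) (S : Fin l ⊕ Q → Fin n ⊕ Q → Prop) :
    Fin m ⊕ (P ⊕ Q) → Fin n ⊕ (P ⊕ Q) → Prop
  | .inl i, .inr (.inl a) => R (.inl i) (.inr a)
  | .inr (.inl a'), .inr (.inl a) => R (.inr a') (.inr a)
  | .inl i, .inl k => ∃ j, R (.inl i) (.inl j) ∧ S (.inl j) (.inl k)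
  | .inl i, .inr (.inr b) => ∃ j, R (.inl i) (.inl j) ∧ S (.inl j) (.inr b)
  | .inr (.inl a), .inl k => ∃ j, R (.inr a) (.inl j) ∧ S (.inl j) (.inl k)
  | .inr (.inl a), .inr (.inr b) => ∃ j, R (.inr a) (.inl j) ∧ S (.inl j) (.inr b)
  | .inr (.inr b), .inl k => S (.inr b) (.inl k)
  | .inr (.inr b'), .inr (.inr b) => S (.inr b') (.inr b)
  | .inr (.inr _), .inr (.inl _) => False

/-- The edges of a sum. -/
def sumR {m n k l : ℕ} (R : Fin m ⊕ P → Fin n ⊕ P → Prop) (S : Fin k ⊕ Q → Fin l ⊕ Q → Prop)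
    (s : Fin (m + k) ⊕ (P ⊕ Q)) (t : Fin (n + l) ⊕ (P ⊕ Q)) : Prop :=
  Sum.LiftRel R S (splitEquiv m k P Q s) (splitEquiv n l P Q t)

/-- The edges of a trace. -/
def trR (l : ℕ) {m n : ℕ} (R : Fin (l + m) ⊕ P → Fin (l + n) ⊕ P → Prop)
    (s : Fin m ⊕ P) (t : Fin n ⊕ P) : Prop :=
  R (shift l s) (shift l t) ∨ ∃ i : Fin l, R (shift l s) (.inl (Fin.castAdd n i)) ∧
    Reach (fun i i' : Fin l => R (.inl (Fin.castAdd m i)) (.inl (Fin.castAdd n i')))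
      (fun i => R (.inl (Fin.castAdd m i)) (shift l t)) i

/-- The edges after a change of arities. -/
def castR {m m' n n' : ℕ} (hm : m = m') (hn : n = n') (R : Fin m ⊕ P → Fin n ⊕ P → Prop)
    (s : Fin m' ⊕ P) (t : Fin n' ⊕ P) : Prop :=
  R (s.map (Fin.cast hm.symm) id) (t.map (Fin.cast hn.symm) id)

/-- The edges of a game without positions. -/
def wireR {m n : ℕ} (σ : Fin m ≃ Fin n) (s : Fin m ⊕ Empty) (t : Fin n ⊕ Empty) : Prop :=
  ∃ i, s = .inl i ∧ t = .inl (σ i)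

theorem wireR_inl {m n : ℕ} (σ : Fin m ≃ Fin n) (i : Fin m) (j : Fin n) :
    wireR σ (.inl i) (.inl j) ↔ j = σ i := by
  simp [wireR]

theorem splitEquiv_castAdd {m k : ℕ} (i : Fin m) :
    splitEquiv m k P Q (.inl (Fin.castAdd k i)) = .inl (.inl i) :=
  splitEquiv_inl (.inl i)

theorem splitEquiv_natAdd {m k : ℕ} (i : Fin k) :
    splitEquiv m k P Q (.inl (Fin.natAdd m i)) = .inr (.inl i) :=
  splitEquiv_inl (.inr i)

theorem splitEquiv_inr_inl {m k : ℕ} (p : P) :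
    splitEquiv m k P Q (.inr (.inl p)) = .inl (.inr p) := rfl

theorem splitEquiv_inr_inr {m k : ℕ} (q : Q) :
    splitEquiv m k P Q (.inr (.inr q)) = .inr (.inr q) := rfl

theorem shift_inl {l m : ℕ} (i : Fin m) : (shift l (.inl i) : Fin (l + m) ⊕ P) =
    .inl (Fin.natAdd l i) := rfl

theorem shift_inr {l m : ℕ} (p : P) : (shift l (.inr p) : Fin (l + m) ⊕ P) = .inr p := rfl

theorem path_iff {l m n : ℕ} (A : ROMPG (l + m) (l + n)) (s : Fin (l + m) ⊕ A.Q)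
    (t : Fin (l + n) ⊕ A.Q) : A.Path s t ↔ A.E s t ∨
      ∃ i : Fin l, A.E s (.inl (Fin.castAdd n i)) ∧
        Reach (fun i i' : Fin l => A.E (.inl (Fin.castAdd m i)) (.inl (Fin.castAdd n i')))
          (fun i => A.E (.inl (Fin.castAdd m i)) t) i := by
  constructor
  · intro h
    induction h with
    | edge h => exact .inl h
    | loop i h _ ih => exact .inr ⟨i, h, Reach.iff_or.2 ih⟩
  · rintro (h | ⟨i, h, h'⟩)
    · exact .edge h
    · refine .loop i h ?_
      clear h
      induction h' with
      | done h => exact .edge h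
      | step h _ ih => exact .loop _ h ih

end Relations

end MPG

namespace MPG

/-! ### The axioms for edge relations -/

section EdgeLaws

open ROMPG

variable {P Q R P' Q' : Type}

theorem castAdd_ne_natAdd' {l m : ℕ} (i : Fin l) (j : Fin m) :
    Fin.natAdd l j ≠ Fin.castAdd m i := (castAdd_ne_natAdd i j).symm

-- These rules evaluate an edge relation as soon as the kinds of both endpoints are known, so most
-- laws follow by distinguishing open ends from positions.
attribute [local simp] compR sumR castR trR wireR_inl splitEquiv_castAdd splitEquiv_natAdd
  splitEquiv_inr_inl splitEquiv_inr_inr shift_inl shift_inr exists_fin_add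
  cast_assoc_castAdd_castAdd cast_assoc_castAdd_natAdd cast_assoc_natAdd cast_assoc_symm_castAdd
  cast_assoc_symm_natAdd_castAdd cast_assoc_symm_natAdd_natAdd Reach.false_iff castAdd_ne_natAdd castAdd_ne_natAdd'

theorem compR_wireR_left {m n : ℕ} (R : Fin m ⊕ P → Fin n ⊕ P → Prop) (s t) :
    compR (wireR (Equiv.refl (Fin m))) R s t ↔
      R (s.map id (Equiv.emptySum Empty P)) (t.map id (Equiv.emptySum Empty P)) := by
  rcases s with s | s | s <;> rcases t with t | t | t <;> first | exact s.elim | exact t.elim | simp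

theorem compR_wireR_right {m n : ℕ} (R : Fin m ⊕ P → Fin n ⊕ P → Prop) (s t) :
    compR R (wireR (Equiv.refl (Fin n))) s t ↔
      R (s.map id (Equiv.sumEmpty P Empty)) (t.map id (Equiv.sumEmpty P Empty)) := by
  rcases s with s | s | s <;> rcases t with t | t | t <;> first | exact s.elim | exact t.elim | simp

theorem compR_assoc {m n k l : ℕ} (R₁ : Fin m ⊕ P → Fin n ⊕ P → Prop)
    (R₂ : Fin n ⊕ Q → Fin k ⊕ Q → Prop) (R₃ : Fin k ⊕ R → Fin l ⊕ R → Prop) (s t) :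
    compR (compR R₁ R₂) R₃ s t ↔ compR R₁ (compR R₂ R₃) (s.map id (Equiv.sumAssoc P Q R))
      (t.map id (Equiv.sumAssoc P Q R)) := by
  rcases s with s | (s | s) | s <;> rcases t with t | (t | t) | t <;> simp <;> grind

theorem sumR_wireR (m n : ℕ) : ∀ s t,
    sumR (wireR (Equiv.refl (Fin m))) (wireR (Equiv.refl (Fin n))) s t ↔
      wireR (Equiv.refl (Fin (m + n))) (s.map id (Equiv.emptySum Empty Empty))
        (t.map id (Equiv.emptySum Empty Empty)) := by
  simp [Sum.forall, forall_fin_add]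

theorem sumR_compR {m n k m' n' k' : ℕ} (R : Fin m ⊕ P → Fin n ⊕ P → Prop)
    (S : Fin n ⊕ Q → Fin k ⊕ Q → Prop) (R' : Fin m' ⊕ P' → Fin n' ⊕ P' → Prop)
    (S' : Fin n' ⊕ Q' → Fin k' ⊕ Q' → Prop) : ∀ s t,
    sumR (compR R S) (compR R' S') s t ↔ compR (sumR R R') (sumR S S')
      (s.map id (Equiv.sumSumSumComm P Q P' Q')) (t.map id (Equiv.sumSumSumComm P Q P' Q')) := by
  simp [Sum.forall, forall_fin_add]

theorem sumR_assoc {m n m' n' m'' n'' : ℕ} (R₁ : Fin m ⊕ P → Fin n ⊕ P → Prop)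
    (R₂ : Fin m' ⊕ Q → Fin n' ⊕ Q → Prop) (R₃ : Fin m'' ⊕ R → Fin n'' ⊕ R → Prop) : ∀ s t,
    sumR R₁ (sumR R₂ R₃) s t ↔
      castR (Nat.add_assoc m m' m'') (Nat.add_assoc n n' n'') (sumR (sumR R₁ R₂) R₃)
        (s.map id (Equiv.sumAssoc P Q R).symm) (t.map id (Equiv.sumAssoc P Q R).symm) := by
  simp [Sum.forall, forall_fin_add]

theorem castR_wireR_sumR {m n : ℕ} (R : Fin m ⊕ P → Fin n ⊕ P → Prop) : ∀ s t,
    castR (Nat.zero_add m) (Nat.zero_add n) (sumR (wireR (Equiv.refl (Fin 0))) R) s t ↔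
      R (s.map id (Equiv.emptySum Empty P)) (t.map id (Equiv.emptySum Empty P)) := by
  simp [Sum.forall, cast_natAdd_zero, -Fin.natAdd_zero]

theorem castR_sumR_wireR {m n : ℕ} (R : Fin m ⊕ P → Fin n ⊕ P → Prop) : ∀ s t,
    castR (Nat.add_zero m) (Nat.add_zero n) (sumR R (wireR (Equiv.refl (Fin 0)))) s t ↔
      R (s.map id (Equiv.sumEmpty P Empty)) (t.map id (Equiv.sumEmpty P Empty)) := by
  have key : ∀ {k : ℕ} (s : Fin k ⊕ (P ⊕ Empty)),
      splitEquiv k 0 P Empty (s.map (Fin.cast (Nat.add_zero k).symm) id) =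
        .inl (s.map id (Equiv.sumEmpty P Empty)) := by
    rintro k (s | s | s)
    · exact splitEquiv_castAdd s
    · rfl
    · exact s.elim
  intro s t
  rw [castR, sumR, key, key, Sum.liftRel_inl_inl]

theorem compR_swap {m n k l : ℕ} (R : Fin m ⊕ P → Fin n ⊕ P → Prop)
    (S : Fin k ⊕ Q → Fin l ⊕ Q → Prop) : ∀ s t,
    compR (sumR R S) (wireR (finAddFlip : Fin (n + l) ≃ Fin (l + n))) s t ↔
      compR (wireR (finAddFlip : Fin (m + k) ≃ Fin (k + m))) (sumR S R)
        (s.map id ((Equiv.sumComm _ _).trans (Equiv.sumCongr (Equiv.refl _) (Equiv.sumComm P Q))))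
        (t.map id
          ((Equiv.sumComm _ _).trans (Equiv.sumCongr (Equiv.refl _) (Equiv.sumComm P Q)))) := by
  simp [Sum.forall, forall_fin_add]

theorem compR_swap_swap (m n : ℕ) : ∀ s t,
    compR (wireR (finAddFlip : Fin (m + n) ≃ Fin (n + m)))
      (wireR (finAddFlip : Fin (n + m) ≃ Fin (m + n))) s t ↔
      wireR (Equiv.refl (Fin (m + n))) (s.map id (Equiv.emptySum Empty Empty))
        (t.map id (Equiv.emptySum Empty Empty)) := by
  simp [Sum.forall, forall_fin_add]

theorem wireR_swap_sum (m n k : ℕ) (e : Empty ≃ (Empty ⊕ Empty) ⊕ (Empty ⊕ Empty)) : ∀ s t,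
    wireR (finAddFlip : Fin (m + (n + k)) ≃ Fin ((n + k) + m)) s t ↔
      compR
        (castR (Nat.add_assoc m n k) (Nat.add_assoc n m k)
          (sumR (wireR (finAddFlip : Fin (m + n) ≃ Fin (n + m))) (wireR (Equiv.refl (Fin k)))))
        (castR rfl (Nat.add_assoc n k m).symm
          (sumR (wireR (Equiv.refl (Fin n))) (wireR (finAddFlip : Fin (m + k) ≃ Fin (k + m)))))
        (s.map id e) (t.map id e) := by
  simp [Sum.forall, forall_fin_add]

theorem trR_natural_left {l m m' n : ℕ} (S : Fin m ⊕ Q → Fin m' ⊕ Q → Prop)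
    (R : Fin (l + m') ⊕ P → Fin (l + n) ⊕ P → Prop) : ∀ s t,
    trR l (compR (sumR (wireR (Equiv.refl (Fin l))) S) R) s t ↔ compR S (trR l R)
      (s.map id (Equiv.sumCongr (Equiv.emptySum Empty Q) (Equiv.refl P)))
      (t.map id (Equiv.sumCongr (Equiv.emptySum Empty Q) (Equiv.refl P))) := by
  -- The edge through `S` comes before everything else and can be factored out of both alternatives.
  have key : ∀ {α β : Type} {p U : α → Prop} {V : α → β → Prop} {W : β → Prop},
      ((∃ a, p a ∧ U a) ∨ ∃ b, (∃ a, p a ∧ V a b) ∧ W b) ↔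
        ∃ a, p a ∧ (U a ∨ ∃ b, V a b ∧ W b) := by
    intros
    constructor
    · rintro (⟨a, h, h'⟩ | ⟨b, ⟨a, h, h'⟩, h''⟩)
      · exact ⟨a, h, .inl h'⟩
      · exact ⟨a, h, .inr ⟨b, h', h''⟩⟩
    · rintro ⟨a, h, h' | ⟨b, h', h''⟩⟩
      · exact .inl ⟨a, h, h'⟩
      · exact .inr ⟨b, ⟨a, h, h'⟩, h''⟩
  simp [Sum.forall]
  exact ⟨fun _ => ⟨fun _ => key, fun _ => key⟩, fun _ => ⟨fun _ => key, fun _ => key⟩⟩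

theorem trR_natural_right {l m n n' : ℕ} (R : Fin (l + m) ⊕ P → Fin (l + n) ⊕ P → Prop)
    (S : Fin n ⊕ Q → Fin n' ⊕ Q → Prop) : ∀ s t,
    trR l (compR R (sumR (wireR (Equiv.refl (Fin l))) S)) s t ↔ compR (trR l R) S
      (s.map id (Equiv.sumCongr (Equiv.refl P) (Equiv.emptySum Empty Q)))
      (t.map id (Equiv.sumCongr (Equiv.refl P) (Equiv.emptySum Empty Q))) := by
  have key : ∀ {α β : Type} {p U : α → Prop} {V : β → Prop} {W : α → β → Prop},
      ((∃ a, U a ∧ p a) ∨ ∃ b, V b ∧ ∃ a, W a b ∧ p a) ↔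
        ∃ a, (U a ∨ ∃ b, V b ∧ W a b) ∧ p a := by
    intros
    constructor
    · rintro (⟨a, h, h'⟩ | ⟨b, h, a, h', h''⟩)
      · exact ⟨a, .inl h, h'⟩
      · exact ⟨a, .inr ⟨b, h, h'⟩, h''⟩
    · rintro ⟨a, h | ⟨b, h, h'⟩, h''⟩
      · exact .inl ⟨a, h, h''⟩
      · exact .inr ⟨b, h, a, h', h''⟩
  simp [Sum.forall, Reach.exists_iff]
  exact ⟨fun _ => ⟨fun _ => key, fun _ => key⟩, fun _ => ⟨fun _ => key, fun _ => key⟩⟩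

theorem trR_dinatural {l l' m n : ℕ} (R : Fin (l + m) ⊕ P → Fin (l' + n) ⊕ P → Prop)
    (S : Fin l' ⊕ Q → Fin l ⊕ Q → Prop) : ∀ s t,
    trR l (compR R (sumR S (wireR (Equiv.refl (Fin n))))) s t ↔
      trR l' (compR (sumR S (wireR (Equiv.refl (Fin m)))) R)
        (s.map id (Equiv.sumComm P (Q ⊕ Empty))) (t.map id (Equiv.sumComm P (Q ⊕ Empty))) := by
  simp [Sum.forall]
  -- One law for each choice of the sides, `R` or `S`, on which the path starts and ends: `h₁` from
  -- `R` to `R`, `h₂` from `R` to `S`, `h₃` from `S` to `S`, `h₄` from `S` to `R`. Entrances and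
  -- exits count as belonging to `R`, being joined to it directly or by identity wires.
  have h₁ := @Reach.slide_entrance _ _
    (fun i j => R (.inl (Fin.castAdd m i)) (.inl (Fin.castAdd n j))) fun j i => S (.inl j) (.inl i)
  have h₂ := @Reach.slide_exit _ _
    (fun i j => R (.inl (Fin.castAdd m i)) (.inl (Fin.castAdd n j))) fun j i => S (.inl j) (.inl i)
  have h₃ := @Reach.slide_entrance _ _
    (fun j i => S (.inl j) (.inl i)) fun i j => R (.inl (Fin.castAdd m i)) (.inl (Fin.castAdd n j))
  have h₄ := @Reach.slide_exit _ _
    (fun j i => S (.inl j) (.inl i)) fun i j => R (.inl (Fin.castAdd m i)) (.inl (Fin.castAdd n j))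
  exact ⟨fun _ => ⟨fun _ => h₁, fun _ => h₁, fun _ => h₂⟩,
    fun _ => ⟨fun _ => h₁, fun _ => h₁, fun _ => h₂⟩,
    fun _ => ⟨fun _ => h₄.symm, fun _ => h₄.symm, fun _ => h₃.symm⟩⟩

theorem trR_zero {m n : ℕ} (R : Fin (0 + m) ⊕ P → Fin (0 + n) ⊕ P → Prop) : ∀ s t,
    trR 0 R s t ↔ castR (Nat.zero_add m) (Nat.zero_add n) R s t := by
  simp [Sum.forall, cast_natAdd_zero, -Fin.natAdd_zero]

theorem trR_add {l k m n : ℕ} (R : Fin ((l + k) + m) ⊕ P → Fin ((l + k) + n) ⊕ P → Prop) :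
    ∀ s t, trR (l + k) R s t ↔
      trR k (trR l (castR (Nat.add_assoc l k m) (Nat.add_assoc l k n) R)) s t := by
  intro s t
  -- Here `E` is the relation on all `l + k` wires and `U` the last edge to `t`; the first edge from
  -- `s` supplies the remaining two arguments.
  refine (reachStaged_iff
    (E := fun x y => R (.inl (Fin.castAdd m x)) (.inl (Fin.castAdd n y)))
    (U := fun x => R (.inl (Fin.castAdd m x)) (shift (l + k) t))).trans ?_
  rcases s with s | s <;> rcases t with t | t <;> simp [ReachStaged, ReachRight, ReachLeft]

theorem trR_sum {l m n m' n' : ℕ} (R : Fin (l + m) ⊕ P → Fin (l + n) ⊕ P → Prop)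
    (S : Fin m' ⊕ Q → Fin n' ⊕ Q → Prop) : ∀ s t,
    trR l (castR (Nat.add_assoc l m m') (Nat.add_assoc l n n') (sumR R S)) s t ↔
      sumR (trR l R) S s t := by
  simp [Sum.forall, forall_fin_add]

theorem trR_swap (m : ℕ) : ∀ s t,
    trR m (wireR (finAddFlip : Fin (m + m) ≃ Fin (m + m))) s t ↔
      wireR (Equiv.refl (Fin m)) s t := by
  simp [Sum.forall, Reach.of_isolated, -Fin.natAdd_eq_addNat]

end EdgeLaws

end MPG

namespace MPG

/-! ### The category of games -/

namespace ROMPG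

theorem comp_E {m l n : ℕ} (A : ROMPG m l) (B : ROMPG l n) : (A.comp B).E = compR A.E B.E := by
  funext s t
  rcases s with s | s | s <;> rcases t with t | t | t <;> rfl

theorem sum_E {m n k l : ℕ} (A : ROMPG m n) (B : ROMPG k l) : (A.sum B).E = sumR A.E B.E := rfl

theorem tr_E {l m n : ℕ} (A : ROMPG (l + m) (l + n)) : (A.tr l).E = trR l A.E :=
  funext fun s => funext fun t => propext (path_iff A (shift l s) (shift l t))

/-- A game with changed arities. -/
def recast {m m' n n' : ℕ} (hm : m = m') (hn : n = n') (A : ROMPG m n) : ROMPG m' n' where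
  Q := A.Q
  finite := A.finite
  E := castR hm hn A.E
  role := A.role
  w := A.w
  entrance := by
    subst hm hn
    simpa [castR] using A.entrance
  exit := by
    subst hm hn
    simpa [castR] using A.exit

/-- The arrow that is represented by a game. -/
def toHom {m n : ℕ} (A : ROMPG m n) : roMPG.Hom m n := Quotient.mk (setoid m n) A

theorem toHom_eq {m n : ℕ} {A B : ROMPG m n} (η : A.Q ≃ B.Q)
    (edge : ∀ s t, A.E s t ↔ B.E (Sum.map id η s) (Sum.map id η t))
    (role_eq : ∀ q, A.role q = B.role (η q)) (w_eq : ∀ q, A.w q = B.w (η q)) :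
    A.toHom = B.toHom := Quotient.sound ⟨⟨η, edge, role_eq, w_eq⟩⟩

theorem cast_toHom {m m' n n' : ℕ} (hm : m = m') (hn : n = n') (A : ROMPG m n) :
    roMPG.cast hm hn A.toHom = (A.recast hm hn).toHom := by
  subst hm hn
  refine toHom_eq (Equiv.refl _) (fun s t => ?_) (fun _ => rfl) fun _ => rfl
  rcases s with s | s <;> rcases t with t | t <;> exact Iff.rfl

theorem exists_toHom {m n : ℕ} (f : roMPG.Hom m n) : ∃ A : ROMPG m n, A.toHom = f :=
  Quotient.exists_rep f

theorem comp_toHom {m l n : ℕ} (A : ROMPG m l) (B : ROMPG l n) :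
    roMPG.comp A.toHom B.toHom = (A.comp B).toHom := rfl

theorem sum_toHom {m n k l : ℕ} (A : ROMPG m n) (B : ROMPG k l) :
    roMPG.sum A.toHom B.toHom = (A.sum B).toHom := rfl

theorem tr_toHom {l m n : ℕ} (A : ROMPG (l + m) (l + n)) :
    roMPG.tr l A.toHom = (A.tr l).toHom := rfl

theorem id_eq_toHom (m : ℕ) : roMPG.id m = (wire (Equiv.refl (Fin m))).toHom := rfl

theorem swap_eq_toHom (m n : ℕ) :
    roMPG.swap m n = (wire (finAddFlip : Fin (m + n) ≃ Fin (n + m))).toHom := rfl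

end ROMPG

open ROMPG

/-- The isomorphisms are the evident bijections of disjoint unions of positions. Their effect on
edges is given by the laws for edge relations; roles and weights agree by computation. -/
theorem isTSMC_roMPG : roMPG.IsTSMC where
  id_comp f := by
    obtain ⟨A, rfl⟩ := exists_toHom f
    refine toHom_eq (A := (wire _).comp A) (Equiv.emptySum Empty A.Q) (fun s t => ?_) ?_ ?_
    · rw [comp_E]
      exact compR_wireR_left A.E s t
    · rintro (q | q)
      · exact q.elim
      · rfl
    · rintro (q | q)
      · exact q.elim
      · rfl
  comp_id f := by
    obtain ⟨A, rfl⟩ := exists_toHom f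
    refine toHom_eq (A := A.comp (wire _)) (Equiv.sumEmpty A.Q Empty) (fun s t => ?_) ?_ ?_
    · rw [comp_E]
      exact compR_wireR_right A.E s t
    · rintro (q | q)
      · rfl
      · exact q.elim
    · rintro (q | q)
      · rfl
      · exact q.elim
  assoc f g h := by
    obtain ⟨A, rfl⟩ := exists_toHom f
    obtain ⟨B, rfl⟩ := exists_toHom g
    obtain ⟨C, rfl⟩ := exists_toHom h
    refine toHom_eq (A := (A.comp B).comp C) (B := A.comp (B.comp C))
      (Equiv.sumAssoc A.Q B.Q C.Q) (fun s t => ?_) ?_ ?_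
    · rw [comp_E, comp_E, comp_E, comp_E]
      exact compR_assoc A.E B.E C.E s t
    · rintro ((q | q) | q) <;> rfl
    · rintro ((q | q) | q) <;> rfl
  sum_id m n := by
    refine toHom_eq (A := (wire _).sum (wire _)) (B := wire _) (Equiv.emptySum Empty Empty)
      (fun s t => ?_) ?_ ?_
    · exact sumR_wireR m n s t
    · rintro (q | q) <;> exact q.elim
    · rintro (q | q) <;> exact q.elim
  sum_comp f g f' g' := by
    obtain ⟨A, rfl⟩ := exists_toHom f
    obtain ⟨B, rfl⟩ := exists_toHom g
    obtain ⟨A', rfl⟩ := exists_toHom f'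
    obtain ⟨B', rfl⟩ := exists_toHom g'
    refine toHom_eq (A := (A.comp B).sum (A'.comp B')) (B := (A.sum A').comp (B.sum B'))
      (Equiv.sumSumSumComm A.Q B.Q A'.Q B'.Q) (fun s t => ?_) ?_ ?_
    · rw [sum_E, comp_E, comp_E, comp_E]
      exact sumR_compR A.E B.E A'.E B'.E s t
    · rintro ((q | q) | (q | q)) <;> rfl
    · rintro ((q | q) | (q | q)) <;> rfl
  sum_assoc f g h := by
    obtain ⟨A, rfl⟩ := exists_toHom f
    obtain ⟨B, rfl⟩ := exists_toHom g
    obtain ⟨C, rfl⟩ := exists_toHom h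
    rw [sum_toHom, sum_toHom, cast_toHom, sum_toHom, sum_toHom]
    symm
    refine toHom_eq (Equiv.sumAssoc A.Q B.Q C.Q).symm (fun s t => ?_) ?_ ?_
    · exact sumR_assoc A.E B.E C.E s t
    · rintro (q | (q | q)) <;> rfl
    · rintro (q | (q | q)) <;> rfl
  zero_sum f := by
    obtain ⟨A, rfl⟩ := exists_toHom f
    rw [id_eq_toHom, sum_toHom, cast_toHom]
    refine toHom_eq (Equiv.emptySum Empty A.Q) (fun s t => ?_) ?_ ?_
    · exact castR_wireR_sumR A.E s t
    · rintro (q | q)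
      · exact q.elim
      · rfl
    · rintro (q | q)
      · exact q.elim
      · rfl
  sum_zero f := by
    obtain ⟨A, rfl⟩ := exists_toHom f
    rw [id_eq_toHom, sum_toHom, cast_toHom]
    refine toHom_eq (Equiv.sumEmpty A.Q Empty) (fun s t => ?_) ?_ ?_
    · exact castR_sumR_wireR A.E s t
    · rintro (q | q)
      · rfl
      · exact q.elim
    · rintro (q | q)
      · rfl
      · exact q.elim
  swap_natural f g := by
    obtain ⟨A, rfl⟩ := exists_toHom f
    obtain ⟨B, rfl⟩ := exists_toHom g
    rw [swap_eq_toHom, swap_eq_toHom, sum_toHom, sum_toHom, comp_toHom, comp_toHom]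
    refine toHom_eq ((Equiv.sumComm _ _).trans
      (Equiv.sumCongr (Equiv.refl Empty) (Equiv.sumComm A.Q B.Q))) (fun s t => ?_) ?_ ?_
    · rw [comp_E, comp_E]
      exact compR_swap A.E B.E s t
    · rintro ((q | q) | q)
      · rfl
      · rfl
      · exact q.elim
    · rintro ((q | q) | q)
      · rfl
      · rfl
      · exact q.elim
  swap_swap m n := by
    rw [swap_eq_toHom, swap_eq_toHom, comp_toHom]
    refine toHom_eq (B := wire _) (Equiv.emptySum Empty Empty) (fun s t => ?_) ?_ ?_
    · rw [comp_E]
      exact compR_swap_swap m n s t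
    · rintro (q | q) <;> exact q.elim
    · rintro (q | q) <;> exact q.elim
  swap_sum m n k := by
    rw [id_eq_toHom, id_eq_toHom, swap_eq_toHom, swap_eq_toHom, swap_eq_toHom, sum_toHom, sum_toHom,
      cast_toHom, cast_toHom, comp_toHom]
    let e : Empty ≃ (Empty ⊕ Empty) ⊕ (Empty ⊕ Empty) := Equiv.equivOfIsEmpty _ _
    refine toHom_eq e (fun s t => ?_) ?_ ?_
    · rw [comp_E]
      exact wireR_swap_sum m n k e s t
    · exact fun q => q.elim
    · exact fun q => q.elim
  tr_natural_left g f := by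
    obtain ⟨A, rfl⟩ := exists_toHom f
    obtain ⟨B, rfl⟩ := exists_toHom g
    rw [id_eq_toHom, sum_toHom, comp_toHom, tr_toHom, tr_toHom, comp_toHom]
    refine toHom_eq (Equiv.sumCongr (Equiv.emptySum Empty B.Q) (Equiv.refl A.Q))
      (fun s t => ?_) ?_ ?_
    · rw [tr_E, comp_E, comp_E, tr_E]
      exact trR_natural_left B.E A.E s t
    · rintro ((q | q) | q)
      · exact q.elim
      · rfl
      · rfl
    · rintro ((q | q) | q)
      · exact q.elim
      · rfl
      · rfl
  tr_natural_right f g := by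
    obtain ⟨A, rfl⟩ := exists_toHom f
    obtain ⟨B, rfl⟩ := exists_toHom g
    rw [id_eq_toHom, sum_toHom, comp_toHom, tr_toHom, tr_toHom, comp_toHom]
    refine toHom_eq (Equiv.sumCongr (Equiv.refl A.Q) (Equiv.emptySum Empty B.Q))
      (fun s t => ?_) ?_ ?_
    · rw [tr_E, comp_E, comp_E, tr_E]
      exact trR_natural_right A.E B.E s t
    · rintro (q | (q | q))
      · rfl
      · exact q.elim
      · rfl
    · rintro (q | (q | q))
      · rfl
      · exact q.elim
      · rfl
  tr_dinatural f g := by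
    obtain ⟨A, rfl⟩ := exists_toHom f
    obtain ⟨B, rfl⟩ := exists_toHom g
    rw [id_eq_toHom, id_eq_toHom, sum_toHom, sum_toHom, comp_toHom, comp_toHom, tr_toHom, tr_toHom]
    refine toHom_eq (Equiv.sumComm A.Q (B.Q ⊕ Empty)) (fun s t => ?_) ?_ ?_
    · rw [tr_E, tr_E, comp_E, comp_E]
      exact trR_dinatural A.E B.E s t
    · rintro (q | (q | q)) <;> rfl
    · rintro (q | (q | q)) <;> rfl
  tr_zero f := by
    obtain ⟨A, rfl⟩ := exists_toHom f
    rw [tr_toHom, cast_toHom]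
    refine toHom_eq (Equiv.refl A.Q) (fun s t => ?_) (fun _ => rfl) fun _ => rfl
    rw [tr_E]
    refine (trR_zero A.E s t).trans ?_
    rcases s with s | s <;> rcases t with t | t <;> exact Iff.rfl
  tr_add f := by
    obtain ⟨A, rfl⟩ := exists_toHom f
    rw [tr_toHom, cast_toHom, tr_toHom, tr_toHom]
    refine toHom_eq (Equiv.refl A.Q) (fun s t => ?_) (fun _ => rfl) fun _ => rfl
    rw [tr_E, tr_E, tr_E]
    refine (trR_add A.E s t).trans ?_
    rcases s with s | s <;> rcases t with t | t <;> exact Iff.rfl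
  tr_sum f g := by
    obtain ⟨A, rfl⟩ := exists_toHom f
    obtain ⟨B, rfl⟩ := exists_toHom g
    rw [sum_toHom, cast_toHom, tr_toHom, tr_toHom, sum_toHom]
    refine toHom_eq (Equiv.refl (A.Q ⊕ B.Q)) (fun s t => ?_) (fun _ => rfl) fun _ => rfl
    rw [tr_E, sum_E, tr_E]
    refine (trR_sum A.E B.E s t).trans ?_
    rcases s with s | s <;> rcases t with t | t <;> exact Iff.rfl
  tr_swap m := by
    rw [swap_eq_toHom, tr_toHom]
    refine toHom_eq (B := wire _) (Equiv.refl Empty) (fun s t => ?_) (fun _ => rfl) fun _ => rfl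
    rw [tr_E]
    refine (trR_swap m s t).trans ?_
    rcases s with s | s <;> rcases t with t | t <;> exact Iff.rfl

end MPG

namespace MPG

/-! ### The solution of a play graph as a trace -/

namespace ROPG

variable {m n : ℕ}

theorem next_eq_none_iff (C : ROPG m n) (s : Fin m ⊕ C.Q) :
    C.next s = none ↔ ∀ t, ¬ C.E s t := by
  rw [Option.eq_none_iff_forall_ne_some]
  exact forall_congr' fun t => not_congr (C.next_eq_some_iff s t)

/-- The result of one step of a play. -/
noncomputable def stepResult (C : ROPG m n) : C.Q ⊕ Fin m → T (C.Q ⊕ Fin n)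
  | .inl q =>
    match C.next (.inr q) with
    | some t => .weighted (C.w q) t.swap
    | none => .winner (C.role q).opponent
  | .inr i =>
    match C.next (.inl i) with
    | some t => .direct t.swap
    -- A default that does not occur, since every entrance has a successor.
    | none => .winner .all

theorem stepResult_position (C : ROPG m n) {q : C.Q} {t : Fin n ⊕ C.Q} (h : C.E (.inr q) t) :
    C.stepResult (.inl q) = .weighted (C.w q) t.swap := by
  rw [stepResult, (C.next_eq_some_iff _ _).2 h]

theorem stepResult_stuck (C : ROPG m n) {q : C.Q} (h : ∀ t, ¬ C.E (.inr q) t) :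
    C.stepResult (.inl q) = .winner (C.role q).opponent := by
  rw [stepResult, (C.next_eq_none_iff _).2 h]

theorem stepResult_entrance (C : ROPG m n) {i : Fin m} {t : Fin n ⊕ C.Q} (h : C.E (.inl i) t) :
    C.stepResult (.inr i) = .direct t.swap := by
  rw [stepResult, (C.next_eq_some_iff _ _).2 h]

/-- The result of the first elements of a play. -/
noncomputable def accumulated (C : ROPG m n) (i : Fin m) (N : ℕ) : T (C.Q ⊕ Fin n) :=
  (C.stepResult (.inr i)).bind
    (Sum.elim (pow (fun q => C.stepResult (.inl q)) N) fun y => .direct (.inr y))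

theorem accumulated_succ (C : ROPG m n) (i : Fin m) (N : ℕ) : C.accumulated i (N + 1) =
    (C.accumulated i N).bind
      (Sum.elim (fun q => C.stepResult (.inl q)) fun y => .direct (.inr y)) := by
  unfold accumulated
  rw [T.bind_assoc]
  congr 1
  funext x
  rcases x with x | x <;> rfl

theorem play_succ (C : ROPG m n) {i : Fin m} {N : ℕ} {t : Fin n ⊕ C.Q}
    (h : C.play i (N + 1) = some t) :
    ∃ q, C.play i N = some (.inr q) ∧ C.next (.inr q) = some t := by
  rw [play] at h
  split at h
  · rename_i q hq
    exact ⟨q, hq, h⟩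
  · cases h

/-- The element at index `N` is preceded by exactly `N` positions. For `N = 0` it directly follows
the entrance, so no weight has been met. -/
theorem accumulated_eq (C : ROPG m n) {i : Fin m} {N : ℕ} {t : Fin n ⊕ C.Q}
    (h : C.play i N = some t) : C.accumulated i N =
      if N = 0 then .direct t.swap
      else .weighted (∑ j ∈ Finset.range N, C.weight (C.play i j)) t.swap := by
  induction N generalizing t with
  | zero =>
    have h1 : C.accumulated i 0 = C.stepResult (.inr i) := T.bind_direct_sum _
    rw [h1, stepResult_entrance C ((C.next_eq_some_iff _ _).1 h), if_pos rfl]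
  | succ N ih =>
    obtain ⟨q, hq, hn⟩ := C.play_succ h
    rw [accumulated_succ, ih hq, if_neg (Nat.succ_ne_zero N), Finset.sum_range_succ, hq]
    have h1 := stepResult_position C ((C.next_eq_some_iff _ _).1 hn)
    split_ifs with h0
    · subst h0
      simp only [Finset.range_zero, Finset.sum_empty, zero_add]
      exact h1
    · change T.bind (T.weighted _ (Sum.inl q)) _ = _
      simp only [T.bind, Sum.elim_inl, h1]
      rfl

theorem trace_eq_accumulated (C : ROPG m n) (i : Fin m) (N : ℕ) :
    trace C.stepResult i = (C.accumulated i N).bind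
      (Sum.elim (iter fun q => C.stepResult (.inl q)) .direct) := by
  unfold trace accumulated
  rw [T.bind_assoc]
  congr 1
  funext x
  rcases x with x | x
  · exact iter_pow _ N x
  · rfl

theorem accumulated_lands (C : ROPG m n) {i : Fin m} {N : ℕ} {t : Fin n ⊕ C.Q}
    (h : C.play i N = some t) : (C.accumulated i N).Lands t.swap ∧
      (C.accumulated i N).weight = ∑ j ∈ Finset.range N, C.weight (C.play i j) := by
  rw [C.accumulated_eq h]
  split_ifs with h0
  · subst h0
    exact ⟨.inl rfl, by simp [T.weight]⟩
  · exact ⟨.inr ⟨_, rfl⟩, rfl⟩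

theorem outcome_of_stops (C : ROPG m n) {i : Fin m} (h : ∃ j, C.play i (j + 1) = none) :
    C.outcome i = trace C.stepResult i := by
  set N := sInf {j | C.play i (j + 1) = none} with hN
  have h1 : C.play i (N + 1) = none := Nat.sInf_mem h
  have h2 : ∃ t, C.play i N = some t := by
    rcases hM : N with _ | M
    · obtain ⟨t, ht⟩ := (C.entrance i).exists
      exact ⟨t, (C.next_eq_some_iff _ _).2 ht⟩
    · rw [← Option.ne_none_iff_exists']
      intro h3
      have := Nat.sInf_le (s := {j | C.play i (j + 1) = none}) h3
      omega
  obtain ⟨t, ht⟩ := h2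
  unfold outcome playOutcome
  rw [if_pos h]
  dsimp only
  rw [← hN, ht, C.trace_eq_accumulated i N]
  rcases t with k | q
  · rw [C.accumulated_eq ht]
    split_ifs <;> rfl
  · symm
    refine T.bind_eq_winner (C.accumulated_lands ht).1 ?_
    change iter _ q = _
    -- The last position has no successor, so a single unfolding of the iteration yields the
    -- opponent.
    rw [play, ht] at h1
    rw [iter_fix, stepResult_stuck C ((C.next_eq_none_iff _).1 h1)]
    rfl

/-- There are finitely many positions, so the play is eventually periodic and its mean payoff is
decided by the boundedness of the partial sums. -/
theorem outcome_of_not_stops (C : ROPG m n) {i : Fin m} (h : ¬ ∃ j, C.play i (j + 1) = none) :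
    C.outcome i = trace C.stepResult i := by
  have hq : ∀ j, ∃ q, C.play i j = some (.inr q) := by
    intro j
    obtain ⟨t, ht⟩ := Option.ne_none_iff_exists'.1 (not_exists.1 h j)
    obtain ⟨q, hq, -⟩ := C.play_succ ht
    exact ⟨q, hq⟩
  choose q hq using hq
  have hacc : ∀ N, (C.accumulated i N).Lands (.inl (q N)) ∧
      (C.accumulated i N).weight = ∑ j ∈ Finset.range N, C.weight (C.play i j) :=
    fun N => C.accumulated_lands (hq N)
  have h0 : (C.stepResult (.inr i)).Lands (.inl (q 0)) := by
    rw [← T.bind_direct_sum (C.stepResult (.inr i))]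
    exact (hacc 0).1
  have hrun : ∀ N, (pow (fun q => C.stepResult (.inl q)) N (q 0)).Lands (.inl (q N)) := by
    intro N
    have h1 := (hacc N).1
    unfold accumulated at h1
    rwa [T.lands_bind_iff h0] at h1
  have hwin : trace C.stepResult i =
      .winner (infWinner fun N => ∑ j ∈ Finset.range N, C.weight (C.play i j)) := by
    refine T.bind_eq_winner h0 ((iter_infinite fun N => ⟨_, hrun N⟩).trans ?_)
    congr 1
    symm
    -- No index is lost, because the step out of the entrance visits no position; whatever its
    -- weight, it is only a constant offset.
    refine infWinner_shift 0 (C.stepResult (.inr i)).weight fun N => ?_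
    rw [Nat.zero_add, ← (hacc N).2]
    exact T.weight_bind h0 (hrun N)
  have := C.finite
  obtain ⟨n₀, p, hp, hper⟩ := eventually_periodic (C.play i)
    (fun z => match z with
      | some (.inr q) => C.next (.inr q)
      | _ => none) fun _ => rfl
  have hmp := meanPayoff_iff (a := fun j => C.weight (C.play i j)) (n₀ := n₀) hp
    fun n hn => by rw [hper n hn]
  rw [hwin]
  unfold outcome playOutcome infWinner
  rw [if_neg h]
  split_ifs <;> tauto

/-- Solving a play graph is itself a trace, over its positions, so the trace laws apply to it. -/
theorem outcome_eq_trace (C : ROPG m n) : C.outcome = trace C.stepResult := by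
  funext i
  by_cases h : ∃ j, C.play i (j + 1) = none
  · exact C.outcome_of_stops h
  · exact C.outcome_of_not_stops h

theorem outcome_entrance (C : ROPG m n) {i : Fin m} {t : Fin n ⊕ C.Q} (h : C.E (.inl i) t) :
    C.outcome i = Sum.elim (iter fun q => C.stepResult (.inl q)) .direct t.swap := by
  rw [outcome_eq_trace, trace, stepResult_entrance C h]
  rfl

/-! ### Operations on play graphs -/

/-- Sequential composition of play graphs. -/
def comp {l : ℕ} (C : ROPG m l) (D : ROPG l n) : ROPG m n where
  toROMPG := C.toROMPG.comp D.toROMPG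
  det s t t' h h' := by
    rw [ROMPG.comp_E] at h h'
    have aux : ∀ {s : Fin m ⊕ C.Q} {j j'}, C.E s (.inl j) → C.E s (.inl j') → j = j' :=
      fun h h' => Sum.inl.inj (C.det _ _ _ h h')
    have aux2 : ∀ {s : Fin m ⊕ C.Q} {j q}, C.E s (.inl j) → ¬ C.E s (.inr q) :=
      fun h h' => by cases C.det _ _ _ h h'
    have aux3 : ∀ {s : Fin l ⊕ D.Q} {j j'}, D.E s (.inl j) → D.E s (.inl j') → j = j' :=
      fun h h' => Sum.inl.inj (D.det _ _ _ h h')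
    have aux4 : ∀ {s : Fin l ⊕ D.Q} {j q}, D.E s (.inl j) → ¬ D.E s (.inr q) :=
      fun h h' => by cases D.det _ _ _ h h'
    have aux5 : ∀ {s : Fin m ⊕ C.Q} {q q'}, C.E s (.inr q) → C.E s (.inr q') → q = q' :=
      fun h h' => Sum.inr.inj (C.det _ _ _ h h')
    have aux6 : ∀ {s : Fin l ⊕ D.Q} {q q'}, D.E s (.inr q) → D.E s (.inr q') → q = q' :=
      fun h h' => Sum.inr.inj (D.det _ _ _ h h')
    rcases s with s | s | s <;> rcases t with t | t | t <;> rcases t' with t' | t' | t' <;>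
      simp only [compR] at h h' <;> grind

theorem comp_E {l : ℕ} (C : ROPG m l) (D : ROPG l n) : (C.comp D).E = compR C.E D.E :=
  ROMPG.comp_E _ _

/-- The sum of play graphs. -/
def sum {k l : ℕ} (C : ROPG m n) (D : ROPG k l) : ROPG (m + k) (n + l) where
  toROMPG := C.toROMPG.sum D.toROMPG
  det s t t' h h' := by
    apply (ROMPG.splitEquiv n l C.Q D.Q).injective
    change Sum.LiftRel C.E D.E (ROMPG.splitEquiv m k C.Q D.Q s) _ at h h'
    generalize ROMPG.splitEquiv n l C.Q D.Q t = x at h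
    generalize ROMPG.splitEquiv n l C.Q D.Q t' = x' at h'
    generalize ROMPG.splitEquiv m k C.Q D.Q s = y at h h'
    cases h with
    | inl h =>
      cases h' with
      | inl h' => rw [C.det _ _ _ h h']
    | inr h =>
      cases h' with
      | inr h' => rw [D.det _ _ _ h h']

/-- A deterministic path leaves no choice before its first target outside the wires, and it cannot
be continued beyond that target. -/
theorem path_det {l : ℕ} (C : ROPG (l + m) (l + n)) {s : Fin (l + m) ⊕ C.Q}
    {u : Fin (l + n) ⊕ C.Q} (hp : C.toROMPG.Path s u) : ∀ a, u = ROMPG.shift l a →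
      ∀ b, C.toROMPG.Path s (ROMPG.shift l b) → b = a := by
  induction hp with
  | @edge s u h =>
    rintro a rfl b hb
    cases hb with
    | edge hb => exact ROMPG.shift_injective l (C.det _ _ _ hb h)
    | loop j hb _ => exact absurd (C.det _ _ _ h hb) (ROMPG.shift_ne a j)
  | @loop s u j h _ ih =>
    rintro a rfl b hb
    cases hb with
    | edge hb => exact absurd (C.det _ _ _ hb h) (ROMPG.shift_ne b j)
    | loop j' hb hb' =>
      have e := Fin.castAdd_injective _ _ (Sum.inl.inj (C.det _ _ _ hb h))
      subst e
      exact ih a rfl b hb'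

/-- The trace of a play graph. -/
def tr (l : ℕ) (C : ROPG (l + m) (l + n)) : ROPG m n where
  toROMPG := C.toROMPG.tr l
  det _ t _ h h' := (C.path_det h t rfl _ h').symm

/-! ### The solution preserves the operations -/

/-- Bekić's identity is applied with the positions of `C` as first block. Plays do not return from
`D` to `C`, so the outer system is that of `D` alone, while the inner one is that of `C` continued
by the entrances of `D`. -/
theorem outcome_comp {l : ℕ} (C : ROPG m l) (D : ROPG l n) (i : Fin m) :
    (C.comp D).outcome i = (C.outcome i).bind D.outcome := by
  have := C.finite
  have := D.finite
  set G := C.comp D with hG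
  have hE : G.E = compR C.E D.E := comp_E C D
  let s : C.Q ⊕ D.Q → T ((C.Q ⊕ D.Q) ⊕ Fin n) := fun q => G.stepResult (.inl q)
  -- Moving from `C` through a shared open end into `D` is one edge of the composite. The step out
  -- of an entrance of `D` is unweighted, so merging it adds nothing to the weight.
  have hinner : innerSystem s = fun q => (C.stepResult (.inl q)).bind
      (Sum.elim (fun q => .direct (.inl q)) fun j => (D.stepResult (.inr j)).map .inr) := by
    funext q
    by_cases hq : ∃ t, C.E (.inr q) t
    · obtain ⟨t, ht⟩ := hq
      rw [stepResult_position C ht]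
      rcases t with j | q'
      · obtain ⟨u, hu, -⟩ := D.entrance j
        have h1 : G.E (.inr (.inl q)) (u.map id .inr) := by
          rw [hE]
          rcases u with u | u <;> exact ⟨j, ht, hu⟩
        change (G.stepResult (.inl (.inl q))).map _ = (T.weighted _ (Sum.inr j)).bind _
        rw [stepResult_position G h1]
        simp only [T.bind, Sum.elim_inr]
        rw [stepResult_entrance D hu]
        rcases u with u | u <;> rfl
      · have h1 : G.E (.inr (.inl q)) (.inr (.inl q')) := by
          rw [hE]
          exact ht
        change (G.stepResult (.inl (.inl q))).map _ = _
        rw [stepResult_position G h1]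
        rfl
    · rw [stepResult_stuck C (not_exists.1 hq)]
      have h1 : ∀ t, ¬ G.E (.inr (.inl q)) t := by
        rw [hE]
        rintro (t | t | t) h
        · exact hq ⟨_, h.choose_spec.1⟩
        · exact hq ⟨_, h⟩
        · exact hq ⟨_, h.choose_spec.1⟩
      change (G.stepResult (.inl (.inl q))).map _ = _
      rw [stepResult_stuck G h1]
      rfl
  have hlast : ∀ q, s (.inr q) =
      (D.stepResult (.inl q)).map (Sum.elim (fun q => .inl (.inr q)) .inr) := by
    intro q
    change G.stepResult (.inl (.inr q)) = _
    by_cases hq : ∃ t, D.E (.inr q) t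
    · obtain ⟨t, ht⟩ := hq
      have h1 : G.E (.inr (.inr q)) (t.map id .inr) := by
        rw [hE]
        rcases t with t | t <;> exact ht
      rw [stepResult_position D ht, stepResult_position G h1]
      rcases t with t | t <;> rfl
    · have h1 : ∀ t, ¬ G.E (.inr (.inr q)) t := by
        rw [hE]
        rintro (t | t | t) h
        · exact hq ⟨_, h⟩
        · exact h
        · exact hq ⟨_, h⟩
      rw [stepResult_stuck D (not_exists.1 hq), stepResult_stuck G h1]
      rfl
  have houter : outerSystem s = fun q => D.stepResult (.inl q) := by
    funext q
    rw [outerSystem, hlast, T.bind_map]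
    refine Eq.trans ?_ (T.bind_direct _)
    congr 1
    funext x
    rcases x with x | x <;> rfl
  have hr : ∀ q, iter s (.inr q) = iter (fun q => D.stepResult (.inl q)) q := by
    intro q
    rw [iter_bekic, bekic, houter]
    rfl
  have hl : ∀ q, iter s (.inl q) =
      (iter (fun q => C.stepResult (.inl q)) q).bind D.outcome := by
    intro q
    rw [iter_bekic, bekic, houter, hinner, iter_natural, Sum.elim_inl, T.bind_assoc,
      outcome_eq_trace]
    rfl
  -- The unweighted first move lies outside the iteration; it may lead straight through `C`.
  obtain ⟨t, ht, -⟩ := C.entrance i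
  rw [outcome_entrance C ht]
  rcases t with j | q
  · obtain ⟨u, hu, -⟩ := D.entrance j
    have h1 : G.E (.inl i) (u.map id .inr) := by
      rw [hE]
      rcases u with u | u <;> exact ⟨j, ht, hu⟩
    rw [outcome_entrance G h1]
    change _ = D.outcome j
    rw [outcome_entrance D hu]
    rcases u with u | u
    · rfl
    · exact hr u
  · have h1 : G.E (.inl i) (.inr (.inl q)) := by
      rw [hE]
      exact ht
    rw [outcome_entrance G h1]
    exact hl q

end ROPG

end MPG

/-! ### Solutions of sums and traces of play graphs -/

namespace MPG

/-- A map of states that commutes with the steps carries runs to runs that have the same weights and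
stop at the same time. It need not be bijective, which is what embeddings into a sum require. -/
theorem iter_hom {S S' Y Z : Type} {h : S → T (S ⊕ Y)} {h' : S' → T (S' ⊕ Z)} {φ : S → S'}
    {g : Y → Z} (H : ∀ s, h' (φ s) = (h s).map (Sum.map φ g)) (s : S) :
    iter h' (φ s) = (iter h s).map g := by
  have hpow : ∀ n, pow h' n (φ s) = (pow h n s).map (Sum.map φ g) := by
    intro n
    induction n with
    | zero => rfl
    | succ n ih =>
      rw [pow, ih, pow, T.bind_map, T.map_bind]
      congr 1
      funext x
      rcases x with x | x
      · exact H x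
      · rfl
  have hrun : ∀ n, (pow h' n (φ s)).Running → (pow h n s).Running := by
    rintro n ⟨x, hx⟩
    rw [hpow] at hx
    obtain ⟨j, hj, hjx⟩ := Play.map_lands hx
    rcases j with j | j
    · exact ⟨j, hj⟩
    · cases hjx
  by_cases hs : Infinite' h s
  · have hs' : Infinite' h' (φ s) := fun n => by
      obtain ⟨x, hx⟩ := hs n
      rw [hpow]
      exact ⟨φ x, T.lands_map hx _⟩
    rw [iter_infinite hs, iter_infinite hs']
    simp only [hpow, T.weight_map]
    rfl
  · obtain ⟨n, hn⟩ := not_forall.1 hs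
    rw [iter_halt hn fun _ => .winner .all, iter_halt (mt (hrun n) hn) fun _ => .winner .all,
      hpow, T.bind_map, T.map_bind]
    congr 1
    funext x
    rcases x with x | x <;> rfl

theorem splitEquiv_map_castAdd {m k : ℕ} {P Q : Type} (s : Fin m ⊕ P) :
    ROMPG.splitEquiv m k P Q (s.map (Fin.castAdd k) .inl) = .inl s := by
  rcases s with s | s
  · exact splitEquiv_castAdd s
  · rfl

theorem splitEquiv_map_natAdd {m k : ℕ} {P Q : Type} (s : Fin k ⊕ Q) :
    ROMPG.splitEquiv m k P Q (s.map (Fin.natAdd m) .inr) = .inr s := by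
  rcases s with s | s
  · exact splitEquiv_natAdd s
  · rfl

namespace ROPG

variable {m n : ℕ}

/-- An embedding of play graphs that reflects edges preserves outcomes. -/
theorem outcome_embedding {m' n' : ℕ} {C : ROPG m n} {D : ROPG m' n'} {α : Fin m → Fin m'}
    {β : Fin n → Fin n'} {φ : C.Q → D.Q}
    (hE : ∀ s t, C.E s t → D.E (s.map α φ) (t.map β φ))
    (hD : ∀ q u, D.E (.inr (φ q)) u → ∃ t, C.E (.inr q) t)
    (hr : ∀ q, D.role (φ q) = C.role q) (hw : ∀ q, D.w (φ q) = C.w q) (i : Fin m) :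
    D.outcome (α i) = (C.outcome i).map β := by
  have hswap : ∀ t : Fin n ⊕ C.Q, (t.map β φ).swap = t.swap.map φ β := by
    rintro (t | t) <;> rfl
  have hstep : ∀ q, D.stepResult (.inl (φ q)) = (C.stepResult (.inl q)).map (Sum.map φ β) := by
    intro q
    by_cases hq : ∃ t, C.E (.inr q) t
    · obtain ⟨t, ht⟩ := hq
      rw [stepResult_position C ht, stepResult_position D (hE _ _ ht), hw, hswap]
      rfl
    · rw [stepResult_stuck C (not_exists.1 hq), stepResult_stuck D fun u hu => hq (hD q u hu), hr]
      rfl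
  obtain ⟨t, ht, -⟩ := C.entrance i
  rw [outcome_entrance C ht, outcome_entrance D (hE _ _ ht)]
  rcases t with t | t
  · rfl
  · exact iter_hom hstep t

theorem outcome_sum_castAdd {k l : ℕ} (C : ROPG m n) (D : ROPG k l) (i : Fin m) :
    (C.sum D).outcome (Fin.castAdd k i) = (C.outcome i).map (Fin.castAdd l) := by
  refine outcome_embedding (D := C.sum D) (φ := Sum.inl) ?_ ?_ (fun _ => rfl) (fun _ => rfl) i
  · exact fun s t h => (congrArg₂ (Sum.LiftRel C.E D.E) (splitEquiv_map_castAdd s)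
      (splitEquiv_map_castAdd t)).mpr (.inl h)
  · intro q u h
    change Sum.LiftRel C.E D.E (.inl (.inr q)) _ at h
    generalize ROMPG.splitEquiv n l C.Q D.Q u = x at h
    cases h with
    | inl h => exact ⟨_, h⟩

theorem outcome_sum_natAdd {k l : ℕ} (C : ROPG m n) (D : ROPG k l) (i : Fin k) :
    (C.sum D).outcome (Fin.natAdd m i) = (D.outcome i).map (Fin.natAdd n) := by
  refine outcome_embedding (D := C.sum D) (φ := Sum.inr) ?_ ?_ (fun _ => rfl) (fun _ => rfl) i
  · exact fun s t h => (congrArg₂ (Sum.LiftRel C.E D.E) (splitEquiv_map_natAdd s)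
      (splitEquiv_map_natAdd t)).mpr (.inr h)
  · intro q u h
    change Sum.LiftRel C.E D.E (.inr (.inr q)) _ at h
    generalize ROMPG.splitEquiv n l C.Q D.Q u = x at h
    cases h with
    | inr h => exact ⟨_, h⟩

section Trace

variable {l : ℕ} (C : ROPG (l + m) (l + n))

/-- The result of one step, with the first `l` open ends separated from the others and in front. -/
noncomputable def wireStep (x : Fin l ⊕ (C.Q ⊕ Fin m)) : T (Fin l ⊕ (C.Q ⊕ Fin n)) :=
  (C.stepResult (x.elim (fun i => .inr (Fin.castAdd m i)) (Sum.map id (Fin.natAdd l)))).map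
    (Sum.elim (fun q => .inr (.inl q)) fun j => (finSumFinEquiv.symm j).map id .inr)

/-- One system on wires and positions, eliminated in two orders: wires before positions on the left,
positions before wires on the right. Both orders agree with the simultaneous trace by vanishing. -/
theorem trace_wireStep_eq : trace (trace C.wireStep) = trace (splitArrow C.solution) := by
  have := C.finite
  let c : C.Q ⊕ (Fin l ⊕ Fin m) → T (C.Q ⊕ (Fin l ⊕ Fin n)) := fun x =>
    (C.stepResult (x.map id finSumFinEquiv)).map (Sum.map id finSumFinEquiv.symm)
  have hc : trace c = splitArrow C.solution := by
    refine (trace_conj _ _ _).trans ?_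
    rw [← outcome_eq_trace]
    rfl
  let F : (C.Q ⊕ Fin l) ⊕ Fin m → T ((C.Q ⊕ Fin l) ⊕ Fin n) := fun x =>
    (c (Equiv.sumAssoc _ _ _ x)).map (Equiv.sumAssoc _ _ _).symm
  have h1 := trace_vanish F
  have h2 : (fun x => (F ((Equiv.sumAssoc C.Q (Fin l) (Fin m)).symm x)).map
      (Equiv.sumAssoc C.Q (Fin l) (Fin n))) = c := by
    funext x
    simp only [F, Equiv.apply_symm_apply, T.map_map]
    exact T.map_id _
  rw [h2, hc, ← trace_equiv (Equiv.sumComm _ _) F, trace_vanish] at h1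
  rw [← h1]
  congr 2
  funext x
  simp only [F, c, T.map_map, wireStep]
  congr 1
  · funext y
    rcases y with y | y
    · rfl
    · obtain ⟨y, rfl⟩ := finSumFinEquiv.surjective y
      rcases y with y | y <;> simp
  · rcases x with x | x | x <;> rfl

/-- Continue along the first `l` open ends as long as possible. -/
noncomputable def wireEnd (u : Fin (l + n) ⊕ C.Q) : T (C.Q ⊕ Fin n) :=
  Sum.elim (fun j => Sum.elim (iter fun i => C.wireStep (.inl i)) (fun j => .direct (.inr j))
    (finSumFinEquiv.symm j)) (fun q => .direct (.inl q)) u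

theorem wireEnd_shift (t : Fin n ⊕ C.Q) : C.wireEnd (ROMPG.shift l t) = .direct t.swap := by
  rcases t with t | t
  · simp [wireEnd, ROMPG.shift]
  · rfl

theorem wireStep_bind (x : Fin l ⊕ (C.Q ⊕ Fin m)) :
    (C.wireStep x).bind (Sum.elim (iter fun i => C.wireStep (.inl i)) .direct) =
      (C.stepResult (x.elim (fun i => .inr (Fin.castAdd m i))
        (Sum.map id (Fin.natAdd l)))).bind fun y => C.wireEnd y.swap := by
  rw [wireStep, T.bind_map]
  congr 1
  funext y
  rcases y with y | y
  · rfl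
  · obtain ⟨y, rfl⟩ := finSumFinEquiv.surjective y
    rcases y with y | y <;> simp [wireEnd]

theorem wireEnd_castAdd {i : Fin l} {u : Fin (l + n) ⊕ C.Q}
    (h : C.E (.inl (Fin.castAdd m i)) u) :
    C.wireEnd (.inl (Fin.castAdd n i)) = C.wireEnd u := by
  have h1 : C.wireEnd (.inl (Fin.castAdd n i)) = iter (fun i => C.wireStep (.inl i)) i := by
    simp [wireEnd]
  rw [h1, iter_fix, wireStep_bind, Sum.elim_inl, stepResult_entrance C h, direct_bind,
    Sum.swap_swap]

/-- All targets met along a path of wires have the same continuation, so the first edge already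
determines where the path ends. -/
theorem exists_edge_of_path {s : Fin (l + m) ⊕ C.Q} {u : Fin (l + n) ⊕ C.Q}
    (h : C.toROMPG.Path s u) : ∃ v, C.E s v ∧ C.wireEnd v = C.wireEnd u := by
  induction h with
  | edge h => exact ⟨_, h, rfl⟩
  | loop i h _ ih =>
    obtain ⟨v, hv, hvu⟩ := ih
    exact ⟨_, h, (C.wireEnd_castAdd hv).trans hvu⟩

/-- Eliminating the wires merges each edge with the wires after it, which is how the edges of the
traced graph arise. -/
theorem trace_wireStep : trace C.wireStep = (C.tr l).stepResult := by
  funext x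
  rw [trace, wireStep_bind]
  rcases x with q | i
  · by_cases hq : ∃ t : Fin n ⊕ C.Q, C.toROMPG.Path (.inr q) (ROMPG.shift l t)
    · obtain ⟨t, ht⟩ := hq
      obtain ⟨v, hv, hvu⟩ := C.exists_edge_of_path ht
      rw [wireEnd_shift] at hvu
      refine Eq.trans ?_ (stepResult_position (C.tr l) ht).symm
      change (C.stepResult (.inl q)).bind _ = _
      rw [stepResult_position C hv]
      simp only [T.bind, Sum.swap_swap, hvu]
      rfl
    · refine Eq.trans ?_ (stepResult_stuck (C.tr l) (not_exists.1 hq)).symm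
      change (C.stepResult (.inl q)).bind _ = _
      -- A position without moves in the trace has none in `C` either: wires entered from a position
      -- cannot cycle, so every edge extends to a path that leaves them.
      have h1 : ∀ u, ¬ C.E (.inr q) u := fun u hu =>
        hq (ROMPG.Path.exists_of_edge C.toROMPG (.inr q) u hu)
      rw [stepResult_stuck C h1]
      rfl
  · obtain ⟨t, ht⟩ : ∃ t : Fin n ⊕ C.Q,
        C.toROMPG.Path (.inl (Fin.natAdd l i)) (ROMPG.shift l t) :=
      ((C.tr l).entrance i).exists
    obtain ⟨v, hv, hvu⟩ := C.exists_edge_of_path ht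
    rw [wireEnd_shift] at hvu
    refine Eq.trans ?_ (stepResult_entrance (C.tr l) (i := i) ht).symm
    change (C.stepResult (.inr (Fin.natAdd l i))).bind _ = _
    rw [stepResult_entrance C hv]
    simp only [T.bind, Sum.swap_swap, hvu]
    rfl

end Trace

/-- Used to compare the graph induced on a compound game with the compound of the induced graphs.
They share positions, roles and weights by definition, and only their edges need an argument. -/
theorem solution_congr {C : ROPG m n}
    {E : Fin m ⊕ C.Q → Fin n ⊕ C.Q → Prop} {fin ent ext det} (h : ∀ s t, C.E s t ↔ E s t) :
    C.solution = (ROPG.mk (ROMPG.mk C.Q fin E C.role C.w ent ext) det).solution := by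
  obtain rfl : C.E = E := funext₂ fun s t => propext (h s t)
  rfl

theorem solution_comp {l : ℕ} (C : ROPG m l) (D : ROPG l n) :
    (C.comp D).solution = SP.comp C.solution D.solution :=
  arrow_injective fun i => (outcome_comp C D i).trans (arrow_comp C.solution D.solution i).symm

theorem solution_sum {k l : ℕ} (C : ROPG m n) (D : ROPG k l) :
    (C.sum D).solution = SP.sum C.solution D.solution := by
  refine arrow_injective fun i => ?_
  refine Fin.addCases (fun i => ?_) (fun i => ?_) i
  · exact (outcome_sum_castAdd C D i).trans (arrow_sum_castAdd C.solution D.solution i).symm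
  · exact (outcome_sum_natAdd C D i).trans (arrow_sum_natAdd C.solution D.solution i).symm

theorem solution_tr {l : ℕ} (C : ROPG (l + m) (l + n)) :
    (C.tr l).solution = SP.tr l C.solution := by
  refine arrow_injective fun i => ?_
  rw [arrow_tr, ← trace_wireStep_eq, trace_wireStep]
  exact congrFun (C.tr l).outcome_eq_trace i

end ROPG

end MPG

namespace MPG

/-! ### Strategies of composed games -/

/-- A choice of an element of a set, which is undefined only if the set is empty. -/
def Legal {X : Type} (U : X → Prop) (o : Option X) : Prop :=
  (∀ t, o = some t → U t) ∧ (o = none → ∀ t, ¬ U t)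

namespace Legal

variable {X Y : Type} {U : X → Prop} {V : Y → Prop} {f : X → Y}

theorem map (hV : ∀ t, V t ↔ ∃ u, U u ∧ f u = t) {o : Option X} (h : Legal U o) :
    Legal V (o.map f) := by
  rcases o with _ | u
  · refine ⟨fun t ht => (by cases ht), fun _ t ht => ?_⟩
    obtain ⟨u, hu, -⟩ := (hV t).1 ht
    exact h.2 rfl u hu
  · refine ⟨?_, fun ht => (by cases ht)⟩
    rintro t ⟨⟩
    exact (hV _).2 ⟨u, h.1 u rfl, rfl⟩

/-- Choices lift along `f` because its image is all of `V`; injectivity is not required. -/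
theorem exists_map (hV : ∀ t, V t ↔ ∃ u, U u ∧ f u = t) {o : Option Y} (h : Legal V o) :
    ∃ o', Legal U o' ∧ o'.map f = o := by
  rcases o with _ | t
  · refine ⟨none, ⟨fun t ht => (by cases ht), fun _ u hu => ?_⟩, rfl⟩
    exact h.2 rfl (f u) ((hV _).2 ⟨u, hu, rfl⟩)
  · obtain ⟨u, hu, rfl⟩ := (hV t).1 (h.1 t rfl)
    refine ⟨some u, ⟨?_, fun ht => (by cases ht)⟩, rfl⟩
    rintro _ ⟨⟩
    exact hu

end Legal

namespace ROMPG

/-! ### Strategies on the union of two sets of positions -/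

section Glue

variable {a b c d m n : ℕ} {A : ROMPG a b} {B : ROMPG c d}
  {E : Fin m ⊕ (A.Q ⊕ B.Q) → Fin n ⊕ (A.Q ⊕ B.Q) → Prop} {fin : Finite (A.Q ⊕ B.Q)}
  {ent : ∀ i : Fin m, ∃! t, E (.inl i) t}
  {ext : ∀ (j : Fin n) (s s' : Fin m ⊕ (A.Q ⊕ B.Q)), E s (.inl j) → E s' (.inl j) → s = s'}
  {f : Fin b ⊕ A.Q → Fin n ⊕ (A.Q ⊕ B.Q)} {g : Fin d ⊕ B.Q → Fin n ⊕ (A.Q ⊕ B.Q)}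

/-- The strategy on a game with the positions of two games that is given by strategies on these. -/
def glueStrategy (hf : ∀ q t, E (.inr (.inl q)) t ↔ ∃ u, A.E (.inr q) u ∧ f u = t)
    (hg : ∀ q t, E (.inr (.inr q)) t ↔ ∃ u, B.E (.inr q) u ∧ g u = t) (p : Role)
    (τ : A.Strategy p) (σ : B.Strategy p) :
    (ROMPG.mk _ fin E (Sum.elim A.role B.role) (Sum.elim A.w B.w) ent ext).Strategy p :=
  ⟨fun
    | ⟨.inl q, h⟩ => (τ.1 ⟨q, h⟩).map f
    | ⟨.inr q, h⟩ => (σ.1 ⟨q, h⟩).map g, by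
    rintro ⟨q | q, h⟩
    · exact Legal.map (hf q) (τ.2 ⟨q, h⟩)
    · exact Legal.map (hg q) (σ.2 ⟨q, h⟩)⟩

/-- Surjectivity is all that is needed, since winning sets only record images. Injectivity may fail:
two exits of the first game can lead to the same position of the second. -/
theorem exists_glueStrategy (hf : ∀ q t, E (.inr (.inl q)) t ↔ ∃ u, A.E (.inr q) u ∧ f u = t)
    (hg : ∀ q t, E (.inr (.inr q)) t ↔ ∃ u, B.E (.inr q) u ∧ g u = t) (p : Role)
    (τ : (ROMPG.mk _ fin E (Sum.elim A.role B.role) (Sum.elim A.w B.w) ent ext).Strategy p) :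
    ∃ τ' σ', glueStrategy hf hg p τ' σ' = τ := by
  have h1 : ∀ q : {q // A.role q = p}, ∃ o, Legal (A.E (.inr q.1)) o ∧
      o.map f = τ.1 ⟨.inl q.1, q.2⟩ := fun q => Legal.exists_map (hf q.1) (τ.2 ⟨.inl q.1, q.2⟩)
  have h2 : ∀ q : {q // B.role q = p}, ∃ o, Legal (B.E (.inr q.1)) o ∧
      o.map g = τ.1 ⟨.inr q.1, q.2⟩ := fun q => Legal.exists_map (hg q.1) (τ.2 ⟨.inr q.1, q.2⟩)
  choose τ' hτ hτ' using h1
  choose σ' hσ hσ' using h2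
  refine ⟨⟨τ', hτ⟩, ⟨σ', hσ⟩, Subtype.ext (funext ?_)⟩
  rintro ⟨q | q, h⟩
  · exact hτ' ⟨q, h⟩
  · exact hσ' ⟨q, h⟩

theorem inducedE_glueStrategy_inl
    (hf : ∀ q t, E (.inr (.inl q)) t ↔ ∃ u, A.E (.inr q) u ∧ f u = t)
    (hg : ∀ q t, E (.inr (.inr q)) t ↔ ∃ u, B.E (.inr q) u ∧ g u = t)
    (τ : A.Strategy .ex) (τ' : B.Strategy .ex) (σ : A.Strategy .all) (σ' : B.Strategy .all)
    (q : A.Q) (t : Fin n ⊕ (A.Q ⊕ B.Q)) :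
    (ROMPG.mk _ fin E (Sum.elim A.role B.role) (Sum.elim A.w B.w) ent ext).inducedE
      (glueStrategy hf hg .ex τ τ') (glueStrategy hf hg .all σ σ') (.inr (.inl q)) t ↔
        ∃ u, A.inducedE τ σ (.inr q) u ∧ f u = t := by
  constructor
  · rintro (⟨h, h'⟩ | ⟨h, h'⟩) <;> obtain ⟨u, hu, rfl⟩ := Option.map_eq_some_iff.1 h'
    · exact ⟨u, .inl ⟨h, hu⟩, rfl⟩
    · exact ⟨u, .inr ⟨h, hu⟩, rfl⟩
  · rintro ⟨u, ⟨h, hu⟩ | ⟨h, hu⟩, rfl⟩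
    · exact .inl ⟨h, Option.map_eq_some_iff.2 ⟨u, hu, rfl⟩⟩
    · exact .inr ⟨h, Option.map_eq_some_iff.2 ⟨u, hu, rfl⟩⟩

theorem inducedE_glueStrategy_inr
    (hf : ∀ q t, E (.inr (.inl q)) t ↔ ∃ u, A.E (.inr q) u ∧ f u = t)
    (hg : ∀ q t, E (.inr (.inr q)) t ↔ ∃ u, B.E (.inr q) u ∧ g u = t)
    (τ : A.Strategy .ex) (τ' : B.Strategy .ex) (σ : A.Strategy .all) (σ' : B.Strategy .all)
    (q : B.Q) (t : Fin n ⊕ (A.Q ⊕ B.Q)) :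
    (ROMPG.mk _ fin E (Sum.elim A.role B.role) (Sum.elim A.w B.w) ent ext).inducedE
      (glueStrategy hf hg .ex τ τ') (glueStrategy hf hg .all σ σ') (.inr (.inr q)) t ↔
        ∃ u, B.inducedE τ' σ' (.inr q) u ∧ g u = t := by
  constructor
  · rintro (⟨h, h'⟩ | ⟨h, h'⟩) <;> obtain ⟨u, hu, rfl⟩ := Option.map_eq_some_iff.1 h'
    · exact ⟨u, .inl ⟨h, hu⟩, rfl⟩
    · exact ⟨u, .inr ⟨h, hu⟩, rfl⟩
  · rintro ⟨u, ⟨h, hu⟩ | ⟨h, hu⟩, rfl⟩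
    · exact .inl ⟨h, Option.map_eq_some_iff.2 ⟨u, hu, rfl⟩⟩
    · exact .inr ⟨h, Option.map_eq_some_iff.2 ⟨u, hu, rfl⟩⟩

open Classical in
/-- The winning positions of a game whose strategies are pairs of strategies on two games, if the
solutions of the induced play graphs are related by a binary operation. -/
theorem winning_eq_image₂ {G : ROMPG m n} {op : SP.Hom a b → SP.Hom c d → SP.Hom m n}
    (s : ∀ p, A.Strategy p → B.Strategy p → G.Strategy p)
    (hs : ∀ p τ, ∃ τ' σ', s p τ' σ' = τ)
    (h : ∀ τ τ' σ σ', (G.induced (s .ex τ τ') (s .all σ σ')).solution =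
      op (A.induced τ σ).solution (B.induced τ' σ').solution) :
    G.winning = Finset.image₂ (Finset.image₂ op) A.winning B.winning := by
  have key : ∀ τ τ', (Finset.univ.image fun σ => (G.induced (s .ex τ τ') σ).solution) =
      Finset.image₂ op (Finset.univ.image fun σ => (A.induced τ σ).solution)
        (Finset.univ.image fun σ => (B.induced τ' σ).solution) := by
    intro τ τ'
    refine Finset.ext fun x => ?_
    simp only [Finset.mem_image, Finset.mem_image₂, Finset.mem_univ, true_and,
      exists_exists_eq_and]
    constructor
    · rintro ⟨σ, rfl⟩
      obtain ⟨σ, σ', rfl⟩ := hs .all σ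
      exact ⟨σ, σ', (h _ _ _ _).symm⟩
    · rintro ⟨σ, σ', rfl⟩
      exact ⟨_, h _ _ _ _⟩
  refine Finset.ext fun x => ?_
  simp only [winning, Finset.mem_image, Finset.mem_image₂, Finset.mem_univ, true_and,
    exists_exists_eq_and]
  constructor
  · rintro ⟨τ, rfl⟩
    obtain ⟨τ, τ', rfl⟩ := hs .ex τ
    exact ⟨τ, τ', (key _ _).symm⟩
  · rintro ⟨τ, τ', rfl⟩
    exact ⟨_, key _ _⟩

open Classical in
theorem winning_eq_image {G : ROMPG m n} {op : SP.Hom a b → SP.Hom m n}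
    (s : ∀ p, A.Strategy p → G.Strategy p) (hs : ∀ p, Function.Surjective (s p))
    (h : ∀ τ σ, (G.induced (s .ex τ) (s .all σ)).solution = op (A.induced τ σ).solution) :
    G.winning = A.winning.image (Finset.image op) := by
  refine Finset.ext fun x => ?_
  simp only [winning, Finset.image_image, Finset.mem_image, Finset.mem_univ, true_and,
    Function.comp_apply]
  rw [(hs .ex).exists]
  refine exists_congr fun τ => ?_
  refine Eq.congr (Finset.ext fun y => ?_) rfl
  simp only [Finset.mem_image, Finset.mem_univ, true_and, Function.comp_apply]
  rw [(hs .all).exists]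
  simp only [h]

end Glue

section Comp

variable {m l n : ℕ} {P Q : Type}

/-- By `hf`, each entrance of the second game has a single successor. Thus the moves in the
composite are the moves in the first game followed by a function. -/
theorem compR_inr_inl {R : Fin m ⊕ P → Fin l ⊕ P → Prop} {S : Fin l ⊕ Q → Fin n ⊕ Q → Prop}
    {f : Fin l → Fin n ⊕ Q} (hf : ∀ j t, S (.inl j) t ↔ f j = t) (q : P)
    (t : Fin n ⊕ (P ⊕ Q)) : compR R S (.inr (.inl q)) t ↔
      ∃ u, R (.inr q) u ∧ Sum.elim (fun j => (f j).map id .inr) (fun p => .inr (.inl p)) u = t := by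
  have h1 : ∀ (x : Fin n ⊕ Q) k, x.map id Sum.inr = (.inl k : Fin n ⊕ (P ⊕ Q)) ↔ x = .inl k := by
    rintro (x | x) k <;> simp
  have h2 : ∀ (x : Fin n ⊕ Q) p, x.map id Sum.inr ≠ (.inr (.inl p) : Fin n ⊕ (P ⊕ Q)) := by
    rintro (x | x) k <;> simp
  have h3 : ∀ (x : Fin n ⊕ Q) q, x.map id Sum.inr = (.inr (.inr q) : Fin n ⊕ (P ⊕ Q)) ↔
      x = .inr q := by
    rintro (x | x) k <;> simp
  rcases t with t | t | t <;> simp [compR, hf, h1, h2, h3]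

theorem compR_inr_inr {R : Fin m ⊕ P → Fin l ⊕ P → Prop} {S : Fin l ⊕ Q → Fin n ⊕ Q → Prop}
    (q : Q) (t : Fin n ⊕ (P ⊕ Q)) : compR R S (.inr (.inr q)) t ↔
      ∃ u, S (.inr q) u ∧ u.map id .inr = t := by
  rcases t with t | t | t <;> simp [compR]

theorem sumR_inr_inl {k : ℕ} {R : Fin m ⊕ P → Fin n ⊕ P → Prop} {S : Fin k ⊕ Q → Fin l ⊕ Q → Prop}
    (q : P) (t : Fin (n + l) ⊕ (P ⊕ Q)) : sumR R S (.inr (.inl q)) t ↔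
      ∃ u, R (.inr q) u ∧ u.map (Fin.castAdd l) .inl = t := by
  rw [sumR, splitEquiv_inr_inl]
  simp only [← (splitEquiv n l P Q).injective.eq_iff, splitEquiv_map_castAdd]
  generalize splitEquiv n l P Q t = x
  rcases x with x | x <;> simp

theorem sumR_inr_inr {k : ℕ} {R : Fin m ⊕ P → Fin n ⊕ P → Prop} {S : Fin k ⊕ Q → Fin l ⊕ Q → Prop}
    (q : Q) (t : Fin (n + l) ⊕ (P ⊕ Q)) : sumR R S (.inr (.inr q)) t ↔
      ∃ u, S (.inr q) u ∧ u.map (Fin.natAdd n) .inr = t := by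
  rw [sumR, splitEquiv_inr_inr]
  simp only [← (splitEquiv n l P Q).injective.eq_iff, splitEquiv_map_natAdd]
  generalize splitEquiv n l P Q t = x
  rcases x with x | x <;> simp

theorem sumR_inl_congr {k : ℕ} {R R' : Fin m ⊕ P → Fin n ⊕ P → Prop}
    {S S' : Fin k ⊕ Q → Fin l ⊕ Q → Prop} (hR : ∀ i t, R (.inl i) t ↔ R' (.inl i) t)
    (hS : ∀ i t, S (.inl i) t ↔ S' (.inl i) t) (i : Fin (m + k)) (t : Fin (n + l) ⊕ (P ⊕ Q)) :
    sumR R S (.inl i) t ↔ sumR R' S' (.inl i) t := by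
  unfold sumR
  refine Fin.addCases (fun i => ?_) (fun i => ?_) i
  · rw [splitEquiv_castAdd]
    generalize splitEquiv n l P Q t = x
    rcases x with x | x <;> simp [hR]
  · rw [splitEquiv_natAdd]
    generalize splitEquiv n l P Q t = x
    rcases x with x | x <;> simp [hS]

/-- The successor of an entrance. -/
noncomputable def first (A : ROMPG m n) (i : Fin m) : Fin n ⊕ A.Q := (A.entrance i).choose

theorem edge_iff_first (A : ROMPG m n) (i : Fin m) (t : Fin n ⊕ A.Q) :
    A.E (.inl i) t ↔ A.first i = t := by
  have h := (A.entrance i).choose_spec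
  constructor
  · exact fun ht => (h.2 t ht).symm
  · rintro rfl
    exact h.1

theorem winning_comp (A : ROMPG m l) (B : ROMPG l n) :
    (A.comp B).winning = Sr.comp A.winning B.winning := by
  have hf := fun q t => (iff_of_eq (congrFun₂ (comp_E A B) (.inr (.inl q)) t)).trans
    (compR_inr_inl (R := A.E) B.edge_iff_first q t)
  have hg := fun q t => (iff_of_eq (congrFun₂ (comp_E A B) (.inr (.inr q)) t)).trans
    (compR_inr_inr (R := A.E) (S := B.E) q t)
  refine winning_eq_image₂ (fun p => glueStrategy hf hg p)
    (fun p τ => exists_glueStrategy hf hg p τ) fun τ τ' σ σ' => ?_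
  -- It remains to see that inducing play graphs commutes with composition on edges.
  refine Eq.trans (ROPG.solution_congr fun s t => ?_)
    (ROPG.solution_comp (A.induced τ σ) (B.induced τ' σ'))
  refine Iff.trans ?_ (iff_of_eq (congrFun₂
    (ROPG.comp_E (A.induced τ σ) (B.induced τ' σ')) s t).symm)
  rcases s with i | q | q
  · refine (iff_of_eq (congrFun₂ (comp_E A B) (.inl i) t)).trans ?_
    rcases t with t | t | t <;> exact Iff.rfl
  · refine (inducedE_glueStrategy_inl hf hg τ τ' σ σ' q t).trans ?_
    exact (compR_inr_inl (S := B.inducedE τ' σ') B.edge_iff_first q t).symm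
  · refine (inducedE_glueStrategy_inr hf hg τ τ' σ σ' q t).trans ?_
    exact (compR_inr_inr q t).symm

theorem winning_sum {k : ℕ} (A : ROMPG m n) (B : ROMPG k l) :
    (A.sum B).winning = Sr.sum A.winning B.winning := by
  have hf := sumR_inr_inl (R := A.E) (S := B.E)
  have hg := sumR_inr_inr (R := A.E) (S := B.E)
  refine winning_eq_image₂ (fun p => glueStrategy hf hg p)
    (fun p τ => exists_glueStrategy hf hg p τ) fun τ τ' σ σ' => ?_
  refine Eq.trans (ROPG.solution_congr fun s t => ?_)
    (ROPG.solution_sum (A.induced τ σ) (B.induced τ' σ'))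
  rcases s with i | q | q
  · exact sumR_inl_congr (R := A.E) (R' := A.inducedE τ σ) (S := B.E) (S' := B.inducedE τ' σ')
      (fun _ _ => Iff.rfl) (fun _ _ => Iff.rfl) i t
  · refine (inducedE_glueStrategy_inl hf hg τ τ' σ σ' q t).trans ?_
    exact (sumR_inr_inl q t).symm
  · refine (inducedE_glueStrategy_inr hf hg τ τ' σ σ' q t).trans ?_
    exact (sumR_inr_inr q t).symm

end Comp

/-! ### Strategies on a trace -/

section Trace

variable {l m n : ℕ}

theorem path_entrance_of_le {A : ROMPG (l + m) (l + n)}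
    {E : Fin (l + m) ⊕ A.Q → Fin (l + n) ⊕ A.Q → Prop} {fin role w ent ext}
    (h : ∀ i t, A.E (.inl i) t → E (.inl i) t) {s : Fin (l + m) ⊕ A.Q}
    {t : Fin (l + n) ⊕ A.Q} (hp : A.Path s t) : ∀ i, s = .inl i →
      (ROMPG.mk A.Q fin E role w ent ext).Path (.inl i) t := by
  induction hp with
  | edge h' =>
    rintro i rfl
    exact .edge (h _ _ h')
  | loop j h' _ ih =>
    rintro i rfl
    exact .loop j (h _ _ h') (ih _ rfl)

/-- Paths from entrances depend only on the edges from entrances. -/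
theorem path_entrance {A : ROMPG (l + m) (l + n)}
    {E : Fin (l + m) ⊕ A.Q → Fin (l + n) ⊕ A.Q → Prop} {fin role w ent ext}
    (h : ∀ i t, A.E (.inl i) t ↔ E (.inl i) t) (i : Fin (l + m)) (t : Fin (l + n) ⊕ A.Q) :
    A.Path (.inl i) t ↔ (ROMPG.mk A.Q fin E role w ent ext).Path (.inl i) t :=
  ⟨fun hp => path_entrance_of_le (fun i t => (h i t).1) hp i rfl,
    fun hp => path_entrance_of_le (A := ROMPG.mk A.Q fin E role w ent ext)
      (fun i t => (h i t).2) hp i rfl⟩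

/-- The target `u` of an edge leads to `t` along the first `l` open ends. -/
def LeadsTo (A : ROMPG (l + m) (l + n)) (u : Fin (l + n) ⊕ A.Q) (t : Fin n ⊕ A.Q) : Prop :=
  u = shift l t ∨
    ∃ i : Fin l, u = .inl (Fin.castAdd n i) ∧ A.Path (.inl (Fin.castAdd m i)) (shift l t)

theorem path_iff_leadsTo (A : ROMPG (l + m) (l + n)) (s : Fin (l + m) ⊕ A.Q) (t : Fin n ⊕ A.Q) :
    A.Path s (shift l t) ↔ ∃ u, A.E s u ∧ A.LeadsTo u t := by
  constructor
  · intro h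
    cases h with
    | edge h => exact ⟨_, h, .inl rfl⟩
    | loop i h h' => exact ⟨_, h, .inr ⟨i, rfl, h'⟩⟩
  · rintro ⟨_, h, rfl | ⟨i, rfl, h'⟩⟩
    · exact .edge h
    · exact .loop i h h'

/-- The play graph of the edges from the entrances and one further edge. -/
def single (A : ROMPG (l + m) (l + n)) (q : A.Q) (u : Fin (l + n) ⊕ A.Q) :
    ROPG (l + m) (l + n) where
  Q := A.Q
  finite := A.finite
  E s t := A.E s t ∧ ((∃ i, s = .inl i) ∨ s = .inr q ∧ t = u)
  role := A.role
  w := A.w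
  entrance i := by
    obtain ⟨t, ht, h⟩ := A.entrance i
    exact ⟨t, ⟨ht, .inl ⟨i, rfl⟩⟩, fun t' ht' => h _ ht'.1⟩
  exit j s s' h h' := A.exit j s s' h.1 h'.1
  det := by
    rintro s t t' ⟨h, ⟨i, rfl⟩ | ⟨rfl, rfl⟩⟩ ⟨h', ⟨i', hi⟩ | ⟨hi, hi'⟩⟩
    · exact (A.entrance i).unique h h'
    · cases hi
    · cases hi
    · exact hi'.symm

/-- The edge from `q` matters: it is the only edge into `u` if `u` is an exit, so the wires behind
`u` cannot form a cycle. Restricting the other positions' edges away gives a play graph, in which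
the path exists and is unique. -/
theorem existsUnique_leadsTo (A : ROMPG (l + m) (l + n)) {q : A.Q} {u : Fin (l + n) ⊕ A.Q}
    (h : A.E (.inr q) u) : ∃! t, A.LeadsTo u t := by
  let C := A.single q u
  have hC : C.E (.inr q) u := ⟨h, .inr ⟨rfl, rfl⟩⟩
  have hl : ∀ t, C.toROMPG.Path (.inr q) (shift l t) ↔ A.LeadsTo u t := by
    intro t
    rw [path_iff_leadsTo]
    have h1 : ∀ i, A.Path (.inl i) (shift l t) ↔ C.toROMPG.Path (.inl i) (shift l t) :=
      fun i => path_entrance (fun i t => ⟨fun ht => ⟨ht, .inl ⟨i, rfl⟩⟩, And.left⟩) i _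
    constructor
    · rintro ⟨v, hv, hv'⟩
      cases C.det _ _ _ hv hC
      exact hv'.imp_right (Exists.imp fun i => And.imp_right (h1 _).2)
    · intro hu
      exact ⟨u, hC, hu.imp_right (Exists.imp fun i => And.imp_right (h1 _).1)⟩
  obtain ⟨t, ht⟩ := Path.exists_of_edge C.toROMPG (.inr q) u hC
  exact ⟨t, (hl t).1 ht, fun t' ht' => C.path_det ht t rfl t' ((hl t').2 ht')⟩

open Classical in
/-- The end of the path along the first `l` open ends that starts with an edge from `q` to `u`. -/
noncomputable def pathEnd (A : ROMPG (l + m) (l + n)) (q : A.Q) (u : Fin (l + n) ⊕ A.Q) :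
    Fin n ⊕ A.Q :=
  -- The default is never used for the target of an edge from `q`.
  if h : ∃ t, A.LeadsTo u t then h.choose else .inr q

theorem leadsTo_iff (A : ROMPG (l + m) (l + n)) {q : A.Q} {u : Fin (l + n) ⊕ A.Q}
    (h : A.E (.inr q) u) (t : Fin n ⊕ A.Q) : A.LeadsTo u t ↔ A.pathEnd q u = t := by
  have hu := A.existsUnique_leadsTo h
  have h1 : A.LeadsTo u (A.pathEnd q u) := by
    rw [pathEnd, dif_pos hu.exists]
    exact hu.exists.choose_spec
  exact ⟨fun ht => hu.unique h1 ht, fun ht => ht ▸ h1⟩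

/-- Moves in the trace are moves in `A` followed by a function, so choices can be transported in
both directions. -/
theorem tr_E_inr (A : ROMPG (l + m) (l + n)) (q : A.Q) (t : Fin n ⊕ A.Q) :
    (A.tr l).E (.inr q) t ↔ ∃ u, A.E (.inr q) u ∧ A.pathEnd q u = t :=
  (A.path_iff_leadsTo (.inr q) t).trans
    (exists_congr fun _ => and_congr_right fun h => A.leadsTo_iff h t)

/-- The strategy on a trace that is given by a strategy. -/
noncomputable def trStrategy (A : ROMPG (l + m) (l + n)) (p : Role) (τ : A.Strategy p) :
    (A.tr l).Strategy p :=
  ⟨fun q => (τ.1 q).map (A.pathEnd q.1), fun q => Legal.map (A.tr_E_inr q.1) (τ.2 q)⟩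

theorem trStrategy_surjective (A : ROMPG (l + m) (l + n)) (p : Role) :
    Function.Surjective (A.trStrategy p) := by
  intro τ
  have h : ∀ q : {q // A.role q = p}, ∃ o, Legal (A.E (.inr q.1)) o ∧
      o.map (A.pathEnd q.1) = τ.1 q := fun q => Legal.exists_map (A.tr_E_inr q.1) (τ.2 q)
  choose τ' hτ hτ' using h
  exact ⟨⟨τ', hτ⟩, Subtype.ext (funext hτ')⟩

/-- Strategies choose only at positions, and a path from an entrance uses no edge out of a position.
-/
theorem path_induced (A : ROMPG (l + m) (l + n)) (τ : A.Strategy .ex) (σ : A.Strategy .all)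
    (i : Fin (l + m)) (t : Fin (l + n) ⊕ A.Q) :
    A.Path (.inl i) t ↔ (A.induced τ σ).toROMPG.Path (.inl i) t :=
  path_entrance (E := A.inducedE τ σ) (fun _ _ => Iff.rfl) i t

theorem winning_tr (A : ROMPG (l + m) (l + n)) :
    (A.tr l).winning = Sr.tr l A.winning := by
  refine winning_eq_image A.trStrategy A.trStrategy_surjective fun τ σ => ?_
  refine Eq.trans (ROPG.solution_congr fun s t => ?_) (ROPG.solution_tr (A.induced τ σ))
  rcases s with i | q
  · exact A.path_induced τ σ (Fin.natAdd l i) (shift l t)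
  · have h1 : ((A.induced τ σ).tr l).E (.inr q) t ↔
        ∃ u, A.inducedE τ σ (.inr q) u ∧ A.pathEnd q u = t := by
      refine ((A.induced τ σ).toROMPG.path_iff_leadsTo (.inr q) t).trans ?_
      refine exists_congr fun u => and_congr_right fun h => ?_
      refine Iff.trans ?_ (A.leadsTo_iff (A.inducedE_le τ σ _ _ h) t)
      exact or_congr_right (exists_congr fun i => and_congr_right fun _ =>
        (A.path_induced τ σ _ _).symm)
    refine Iff.trans ?_ h1.symm
    constructor
    · rintro (⟨h, h'⟩ | ⟨h, h'⟩) <;> obtain ⟨u, hu, rfl⟩ := Option.map_eq_some_iff.1 h'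
      · exact ⟨u, .inl ⟨h, hu⟩, rfl⟩
      · exact ⟨u, .inr ⟨h, hu⟩, rfl⟩
    · rintro ⟨u, ⟨h, hu⟩ | ⟨h, hu⟩, rfl⟩
      · exact .inl ⟨h, Option.map_eq_some_iff.2 ⟨u, hu, rfl⟩⟩
      · exact .inr ⟨h, Option.map_eq_some_iff.2 ⟨u, hu, rfl⟩⟩

end Trace

/-- Without positions there is nothing to choose, but the empty strategies exist; hence both sets
are nonempty images of constant functions. -/
theorem winning_wire {m n : ℕ} (σ : Fin m ≃ Fin n) (f : SP.Hom m n)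
    (hf : ∀ i, arrow f i = .direct (σ i)) : (wire σ).winning = ({{f}} : Finset (Finset (SP.Hom m n))) := by
  classical
  have hs : ∀ p, Nonempty ((wire σ).Strategy p) := fun p =>
    ⟨⟨fun q => q.1.elim, fun q => q.1.elim⟩⟩
  have h : ∀ τ τ', ((wire σ).induced τ τ').solution = f := by
    intro τ τ'
    refine arrow_injective fun i => (hf i).symm ▸ ?_
    exact ((wire σ).induced τ τ').outcome_entrance (t := .inl (σ i)) ⟨i, rfl, rfl⟩
  have := hs .ex
  have := hs .all
  unfold winning
  simp only [h]
  rw [Finset.image_const Finset.univ_nonempty, Finset.image_const Finset.univ_nonempty]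

end ROMPG

theorem isTracedFunctor_Wr : TracedData.IsTracedFunctor roMPG Sr Wr where
  map_id m := ROMPG.winning_wire _ _ (arrow_id m)
  map_comp f g := by
    obtain ⟨A, rfl⟩ := ROMPG.exists_toHom f
    obtain ⟨B, rfl⟩ := ROMPG.exists_toHom g
    exact A.winning_comp B
  map_sum f g := by
    obtain ⟨A, rfl⟩ := ROMPG.exists_toHom f
    obtain ⟨B, rfl⟩ := ROMPG.exists_toHom g
    exact A.winning_sum B
  map_swap m n := ROMPG.winning_wire _ _ (arrow_swap m n)
  map_tr f := by
    obtain ⟨A, rfl⟩ := ROMPG.exists_toHom f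
    exact A.winning_tr

end MPG

theorem mainTheorem3 :
    MPG.roMPG.IsTSMC ∧ MPG.Sr.IsTSMC ∧
      MPG.TracedData.IsTracedFunctor MPG.roMPG MPG.Sr MPG.Wr :=
  ⟨MPG.isTSMC_roMPG, MPG.isTSMC_Sr, MPG.isTracedFunctor_Wr⟩
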